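/- Let $X$ be a complex Banach space and $1\le p<\infty$. Let $\mathfrak p=(\mathfrak p_n)_{n\ge1}$ be the increasing sequence of the primes; for a finitely supported multi-index $\alpha$ write $z^\alpha=\prod_n z_n^{\alpha_n}$ and $\mathfrak p^\alpha=\prod_n\mathfrak p_n^{\alpha_n}$. All tori $\mathbb T^m$ and $\mathbb T^{\mathbb N}$ carry normalized Haar measure. *Holomorphic functions.* $B_{c_0}\cap\ell_2=\{z\in\ell_2:\sup_n|z_n|<1\}$ is regarded as an open subset of $\ell_2$. $H_p(B_{c_0}\cap\ell_2,X)$ is the space of all holomorphic $F:B_{c_0}\cap\ell_2\to X$ with $$\|F\|:=\sup_{m}\ \sup_{0<r<1}\Big(\int_{\mathbb T^m}\|F(r\omega_1,\dots,r\omega_m,0,0,\dots)\|_X^p\,d\omega\Big)^{1/p}<\infty .$$ Each such $F$ has unique monomial coefficients $c_\alpha(F)\in X$ ($\alpha\in\mathbb N_0^{(\mathbb N)}$, the finitely supported sequences in $\mathbb N_0$), determined by $F(z_1,\dots,z_m,0,0,\dots)=\sum_{\alpha\in\mathbb N_0^m}c_\alpha(F)z^\alpha$ for all $m$ and all $z\in\mathbb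 D^m$. *Dirichlet series.* Let $H_p(\mathbb T^{\mathbb N},X)$ be the space of all $f$ in the Bochner space $L_p(\mathbb T^{\mathbb N},X)$ whose Fourier coefficients $\hat f(\alpha)=\int f(\omega)\omega^{-\alpha}\,d\omega$ vanish for all $\alpha\in\mathbb Z^{(\mathbb N)}\setminus\mathbb N_0^{(\mathbb N)}$. A formal Dirichlet series $D=\sum_{n\ge1} a_nn^{-s}$ with coefficients in $X$ belongs to $\mathcal H_p(X)$ if there is a (necessarily unique) $f\in H_p(\mathbb T^{\mathbb N},X)$ with $\hat f(\alpha)=a_{\mathfrak p^\alpha}$ for all $\alpha\in\mathbb N_0^{(\mathbb N)}$, and then $\|D\|_{\mathcal H_p(X)}:=\|f\|_{L_p}$. Let $\mathcal H_p^+(X)$ be the space of all Dirichlet series $D=\sum_n a_nn^{-s}$ such that $D_\varepsilon:=\sum_n\frac{a_n}{n^\varepsilon}n^{-s}\in\mathcal H_p(X)$ for every $\varepsilon>0$ and $\|D\|_{\mathcal H_p^+(X)}:=\sup_{\varepsilon>0}\|D_\varepsilon\|_{\mathcal H_p(X)}<\infty$. **Theorem.** The Bohr transform $\mathcal B$, which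 sends $F$ to the Dirichlet series $\sum_n a_nn^{-s}$ with $a_{\mathfrak p^\alpha}=c_\alpha(F)$ for all $\alpha\in\mathbb N_0^{(\mathbb N)}$, is a well-defined linear isometry from $H_p(B_{c_0}\cap\ell_2,X)$ onto $\mathcal H_p^+(X)$. Moreover, if $\mathcal B(F)=\sum_n a_nn^{-s}$, then for every $s\in\mathbb C$ with $\operatorname{Re}s>1/2$ the series $\sum_{n=1}^\infty a_nn^{-s}$ converges in $X$ (as the limit of its partial sums $\sum_{n\le N}$), and $$F(\mathfrak p^{-s})=\sum_{n=1}^\infty a_nn^{-s},\qquad \mathfrak p^{-s}=(\mathfrak p_1^{-s},\mathfrak p_2^{-s},\dots).$$ -/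

import Mathlib

open MeasureTheory Filter Topology
open scoped ENNReal

noncomputable section

namespace BohrHardy

variable {X : Type*} [NormedAddCommGroup X] [NormedSpace ℂ X]

/-! ### The infinite torus, its Fourier coefficients, and Hardy spaces on it -/

/-- The infinite torus `𝕋^ℕ`. A point is a sequence of angles `x n ∈ ℝ/ℤ`; it stands for
`ω = (e^{2πi x 0}, e^{2πi x 1}, …)`, and `ω n ^ k` is Mathlib's `fourier k (x n)`. -/
abbrev Torus : Type := ℕ → UnitAddCircle

/-- The normalized Haar measure of `𝕋^ℕ`: the product of the normalized Haar measures of `𝕋`. -/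
def haarTorus : Measure Torus :=
  Measure.infinitePi (fun _ : ℕ => (AddCircle.haarAddCircle : Measure UnitAddCircle))

instance : IsProbabilityMeasure haarTorus := by
  unfold haarTorus; infer_instance

/-- The monomial `ω^α`, for a finitely supported sequence of integers `α`. -/
def character (α : ℕ →₀ ℤ) (x : Torus) : ℂ := α.prod fun n k => fourier k (x n)

/-- The Fourier coefficient `∫ f(ω) ω^{-α} dω`. -/
def torusCoeff (f : Torus → X) (α : ℕ →₀ ℤ) : X :=
  ∫ x, character (-α) x • f x ∂haarTorus

/-- A multi-index with entries in `ℕ`, seen as one with entries in `ℤ`. -/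
def intIndex (α : ℕ →₀ ℕ) : ℕ →₀ ℤ := α.mapRange (fun k : ℕ => (k : ℤ)) Nat.cast_zero

/-- The members of `H_p(𝕋^ℕ, X)`: the `f ∈ L_p(𝕋^ℕ, X)` whose Fourier coefficients vanish at
every multi-index that has a negative entry. -/
def MemHardyTorus {p : ℝ≥0∞} (f : Lp X p haarTorus) : Prop :=
  ∀ α : ℕ →₀ ℤ, (∃ n, α n < 0) → torusCoeff f α = 0

/-! ### Dirichlet series -/

/-- The `n`-th prime, starting with `prime 0 = 2`. -/
def prime (n : ℕ) : ℕ+ := ⟨Nat.nth Nat.Prime n, (Nat.prime_nth_prime n).pos⟩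

/-- The positive integer `𝔭^α`. -/
def primePow (α : ℕ →₀ ℕ) : ℕ+ := α.prod fun n k => prime n ^ k

/-- A (formal) Dirichlet series `∑_{n ≥ 1} a_n n^{-s}`, given by its coefficients. -/
abbrev DirichletSeries (X : Type*) : Type _ := ℕ+ → X

/-- The translation `D_z = ∑ (a_n / n^z) n^{-s}` of a Dirichlet series. -/
def translate (z : ℂ) (a : DirichletSeries X) : DirichletSeries X :=
  fun n => ((n : ℕ) : ℂ) ^ (-z) • a n

/-- The functions `f ∈ H_p(𝕋^ℕ, X)` whose image under the Bohr transform is the Dirichlet series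
`a`, that is, whose Fourier coefficient at `α` is `a (𝔭^α)` for every `α` with entries in `ℕ`.
There is at most one, as Fourier coefficients determine a function in `L_p`. -/
def torusLifts (p : ℝ≥0∞) (a : DirichletSeries X) : Set (Lp X p haarTorus) :=
  {f | MemHardyTorus f ∧ ∀ α : ℕ →₀ ℕ, torusCoeff f (intIndex α) = a (primePow α)}

/-- Membership in `𝓗_p(X)`, the image of `H_p(𝕋^ℕ, X)` under the Bohr transform. -/
def MemHardyDirichlet (p : ℝ≥0∞) (a : DirichletSeries X) : Prop := (torusLifts p a).Nonempty

/-- The norm of `𝓗_p(X)`: the `L_p`-norm of the unique function in `torusLifts p a`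
(and `∞` if there is none). -/
def hardyDirichletNorm (p : ℝ≥0∞) (a : DirichletSeries X) : ℝ≥0∞ :=
  ⨅ f ∈ torusLifts p a, ‖f‖ₑ

/-- The norm of `𝓗⁺_p(X)`: the supremum over `ε > 0` of the `𝓗_p(X)`-norms of the
translations `D_ε`. -/
def hardyPlusNorm (p : ℝ≥0∞) (a : DirichletSeries X) : ℝ≥0∞ :=
  ⨆ (ε : ℝ) (_ : 0 < ε), hardyDirichletNorm p (translate (ε : ℂ) a)

lemma measurable_character (α : ℕ →₀ ℤ) : Measurable (character α) := by
  unfold character Finsupp.prod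
  refine Finset.measurable_prod _ fun n _ => ?_
  exact (fourier (α n)).continuous.measurable.comp (measurable_pi_apply n)

lemma norm_character (α : ℕ →₀ ℤ) (x : Torus) : ‖character α x‖ = 1 := by
  unfold character Finsupp.prod
  rw [norm_prod]
  exact Finset.prod_eq_one fun n _ => by
    simp only [fourier_apply, Circle.norm_coe]

lemma integrable_character_smul {p : ℝ≥0∞} [hp : Fact (1 ≤ p)] (f : Lp X p haarTorus)
    (α : ℕ →₀ ℤ) : Integrable (fun x => character α x • f x) haarTorus :=
  ((Lp.memLp f).integrable hp.out).bdd_smul 1 (measurable_character α).aestronglyMeasurable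
    (ae_of_all _ fun x => (norm_character α x).le)

lemma torusCoeff_zero {p : ℝ≥0∞} (α : ℕ →₀ ℤ) :
    torusCoeff (0 : Lp X p haarTorus) α = 0 := by
  unfold torusCoeff
  refine integral_eq_zero_of_ae ?_
  filter_upwards [Lp.coeFn_zero X p haarTorus] with x hx
  rw [hx]; simp

lemma torusCoeff_add {p : ℝ≥0∞} [Fact (1 ≤ p)] (f g : Lp X p haarTorus) (α : ℕ →₀ ℤ) :
    torusCoeff (f + g : Lp X p haarTorus) α = torusCoeff f α + torusCoeff g α := by
  unfold torusCoeff
  rw [← integral_add (integrable_character_smul f _) (integrable_character_smul g _)]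
  refine integral_congr_ae ?_
  filter_upwards [Lp.coeFn_add f g] with x hx
  rw [hx, Pi.add_apply, smul_add]

lemma torusCoeff_smul {p : ℝ≥0∞} (c : ℂ) (f : Lp X p haarTorus) (α : ℕ →₀ ℤ) :
    torusCoeff (c • f : Lp X p haarTorus) α = c • torusCoeff f α := by
  unfold torusCoeff
  rw [← integral_smul]
  refine integral_congr_ae ?_
  filter_upwards [Lp.coeFn_smul c f] with x hx
  rw [hx, Pi.smul_apply, smul_comm]

lemma torusLifts_zero (p : ℝ≥0∞) :
    (0 : Lp X p haarTorus) ∈ torusLifts p (0 : DirichletSeries X) :=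
  ⟨fun _ _ => torusCoeff_zero _, fun _ => torusCoeff_zero _⟩

lemma torusLifts_add {p : ℝ≥0∞} [Fact (1 ≤ p)] {a b : DirichletSeries X}
    {f g : Lp X p haarTorus} (hf : f ∈ torusLifts p a) (hg : g ∈ torusLifts p b) :
    f + g ∈ torusLifts p (a + b) := by
  refine ⟨fun α h => ?_, fun α => ?_⟩
  · rw [torusCoeff_add, hf.1 α h, hg.1 α h, add_zero]
  · rw [torusCoeff_add, hf.2 α, hg.2 α, Pi.add_apply]

lemma torusLifts_smul {p : ℝ≥0∞} (c : ℂ) {a : DirichletSeries X}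
    {f : Lp X p haarTorus} (hf : f ∈ torusLifts p a) :
    c • f ∈ torusLifts p (c • a) := by
  refine ⟨fun α h => ?_, fun α => ?_⟩
  · rw [torusCoeff_smul, hf.1 α h, smul_zero]
  · rw [torusCoeff_smul, hf.2 α, Pi.smul_apply]

lemma translate_zero (z : ℂ) : translate z (0 : DirichletSeries X) = 0 := by
  ext n; simp [translate]

lemma translate_add (z : ℂ) (a b : DirichletSeries X) :
    translate z (a + b) = translate z a + translate z b := by
  ext n; simp [translate]

lemma translate_smul (z c : ℂ) (a : DirichletSeries X) :
    translate z (c • a) = c • translate z a := by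
  ext n; simp [translate, smul_comm c]

lemma hardyDirichletNorm_le {p : ℝ≥0∞} {a : DirichletSeries X} {f : Lp X p haarTorus}
    (hf : f ∈ torusLifts p a) : hardyDirichletNorm p a ≤ ‖f‖ₑ :=
  iInf₂_le f hf

lemma hardyDirichletNorm_add {p : ℝ≥0∞} [Fact (1 ≤ p)] (a b : DirichletSeries X) :
    hardyDirichletNorm p (a + b) ≤ hardyDirichletNorm p a + hardyDirichletNorm p b := by
  have h : ∀ f ∈ torusLifts p a, ∀ g ∈ torusLifts p b,
      hardyDirichletNorm p (a + b) ≤ ‖f‖ₑ + ‖g‖ₑ := fun f hf g hg =>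
    (hardyDirichletNorm_le (torusLifts_add hf hg)).trans (enorm_add_le f g)
  conv_rhs => unfold hardyDirichletNorm
  rw [iInf_subtype' (p := fun f => f ∈ torusLifts p a) (f := fun f _ => ‖f‖ₑ),
    iInf_subtype' (p := fun f => f ∈ torusLifts p b) (f := fun f _ => ‖f‖ₑ), ENNReal.iInf_add]
  refine le_iInf fun f => ?_
  rw [ENNReal.add_iInf]
  exact le_iInf fun g => h f f.2 g g.2

lemma hardyDirichletNorm_smul {p : ℝ≥0∞} [Fact (1 ≤ p)] (c : ℂ) (a : DirichletSeries X)
    (ha : MemHardyDirichlet p a) :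
    hardyDirichletNorm p (c • a) ≤ ‖c‖ₑ * hardyDirichletNorm p a := by
  have hne : Nonempty (torusLifts p a) := ha.to_subtype
  conv_rhs => unfold hardyDirichletNorm
  rw [iInf_subtype' (p := fun f => f ∈ torusLifts p a) (f := fun f _ => ‖f‖ₑ),
    ENNReal.mul_iInf fun h => absurd h enorm_ne_top]
  exact le_iInf fun f => (hardyDirichletNorm_le (torusLifts_smul c f.2)).trans enorm_smul_le

/-- The space `𝓗⁺_p(X)` of all Dirichlet series `D` such that `D_ε ∈ 𝓗_p(X)` for every `ε > 0`
and `sup_{ε > 0} ‖D_ε‖ < ∞`. -/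
def HardyPlus (X : Type*) [NormedAddCommGroup X] [NormedSpace ℂ X] (p : ℝ≥0∞) [Fact (1 ≤ p)] :
    Submodule ℂ (DirichletSeries X) where
  carrier := {a | (∀ ε : ℝ, 0 < ε → MemHardyDirichlet p (translate (ε : ℂ) a)) ∧
    hardyPlusNorm p a < ∞}
  zero_mem' := by
    have h0 : ∀ ε : ℝ, (0 : Lp X p haarTorus) ∈
        torusLifts p (translate (ε : ℂ) (0 : DirichletSeries X)) := fun ε => by
      rw [translate_zero]; exact torusLifts_zero p
    refine ⟨fun ε _ => ⟨0, h0 ε⟩, lt_of_le_of_lt (b := 0) ?_ ENNReal.zero_lt_top⟩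
    exact iSup₂_le fun ε _ => (iInf₂_le 0 (h0 ε)).trans (by simp)
  add_mem' := by
    rintro a b ⟨ha, ha'⟩ ⟨hb, hb'⟩
    refine ⟨fun ε hε => ?_, lt_of_le_of_lt ?_ (ENNReal.add_lt_top.2 ⟨ha', hb'⟩)⟩
    · obtain ⟨f, hf⟩ := ha ε hε
      obtain ⟨g, hg⟩ := hb ε hε
      rw [translate_add]
      exact ⟨f + g, torusLifts_add hf hg⟩
    · refine iSup₂_le fun ε hε => ?_
      rw [translate_add]
      refine (hardyDirichletNorm_add _ _).trans (add_le_add ?_ ?_)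
      · exact le_iSup₂ (f := fun (ε : ℝ) (_ : 0 < ε) =>
          hardyDirichletNorm p (translate (ε : ℂ) a)) ε hε
      · exact le_iSup₂ (f := fun (ε : ℝ) (_ : 0 < ε) =>
          hardyDirichletNorm p (translate (ε : ℂ) b)) ε hε
  smul_mem' := by
    rintro c a ⟨ha, ha'⟩
    refine ⟨fun ε hε => ?_,
      lt_of_le_of_lt ?_ (ENNReal.mul_lt_top (enorm_lt_top (x := c)) ha')⟩
    · obtain ⟨f, hf⟩ := ha ε hε
      rw [translate_smul]
      exact ⟨c • f, torusLifts_smul c hf⟩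
    · refine iSup₂_le fun ε hε => ?_
      rw [translate_smul]
      refine (hardyDirichletNorm_smul _ _ (ha ε hε)).trans (mul_le_mul_right ?_ _)
      exact le_iSup₂ (f := fun (ε : ℝ) (_ : 0 < ε) =>
          hardyDirichletNorm p (translate (ε : ℂ) a)) ε hε

/-! ### Hardy spaces of holomorphic functions on `B_{c₀} ∩ ℓ₂` -/

/-- The sequence space `ℓ₂`. -/
abbrev EllTwo : Type := lp (fun _ : ℕ => ℂ) 2

/-- `B_{c₀} ∩ ℓ₂`, a subset of `ℓ₂`. (For a null sequence, `sup_n |z_n| < 1` means that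
`|z_n| < 1` for all `n`.) -/
def ballEllTwo : Set EllTwo := {z | ∀ n, ‖z n‖ < 1}

/-- Holomorphy on the open subset `B_{c₀} ∩ ℓ₂` of the Banach space `ℓ₂`: complex Fréchet
differentiability at every point. -/
def Holomorphic (F : ballEllTwo → X) : Prop :=
  ∃ G : EllTwo → X, DifferentiableOn ℂ G ballEllTwo ∧ ∀ z : ballEllTwo, G z = F z

/-- The polydisc `𝔻^m`. -/
def polydisc (m : ℕ) : Set (Fin m → ℂ) := {z | ∀ i, ‖z i‖ < 1}

/-- The sequence `(z_1, …, z_m, 0, 0, …)` in `ℓ₂`. -/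
def padSeq {m : ℕ} (z : Fin m → ℂ) : EllTwo :=
  ∑ i : Fin m, lp.single 2 (i : ℕ) (z i)

lemma padSeq_apply {m : ℕ} (z : Fin m → ℂ) (n : ℕ) :
    padSeq z n = if h : n < m then z ⟨n, h⟩ else 0 := by
  unfold padSeq
  rw [lp.coeFn_sum, Finset.sum_apply]
  simp only [lp.single_apply]
  split_ifs with h
  · rw [Finset.sum_eq_single ⟨n, h⟩]
    · simp
    · intro i _ hi
      refine Pi.single_eq_of_ne (fun hn => hi ?_) _
      exact Fin.ext hn.symm
    · simp
  · refine Finset.sum_eq_zero fun i _ => Pi.single_eq_of_ne (fun hn => h ?_) _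
    rw [hn]; exact i.2

/-- The point `(z_1, …, z_m, 0, 0, …)` of `B_{c₀} ∩ ℓ₂`, for `z ∈ 𝔻^m`. -/
def pad {m : ℕ} (z : polydisc m) : ballEllTwo :=
  ⟨padSeq z.1, fun n => by
    rw [padSeq_apply]
    split_ifs with h
    · exact z.2 _
    · simp⟩

/-- The point `(r ω_1, …, r ω_m)` of `𝔻^m`, for `0 < r < 1` and `ω ∈ 𝕋^m`. -/
def scaled {m : ℕ} (r : Set.Ioo (0 : ℝ) 1) (x : Fin m → UnitAddCircle) : polydisc m :=
  ⟨fun i => (r.1 : ℂ) * fourier 1 (x i), fun i => by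
    rw [norm_mul, fourier_apply, Circle.norm_coe, mul_one, Complex.norm_real,
      Real.norm_of_nonneg r.2.1.le]
    exact r.2.2⟩

/-- The normalized Haar measure of `𝕋^m`. -/
def haarFinTorus (m : ℕ) : Measure (Fin m → UnitAddCircle) :=
  Measure.pi fun _ => AddCircle.haarAddCircle

/-- The norm of `H_p(B_{c₀} ∩ ℓ₂, X)`:
`sup_m sup_{0 < r < 1} (∫_{𝕋^m} ‖F(r ω_1, …, r ω_m, 0, …)‖^p dω)^{1/p}`. -/
def hardyBallNorm (p : ℝ≥0∞) (F : ballEllTwo → X) : ℝ≥0∞ :=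
  ⨆ (m : ℕ) (r : Set.Ioo (0 : ℝ) 1),
    eLpNorm (fun x : Fin m → UnitAddCircle => F (pad (scaled r x))) p (haarFinTorus m)

lemma Holomorphic.continuous {F : ballEllTwo → X} (hF : Holomorphic F) : Continuous F := by
  obtain ⟨G, hG, hGF⟩ := hF
  have h := continuousOn_iff_continuous_domRestrict.1 hG.continuousOn
  convert h using 1
  ext z
  exact (hGF z).symm

lemma continuous_single (i : ℕ) : Continuous fun c : ℂ => (lp.single 2 i c : EllTwo) := by
  have h : Isometry (lp.singleAddMonoidHom (E := fun _ : ℕ => ℂ) 2 i) :=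
    AddMonoidHomClass.isometry_of_norm _ fun c =>
      lp.norm_single (E := fun _ : ℕ => ℂ) (p := 2) (by norm_num) i c
  exact h.continuous

lemma continuous_pad_scaled {m : ℕ} (r : Set.Ioo (0 : ℝ) 1) :
    Continuous fun x : Fin m → UnitAddCircle => pad (scaled r x) := by
  have h : Continuous fun x : Fin m → UnitAddCircle => padSeq (scaled r x).1 := by
    unfold padSeq
    refine continuous_finsetSum _ fun i _ => (continuous_single (i : ℕ)).comp ?_
    exact continuous_const.mul ((fourier 1).continuous.comp (continuous_apply i))
  exact h.subtype_mk _

lemma hardyBallNorm_add {p : ℝ≥0∞} [hp : Fact (1 ≤ p)] {F G : ballEllTwo → X}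
    (hF : Holomorphic F) (hG : Holomorphic G) :
    hardyBallNorm p (F + G) ≤ hardyBallNorm p F + hardyBallNorm p G := by
  refine iSup₂_le fun m r => ?_
  have hmeas : ∀ H : ballEllTwo → X, Holomorphic H → AEStronglyMeasurable
      (fun x : Fin m → UnitAddCircle => H (pad (scaled r x))) (haarFinTorus m) := fun H hH =>
    (hH.continuous.comp (continuous_pad_scaled r)).aestronglyMeasurable
  refine (eLpNorm_add_le (hmeas F hF) (hmeas G hG) hp.out).trans (add_le_add ?_ ?_)
  · exact le_iSup₂ (f := fun (m : ℕ) (r : Set.Ioo (0 : ℝ) 1) =>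
      eLpNorm (fun x : Fin m → UnitAddCircle => F (pad (scaled r x))) p (haarFinTorus m)) m r
  · exact le_iSup₂ (f := fun (m : ℕ) (r : Set.Ioo (0 : ℝ) 1) =>
      eLpNorm (fun x : Fin m → UnitAddCircle => G (pad (scaled r x))) p (haarFinTorus m)) m r

lemma hardyBallNorm_smul {p : ℝ≥0∞} (c : ℂ) (F : ballEllTwo → X) :
    hardyBallNorm p (c • F) = ‖c‖ₑ * hardyBallNorm p F := by
  unfold hardyBallNorm
  simp only [ENNReal.mul_iSup]
  refine iSup_congr fun m => iSup_congr fun r => ?_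
  exact eLpNorm_const_smul c _ p (haarFinTorus m)

/-- The space `H_p(B_{c₀} ∩ ℓ₂, X)` of all holomorphic `F : B_{c₀} ∩ ℓ₂ → X` with finite
norm. -/
def HardyBall (X : Type*) [NormedAddCommGroup X] [NormedSpace ℂ X] (p : ℝ≥0∞) [Fact (1 ≤ p)] :
    Submodule ℂ (ballEllTwo → X) where
  carrier := {F | Holomorphic F ∧ hardyBallNorm p F < ∞}
  zero_mem' := by
    refine ⟨⟨0, differentiableOn_const 0, fun _ => rfl⟩, ?_⟩
    refine lt_of_le_of_lt (b := 0) (iSup₂_le fun m r => ?_) ENNReal.zero_lt_top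
    exact (eLpNorm_zero (p := p) (μ := haarFinTorus m) (ε := X)).le
  add_mem' := by
    rintro F G ⟨hF, hF'⟩ ⟨hG, hG'⟩
    refine ⟨?_, lt_of_le_of_lt (hardyBallNorm_add hF hG) (ENNReal.add_lt_top.2 ⟨hF', hG'⟩)⟩
    obtain ⟨F₁, hF₁, hF₁'⟩ := hF
    obtain ⟨G₁, hG₁, hG₁'⟩ := hG
    exact ⟨F₁ + G₁, hF₁.add hG₁, fun z => by simp [hF₁', hG₁']⟩
  smul_mem' := by
    rintro c F ⟨hF, hF'⟩
    refine ⟨?_, ?_⟩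
    · obtain ⟨F₁, hF₁, hF₁'⟩ := hF
      exact ⟨c • F₁, hF₁.const_smul c, fun z => by simp [hF₁']⟩
    · rw [hardyBallNorm_smul]
      exact ENNReal.mul_lt_top enorm_lt_top hF'

/-! ### The Bohr transform -/

/-- The monomial `z^α`. -/
def monomial (α : ℕ →₀ ℕ) (z : ℕ → ℂ) : ℂ := α.prod fun n k => z n ^ k

/-- `F` has the monomial series expansion `∑_α c_α z^α`: for every `m` and `z ∈ 𝔻^m`, the value
`F(z_1, …, z_m, 0, …)` is the unconditional sum of the `c_α z^α`. (The terms with `α ∉ ℕ₀^m`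
vanish there, so this is the sum over `α ∈ ℕ₀^m`.) -/
def HasMonomialExpansion (F : ballEllTwo → X) (c : (ℕ →₀ ℕ) → X) : Prop :=
  ∀ (m : ℕ) (z : polydisc m),
    HasSum (fun α : ℕ →₀ ℕ => monomial α (pad z).1 • c α) (F (pad z))

/-- The Dirichlet series `a` is the Bohr transform of `F`: the monomial coefficients of `F` are
`c_α = a_n` for `n = 𝔭^α`. -/
def IsBohrTransform (F : ballEllTwo → X) (a : DirichletSeries X) : Prop :=
  HasMonomialExpansion F fun α => a (primePow α)

/-- The sequence `𝔭^{-s} = (2^{-s}, 3^{-s}, 5^{-s}, …)`, a point of `B_{c₀} ∩ ℓ₂` for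
`Re s > 1/2`. -/
def primeSeq (s : ℂ) (hs : 1 / 2 < s.re) : ballEllTwo :=
  ⟨⟨fun n => ((prime n : ℕ) : ℂ) ^ (-s), by
    have hsum : Summable fun n : ℕ => (n : ℝ) ^ (-(2 * s.re)) :=
      Real.summable_nat_rpow.2 (by linarith)
    refine memℓp_gen ?_
    refine (hsum.comp_injective (Nat.nth_injective Nat.infinite_setOfPred_prime)).congr fun n => ?_
    rw [Complex.norm_natCast_cpow_of_pos (prime n).pos]
    simp only [Function.comp_apply, prime, PNat.mk_coe, Complex.neg_re, ENNReal.toReal_ofNat]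
    rw [← Real.rpow_mul (Nat.cast_nonneg _)]
    congr 1
    ring⟩,
  fun n => by
    change ‖((prime n : ℕ) : ℂ) ^ (-s)‖ < 1
    rw [Complex.norm_natCast_cpow_of_pos (prime n).pos]
    refine Real.rpow_lt_one_of_one_lt_of_neg ?_ (by rw [Complex.neg_re]; linarith)
    exact_mod_cast (Nat.prime_nth_prime n).one_lt⟩

/-- The Dirichlet series `∑_n a_n n^{-s}` converges at `s`, with sum `S`: its partial sums, in
the natural order, tend to `S`. -/
def DirichletConvergesTo (a : DirichletSeries X) (s : ℂ) (S : X) : Prop :=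
  Tendsto (fun N : ℕ => ∑ n ∈ Finset.range N,
    ((n.succPNat : ℕ) : ℂ) ^ (-s) • a n.succPNat) atTop (𝓝 S)

end BohrHardy

end

noncomputable section

namespace BohrHardy

variable {X : Type*} [NormedAddCommGroup X] [NormedSpace ℂ X]

/-! ### Products of absolutely convergent series -/

/-! Both spaces consist of formal power series `∑ c_α z^α` with one common norm: the least `M` such
that all sections `ω ↦ ∑ c_α w^α ω^α`, with `w` a finitely supported point of the polydisc, have
`L_p`-norm at most `M` (`SectionBound`).

The definitions are compared by means of kernels. A function on the torus with spectrum in `ℕ₀^(ℕ)`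
does not see the part of a kernel that belongs to multi-indices with a negative entry, so this part
may be chosen at will (`integral_prod_kernel_smul`). The Poisson kernel shows that dilations and
truncations contract `L_p` (`eLpNorm_powerSum_rot_le`). A kernel of constant modulus bounds the
evaluation at `z` on `H_1` by `∏ (1 - |z_j|²)⁻¹` (`norm_powerSum_le`); on `ℓ₂` this stays bounded as
the number of variables grows.

From Dirichlet series to functions: the power series in the first `m` variables are locally bounded
on `B_{c₀} ∩ ℓ₂` uniformly in `m`, and they converge to a holomorphic function
(`SectionBound.exists_holomorphic`).

From functions to Dirichlet series: for a general `X`, bounded sections need not converge in `L_p`.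
They do after a translation by `ε > 0`, by a quantitative form of Bohr's theorem
(`exists_norm_tsum_sub_sum_range_le`): if a Dirichlet series with values in a Banach space is
bounded by `M` on a vertical line, then its translate by `η` has tails of size `N^{-η/2} M`, with a
constant that depends on `η` only. With `L_p(𝕋^ℕ, X)` as the Banach space, the tails are small
uniformly in `m`, and the sections at `(𝔭_1^{-ε}, …, 𝔭_m^{-ε})` tend to the lift of `D_ε`
(`exists_mem_torusLifts`).

Convergence for `Re s > 1/2` is the same tail estimate with values in `X`, the bound on a vertical
line coming from point evaluations (`dirichletConvergesTo_of_sectionBound`). -/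

lemma summable_norm_and_tsum_pi_prod {ι : Type*} :
    ∀ (m : ℕ) (q : Fin m → ι → ℂ), (∀ j, Summable fun k => ‖q j k‖) →
      (Summable fun α : Fin m → ι => ‖∏ j, q j (α j)‖) ∧
        ∑' α : Fin m → ι, ∏ j, q j (α j) = ∏ j, ∑' k, q j k
  | 0, q, _ => by
    refine ⟨(hasSum_fintype _).summable, ?_⟩
    rw [tsum_fintype]
    simp
  | m + 1, q, hq => by
    obtain ⟨h1, h2⟩ := summable_norm_and_tsum_pi_prod m (fun j => q j.succ) fun j => hq j.succ
    let e : ι × (Fin m → ι) ≃ (Fin (m + 1) → ι) := Fin.consEquiv fun _ => ι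
    have he : ∀ x : ι × (Fin m → ι),
        ∏ j, q j (e x j) = q 0 x.1 * ∏ j : Fin m, q j.succ (x.2 j) := fun x => by
      rw [Fin.prod_univ_succ]; simp [e, Fin.consEquiv]
    constructor
    · rw [← e.summable_iff]
      refine (summable_mul_of_summable_norm (hq 0) h1).norm.congr fun x => ?_
      simp only [Function.comp_apply, he]
    · rw [← e.tsum_eq, Fin.prod_univ_succ, ← h2,
        tsum_mul_tsum_of_summable_norm (hq 0) h1]
      exact tsum_congr he

/-- A tuple, seen as a finitely supported sequence. -/
def extendZero {ι : Type*} [Zero ι] {m : ℕ} (α : Fin m → ι) : ℕ →₀ ι :=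
  Finsupp.embDomain Fin.valEmbedding (Finsupp.equivFunOnFinite.symm α)

lemma extendZero_apply {ι : Type*} [Zero ι] {m : ℕ} (α : Fin m → ι) (j : Fin m) :
    extendZero α j = α j := by
  unfold extendZero
  exact Finsupp.embDomain_apply_self Fin.valEmbedding (Finsupp.equivFunOnFinite.symm α) j

lemma extendZero_apply_of_le {ι : Type*} [Zero ι] {m : ℕ} (α : Fin m → ι) {j : ℕ} (h : m ≤ j) :
    extendZero α j = 0 := by
  refine Finsupp.embDomain_of_notMem_range _ _ _ ?_
  rintro ⟨i, rfl⟩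
  exact absurd i.2 (not_lt.2 h)

lemma extendZero_injective {ι : Type*} [Zero ι] {m : ℕ} :
    Function.Injective (extendZero : (Fin m → ι) → ℕ →₀ ι) := fun α β h => by
  ext j
  rw [← extendZero_apply α, ← extendZero_apply β, h]

lemma mem_range_extendZero {ι : Type*} [Zero ι] {m : ℕ} {α : ℕ →₀ ι} (h : ∀ j, m ≤ j → α j = 0) :
    α ∈ Set.range (extendZero : (Fin m → ι) → ℕ →₀ ι) := by
  refine ⟨fun j => α j, ?_⟩
  ext j
  by_cases hj : j < m
  · exact extendZero_apply (fun j : Fin m => α j) ⟨j, hj⟩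
  · rw [extendZero_apply_of_le _ (not_lt.1 hj), h j (not_lt.1 hj)]

lemma finsupp_prod_eq_prod_fin {ι M : Type*} [Zero ι] [CommMonoid M] {m : ℕ} (α : ℕ →₀ ι)
    (h : ∀ j, m ≤ j → α j = 0) (q : ℕ → ι → M) (h0 : ∀ j, q j 0 = 1) :
    α.prod q = ∏ j : Fin m, q j (α j) := by
  rw [Finsupp.prod_of_support_subset α (s := Finset.range m) _ q fun _ _ => h0 _,
    Finset.prod_range]
  intro j hj
  rw [Finset.mem_range]
  by_contra hm
  exact (Finsupp.mem_support_iff.1 hj) (h j (not_lt.1 hm))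

lemma finsupp_prod_eq_zero {ι : Type*} [Zero ι] {m : ℕ} {q : ℕ → ι → ℂ}
    (hm : ∀ j, m ≤ j → ∀ k, k ≠ 0 → q j k = 0) {α : ℕ →₀ ι}
    (hα : α ∉ Set.range (extendZero : (Fin m → ι) → ℕ →₀ ι)) : α.prod q = 0 := by
  have : ∃ j, m ≤ j ∧ α j ≠ 0 := by
    by_contra! h
    exact hα (mem_range_extendZero h)
  obtain ⟨j, hj, h⟩ := this
  exact Finset.prod_eq_zero (Finsupp.mem_support_iff.2 h) (hm j hj _ h)

lemma finsupp_prod_extendZero {ι : Type*} [Zero ι] {m : ℕ} {q : ℕ → ι → ℂ}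
    (h0 : ∀ j, q j 0 = 1) (α : Fin m → ι) :
    (extendZero α).prod q = ∏ j : Fin m, q j (α j) := by
  rw [finsupp_prod_eq_prod_fin (extendZero α) (fun _ hj => extendZero_apply_of_le α hj) q h0]
  simp only [extendZero_apply]

/-- The factors from `m` on are trivial, so a term vanishes unless its multi-index comes from `Fin m
→ ι`. Power series use this with `ι = ℕ`, kernels on the torus with `ι = ℤ`. -/
lemma summable_norm_finsupp_prod {ι : Type*} [Zero ι] {m : ℕ} {q : ℕ → ι → ℂ}
    (hq : ∀ j, Summable fun k => ‖q j k‖) (h0 : ∀ j, q j 0 = 1)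
    (hm : ∀ j, m ≤ j → ∀ k, k ≠ 0 → q j k = 0) :
    Summable fun α : ℕ →₀ ι => ‖α.prod q‖ := by
  rw [← (extendZero_injective (m := m)).summable_iff fun α hα => by
    rw [finsupp_prod_eq_zero hm hα, norm_zero]]
  refine (summable_norm_and_tsum_pi_prod m (fun j => q j) fun j => hq j).1.congr fun α => ?_
  rw [Function.comp_apply, finsupp_prod_extendZero h0]

lemma hasSum_finsupp_prod {ι : Type*} [Zero ι] {m : ℕ} {q : ℕ → ι → ℂ}
    (hq : ∀ j, Summable fun k => ‖q j k‖) (h0 : ∀ j, q j 0 = 1)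
    (hm : ∀ j, m ≤ j → ∀ k, k ≠ 0 → q j k = 0) :
    HasSum (fun α : ℕ →₀ ι => α.prod q) (∏ j : Fin m, ∑' k, q j k) := by
  rw [← (extendZero_injective (m := m)).hasSum_iff fun α hα => finsupp_prod_eq_zero hm hα]
  obtain ⟨h1, h2⟩ := summable_norm_and_tsum_pi_prod m (fun j => q j) fun j => hq j
  rw [← h2]
  refine h1.of_norm.hasSum.congr_fun ?_ |> id
  intro α
  rw [Function.comp_apply, finsupp_prod_extendZero h0]

/-! ### The infinite torus -/

lemma measurePreserving_projFin (m : ℕ) :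
    MeasurePreserving (fun (x : Torus) (i : Fin m) => x i) haarTorus (haarFinTorus m) := by
  refine ⟨measurable_pi_lambda _ fun i => measurable_pi_apply _, ?_⟩
  unfold haarTorus haarFinTorus
  rw [Measure.map_infinitePi_infinitePi_of_inj (f := fun i : Fin m => (i : ℕ)) Fin.val_injective,
    Measure.infinitePi_eq_pi]

lemma integral_fourier (k : ℤ) :
    ∫ x : UnitAddCircle, fourier k x ∂AddCircle.haarAddCircle = if k = 0 then 1 else 0 := by
  have h := congrFun (fourierCoeff_fourier (T := 1) k) 0
  simp only [fourierCoeff, neg_zero, fourier_zero, one_smul] at h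
  rw [h, Pi.single_apply]
  simp [eq_comm]

lemma character_eq_prod_fin {m : ℕ} (α : ℕ →₀ ℤ) (h : ∀ j, m ≤ j → α j = 0) (x : Torus) :
    character α x = ∏ j : Fin m, fourier (α j) (x j) :=
  finsupp_prod_eq_prod_fin α h (fun n k => (fourier k (x n) : ℂ)) fun _ => fourier_zero

lemma exists_forall_le_eq_zero {ι : Type*} [Zero ι] (α : ℕ →₀ ι) :
    ∃ m, ∀ j, m ≤ j → α j = 0 := by
  obtain ⟨m, hm⟩ := α.support.bddAbove
  refine ⟨m + 1, fun j hj => ?_⟩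
  by_contra h
  exact absurd (hm (Finsupp.mem_support_iff.2 h)) (by simp; omega)

/-- Only finitely many coordinates enter, so the integral lives on a finite torus and factors. -/
lemma integral_character (α : ℕ →₀ ℤ) :
    ∫ x, character α x ∂haarTorus = if α = 0 then 1 else 0 := by
  obtain ⟨m, hm⟩ := exists_forall_le_eq_zero α
  have h1 : ∫ x, character α x ∂haarTorus
      = ∫ y, (∏ j : Fin m, (fourier (α j) (y j) : ℂ)) ∂haarFinTorus m := by
    rw [← (measurePreserving_projFin m).map_eq, integral_map]
    · exact integral_congr_ae (ae_of_all _ fun x => character_eq_prod_fin α hm x)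
    · exact (measurePreserving_projFin m).measurable.aemeasurable
    · refine Continuous.aestronglyMeasurable ?_
      fun_prop
  rw [h1, haarFinTorus, integral_fintype_prod_eq_prod (f := fun (j : Fin m) y =>
    (fourier (α j) y : ℂ))]
  simp only [integral_fourier]
  split_ifs with h
  · subst h; simp
  · have : ∃ j, α j ≠ 0 := by
      by_contra! h'
      exact h (Finsupp.ext h')
    obtain ⟨j, hj⟩ := this
    have hjm : j < m := by
      by_contra h'
      exact hj (hm j (not_lt.1 h'))
    exact Finset.prod_eq_zero (Finset.mem_univ ⟨j, hjm⟩) (if_neg hj)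

lemma character_add (α β : ℕ →₀ ℤ) (x : Torus) :
    character (α + β) x = character α x * character β x := by
  unfold character
  exact Finsupp.prod_add_index' (fun n => fourier_zero) fun n k l => fourier_add

lemma continuous_character (α : ℕ →₀ ℤ) : Continuous (character α) := by
  unfold character Finsupp.prod
  fun_prop

lemma intIndex_apply (α : ℕ →₀ ℕ) (n : ℕ) : intIndex α n = α n := rfl

lemma intIndex_injective : Function.Injective intIndex := fun α β h => by
  ext n
  have := DFunLike.congr_fun h n
  simpa [intIndex_apply] using this

lemma mem_range_intIndex {α : ℕ →₀ ℤ} (h : ∀ n, 0 ≤ α n) : α ∈ Set.range intIndex := by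
  refine ⟨α.mapRange Int.toNat rfl, ?_⟩
  ext n
  simp [intIndex_apply, h n]

/-! ### Reproducing kernels -/

/-- Integration against a product of absolutely convergent trigonometric series. -/
lemma integral_prod_kernel_smul {f : Torus → X} (hf : Integrable f haarTorus)
    (hneg : ∀ α : ℕ →₀ ℤ, (∃ n, α n < 0) → torusCoeff f α = 0) {m : ℕ} {κ : ℕ → ℤ → ℂ}
    (hκ : ∀ j, Summable fun k => ‖κ j k‖) (h0 : ∀ j, κ j 0 = 1)
    (hm : ∀ j, m ≤ j → ∀ k, k ≠ 0 → κ j k = 0) :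
    HasSum (fun α : ℕ →₀ ℕ => (α.prod fun j k => κ j k) • torusCoeff f (intIndex α))
      (∫ x, (∏ j : Fin m, ∑' k : ℤ, κ j k * fourier (-k) (x j)) • f x ∂haarTorus) := by
  have hprod : ∀ (x : Torus) (α : ℕ →₀ ℤ),
      (α.prod fun j k => κ j k * fourier (-k) (x j)) = α.prod κ * character (-α) x := by
    intro x α
    rw [Finsupp.prod_mul]
    congr 1
    unfold character
    exact (Finsupp.prod_neg_index (h := fun n k => (fourier k (x n) : ℂ))
      fun n => fourier_zero).symm
  have hsum : ∀ x : Torus, HasSum (fun α : ℕ →₀ ℤ => (α.prod κ * character (-α) x) • f x)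
      ((∏ j : Fin m, ∑' k : ℤ, κ j k * fourier (-k) (x j)) • f x) := by
    intro x
    simp only [← hprod]
    refine HasSum.smul_const (hasSum_finsupp_prod (q := fun j k => κ j k * fourier (-k) (x j))
      (fun j => ?_) (fun j => ?_) fun j hj k hk => ?_) _
    · refine (hκ j).congr fun k => ?_
      rw [norm_mul, fourier_apply, Circle.norm_coe, mul_one]
    · simp [h0]
    · simp [hm j hj k hk]
  have hS : Summable fun α : ℕ →₀ ℤ => ‖α.prod κ‖ := summable_norm_finsupp_prod hκ h0 hm
  have hint : ∀ α : ℕ →₀ ℤ, Integrable (fun x => (α.prod κ * character (-α) x) • f x) haarTorus :=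
    fun α => hf.bdd_smul ‖α.prod κ‖
      (measurable_const.mul (measurable_character _)).aestronglyMeasurable
      (ae_of_all _ fun x => by rw [norm_mul, norm_character, mul_one])
  -- Characters have modulus one, so the norms of the terms integrate to `‖α.prod κ‖` times the
  -- `L_1`-norm of `f`, which is summable.
  have key := hasSum_integral_of_summable_integral_norm hint (by
    simp only [norm_smul, norm_mul, norm_character, mul_one, integral_const_mul]
    exact hS.mul_right _)
  rw [integral_congr_ae (ae_of_all _ fun x => (hsum x).tsum_eq)] at key
  have hcoef : ∀ α : ℕ →₀ ℤ, ∫ x, (α.prod κ * character (-α) x) • f x ∂haarTorus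
      = α.prod κ • torusCoeff f α := by
    intro α
    simp only [mul_smul]
    rw [integral_smul, torusCoeff]
  simp only [hcoef] at key
  -- The spectrum of `f` removes every multi-index with a negative entry: the values of `κ` at
  -- negative integers do not affect the sum.
  rw [← intIndex_injective.hasSum_iff] at key
  · refine key.congr_fun fun α => ?_
    rw [Function.comp_apply]
    congr 1
    unfold intIndex
    rw [Finsupp.prod_mapRange_index h0]
  · intro α hα
    have : ∃ n, α n < 0 := by
      by_contra! h
      exact hα (mem_range_intIndex h)
    rw [hneg α this, smul_zero]

/-! ### Power series in finitely many variables -/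

/-- The points of the infinite polydisc with at most `m` nonzero coordinates, the first ones. -/
def finDisc (m : ℕ) : Set (ℕ → ℂ) := {w | (∀ j, ‖w j‖ < 1) ∧ ∀ j, m ≤ j → w j = 0}

/-- The sum of the power series with coefficients `c`. -/
def powerSum (c : (ℕ →₀ ℕ) → X) (w : ℕ → ℂ) : X := ∑' α, monomial α w • c α

lemma summable_norm_monomial {m : ℕ} {w : ℕ → ℂ} (hw : w ∈ finDisc m) :
    Summable fun α : ℕ →₀ ℕ => ‖monomial α w‖ := by
  refine summable_norm_finsupp_prod (m := m) (q := fun n k => w n ^ k) (fun j => ?_)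
    (fun j => pow_zero _) fun j hj k hk => ?_
  · simpa only [norm_pow] using summable_geometric_of_lt_one (norm_nonneg _) (hw.1 j)
  · rw [hw.2 j hj, zero_pow hk]

lemma summable_norm_monomial_smul {m : ℕ} {w : ℕ → ℂ} (hw : w ∈ finDisc m)
    {c : (ℕ →₀ ℕ) → X} {C : ℝ} (hc : ∀ α, ‖c α‖ ≤ C) :
    Summable fun α : ℕ →₀ ℕ => ‖monomial α w • c α‖ := by
  refine ((summable_norm_monomial hw).mul_right C).of_nonneg_of_le (fun _ => norm_nonneg _)
    fun α => ?_
  rw [norm_smul]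
  gcongr
  exact hc α

lemma hasSum_powerSum [CompleteSpace X] {m : ℕ} {w : ℕ → ℂ} (hw : w ∈ finDisc m)
    {c : (ℕ →₀ ℕ) → X} {C : ℝ} (hc : ∀ α, ‖c α‖ ≤ C) :
    HasSum (fun α : ℕ →₀ ℕ => monomial α w • c α) (powerSum c w) :=
  (summable_norm_monomial_smul hw hc).of_norm.hasSum

/-- The point `(w_j ω_j)_j`. -/
def rot (w : ℕ → ℂ) (x : Torus) : ℕ → ℂ := fun j => w j * fourier 1 (x j)

lemma norm_fourier_apply (k : ℤ) (t : UnitAddCircle) : ‖(fourier k t : ℂ)‖ = 1 := by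
  rw [fourier_apply, Circle.norm_coe]

lemma norm_rot (w : ℕ → ℂ) (x : Torus) (j : ℕ) : ‖rot w x j‖ = ‖w j‖ := by
  rw [rot, norm_mul, norm_fourier_apply, mul_one]

lemma rot_mem_finDisc {m : ℕ} {w : ℕ → ℂ} (hw : w ∈ finDisc m) (x : Torus) :
    rot w x ∈ finDisc m :=
  ⟨fun j => by rw [norm_rot]; exact hw.1 j, fun j hj => by rw [rot, hw.2 j hj, zero_mul]⟩

lemma fourier_one_pow (k : ℕ) (t : UnitAddCircle) : (fourier 1 t : ℂ) ^ k = fourier k t := by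
  induction k with
  | zero => simp
  | succ k ih => rw [pow_succ, ih, Nat.cast_succ, fourier_add]

lemma monomial_mul (α : ℕ →₀ ℕ) (v w : ℕ → ℂ) :
    monomial α (fun j => v j * w j) = monomial α v * monomial α w := by
  unfold monomial
  rw [← Finsupp.prod_mul]
  simp only [mul_pow]

lemma monomial_rot (α : ℕ →₀ ℕ) (w : ℕ → ℂ) (x : Torus) :
    monomial α (rot w x) = monomial α w * character (intIndex α) x := by
  unfold rot
  rw [monomial_mul]
  congr 1
  unfold monomial character intIndex
  rw [Finsupp.prod_mapRange_index (h := fun n k => (fourier k (x n) : ℂ)) fun _ => fourier_zero]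
  simp only [fourier_one_pow]

lemma norm_monomial_rot (α : ℕ →₀ ℕ) (w : ℕ → ℂ) (x : Torus) :
    ‖monomial α (rot w x)‖ = ‖monomial α w‖ := by
  rw [monomial_rot, norm_mul, norm_character, mul_one]

lemma continuous_monomial_rot (α : ℕ →₀ ℕ) (w : ℕ → ℂ) :
    Continuous fun x => monomial α (rot w x) := by
  simp only [monomial_rot]
  exact continuous_const.mul (continuous_character _)

lemma continuous_powerSum_rot [CompleteSpace X] {m : ℕ} {w : ℕ → ℂ} (hw : w ∈ finDisc m)
    {c : (ℕ →₀ ℕ) → X} {C : ℝ} (hc : ∀ α, ‖c α‖ ≤ C) :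
    Continuous fun x => powerSum c (rot w x) := by
  refine continuous_tsum (u := fun α => ‖monomial α w‖ * C)
    (fun α => (continuous_monomial_rot α w).smul continuous_const)
    ((summable_norm_monomial hw).mul_right C) fun α x => ?_
  rw [norm_smul, norm_monomial_rot]
  exact mul_le_mul_of_nonneg_left (hc α) (norm_nonneg _)

/-- The Fourier coefficients of `ω ↦ ∑ c_α w^α ω^α`. -/
lemma torusCoeff_powerSum_rot [CompleteSpace X] {m : ℕ} {w : ℕ → ℂ} (hw : w ∈ finDisc m)
    {c : (ℕ →₀ ℕ) → X} {C : ℝ} (hc : ∀ α, ‖c α‖ ≤ C) (β : ℕ →₀ ℤ) :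
    HasSum (fun α => if intIndex α = β then monomial α w • c α else 0)
      (torusCoeff (fun x => powerSum c (rot w x)) β) := by
  have hint : ∀ α : ℕ →₀ ℕ, Integrable
      (fun x => character (-β) x • monomial α (rot w x) • c α) haarTorus := fun α => by
    refine Continuous.integrable_of_hasCompactSupport ?_ (HasCompactSupport.of_compactSpace _)
    exact (continuous_character _).smul ((continuous_monomial_rot α w).smul continuous_const)
  have key := hasSum_integral_of_summable_integral_norm hint (by
    simp only [norm_smul, norm_character, norm_monomial_rot, one_mul, integral_const,
      probReal_univ, one_smul]
    simpa only [norm_smul] using summable_norm_monomial_smul hw hc)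
  have h1 : ∀ x : Torus, ∑' α, character (-β) x • monomial α (rot w x) • c α
      = character (-β) x • powerSum c (rot w x) := fun x =>
    ((hasSum_powerSum (rot_mem_finDisc hw x) hc).const_smul _).tsum_eq
  simp only [h1] at key
  refine key.congr_fun fun α => ?_
  have h2 : ∀ x : Torus, character (-β) x • monomial α (rot w x) • c α
      = character (intIndex α + -β) x • monomial α w • c α := fun x => by
    rw [monomial_rot, character_add, smul_smul, smul_smul]
    congr 1
    ring
  simp only [h2]
  rw [integral_smul_const, integral_character]
  simp only [← sub_eq_add_neg, sub_eq_zero]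
  split_ifs <;> simp

lemma torusCoeff_powerSum_rot_intIndex [CompleteSpace X] {m : ℕ} {w : ℕ → ℂ}
    (hw : w ∈ finDisc m) {c : (ℕ →₀ ℕ) → X} {C : ℝ} (hc : ∀ α, ‖c α‖ ≤ C) (α : ℕ →₀ ℕ) :
    torusCoeff (fun x => powerSum c (rot w x)) (intIndex α) = monomial α w • c α := by
  refine (torusCoeff_powerSum_rot hw hc _).unique ?_
  convert hasSum_ite_eq α (monomial α w • c α) using 2 with β
  simp only [intIndex_injective.eq_iff]
  split_ifs with h
  · rw [h]
  · rfl

lemma torusCoeff_powerSum_rot_of_neg [CompleteSpace X] {m : ℕ} {w : ℕ → ℂ}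
    (hw : w ∈ finDisc m) {c : (ℕ →₀ ℕ) → X} {C : ℝ} (hc : ∀ α, ‖c α‖ ≤ C) (β : ℕ →₀ ℤ)
    (hβ : ∃ n, β n < 0) :
    torusCoeff (fun x => powerSum c (rot w x)) β = 0 := by
  refine (torusCoeff_powerSum_rot hw hc _).unique ?_
  convert hasSum_zero using 2 with α
  refine if_neg ?_
  rintro rfl
  obtain ⟨n, hn⟩ := hβ
  rw [intIndex_apply] at hn
  omega

/-! ### The Poisson kernel -/

/-- The coefficients of the Poisson kernel. -/
def poissonCoeff (u : ℕ → ℂ) (j : ℕ) (k : ℤ) : ℂ :=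
  if 0 ≤ k then u j ^ k.toNat else (starRingEnd ℂ (u j)) ^ (-k).toNat

/-- The Poisson kernel of the unit disc, as a function of `z \bar ω`. -/
def poissonDisc (ζ : ℂ) : ℝ := (1 - ‖ζ‖ ^ 2) / ‖1 - ζ‖ ^ 2

lemma poissonDisc_conj (ζ : ℂ) : poissonDisc (starRingEnd ℂ ζ) = poissonDisc ζ := by
  unfold poissonDisc
  rw [RCLike.norm_conj, ← RCLike.norm_conj (1 - ζ), map_sub, map_one]

lemma poissonDisc_nonneg {ζ : ℂ} (h : ‖ζ‖ < 1) : 0 ≤ poissonDisc ζ := by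
  unfold poissonDisc
  have : ‖ζ‖ ^ 2 ≤ 1 := by nlinarith [norm_nonneg ζ]
  exact div_nonneg (by linarith) (by positivity)

lemma poissonDisc_eq {ζ : ℂ} (h : ‖ζ‖ < 1) :
    (poissonDisc ζ : ℂ) = (1 - ζ)⁻¹ + (1 - starRingEnd ℂ ζ)⁻¹ * starRingEnd ℂ ζ := by
  have hne : 1 - ζ ≠ 0 := by
    intro h0
    rw [← sub_eq_zero.1 h0, norm_one] at h
    exact lt_irrefl _ h
  have hne' : 1 - starRingEnd ℂ ζ ≠ 0 := by
    rw [← map_one (starRingEnd ℂ), ← map_sub]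
    exact (map_ne_zero _).2 hne
  unfold poissonDisc
  rw [Complex.ofReal_div, Complex.ofReal_sub, Complex.ofReal_one, Complex.ofReal_pow,
    Complex.ofReal_pow, ← Complex.mul_conj', ← Complex.mul_conj', map_sub, map_one]
  generalize starRingEnd ℂ ζ = b at *
  field_simp
  ring

lemma fourier_neg_natCast (k : ℕ) (t : UnitAddCircle) :
    (fourier (-(k : ℤ)) t : ℂ) = starRingEnd ℂ (fourier 1 t) ^ k := by
  rw [fourier_neg, ← fourier_one_pow, map_pow]

/-- With `ζ = u_j \bar ω`, the frequencies `k ≥ 0` give the geometric series of `ζ`, and the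
frequencies `-(n + 1)` that of `\bar ζ` without its constant term. -/
lemma hasSum_poissonCoeff {m : ℕ} {u : ℕ → ℂ} (hu : u ∈ finDisc m) (j : ℕ) (t : UnitAddCircle) :
    HasSum (fun k : ℤ => poissonCoeff u j k * fourier (-k) t)
      (poissonDisc (u j * starRingEnd ℂ (fourier 1 t)) : ℂ) := by
  set ω : ℂ := fourier 1 t with hω
  have hζ1 : ‖u j * starRingEnd ℂ ω‖ < 1 := by
    rw [norm_mul, RCLike.norm_conj, norm_fourier_apply, mul_one]; exact hu.1 j
  rw [poissonDisc_eq hζ1]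
  refine HasSum.of_nat_of_neg_add_one ?_ ?_
  · refine (hasSum_geometric_of_norm_lt_one hζ1).congr_fun fun n => ?_
    rw [fourier_neg_natCast, ← hω, mul_pow, poissonCoeff, if_pos (Int.natCast_nonneg n),
      Int.toNat_natCast]
  · have h2 := (hasSum_geometric_of_norm_lt_one
      (show ‖starRingEnd ℂ (u j * starRingEnd ℂ ω)‖ < 1 by rwa [RCLike.norm_conj])).mul_right
      (starRingEnd ℂ (u j * starRingEnd ℂ ω))
    refine h2.congr_fun fun n => ?_
    have h3 : ¬ (0 : ℤ) ≤ -((n : ℤ) + 1) := by omega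
    have h4 : -(-((n : ℤ) + 1)) = ((n + 1 : ℕ) : ℤ) := by push_cast; ring
    rw [poissonCoeff, if_neg h3, h4, Int.toNat_natCast, ← fourier_one_pow, ← hω, ← mul_pow,
      ← pow_succ, map_mul, Complex.conj_conj]

lemma summable_norm_poissonCoeff {m : ℕ} {u : ℕ → ℂ} (hu : u ∈ finDisc m) (j : ℕ) :
    Summable fun k : ℤ => ‖poissonCoeff u j k‖ := by
  refine (hasSum_poissonCoeff hu j 0).summable.norm.congr fun k => ?_
  rw [norm_mul, norm_fourier_apply, mul_one]

lemma poissonCoeff_zero (u : ℕ → ℂ) (j : ℕ) : poissonCoeff u j 0 = 1 := by simp [poissonCoeff]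

lemma poissonCoeff_of_le {m : ℕ} {u : ℕ → ℂ} (hu : u ∈ finDisc m) (j : ℕ) (hj : m ≤ j) (k : ℤ)
    (hk : k ≠ 0) : poissonCoeff u j k = 0 := by
  unfold poissonCoeff
  rw [hu.2 j hj, map_zero]
  split_ifs
  · exact zero_pow (by omega)
  · exact zero_pow (by omega)

/-- The Poisson kernel of the first `m` variables. -/
def poissonTorus (m : ℕ) (z : ℕ → ℂ) (x y : Torus) : ℝ :=
  ∏ j : Fin m, poissonDisc (rot z x j * starRingEnd ℂ (fourier 1 (y j)))

lemma poissonTorus_nonneg {m : ℕ} {z : ℕ → ℂ} (hz : z ∈ finDisc m) (x y : Torus) :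
    0 ≤ poissonTorus m z x y := by
  refine Finset.prod_nonneg fun j _ => poissonDisc_nonneg ?_
  rw [norm_mul, RCLike.norm_conj, norm_fourier_apply, mul_one, norm_rot]
  exact hz.1 j

lemma continuous_poissonTorus {m : ℕ} {z : ℕ → ℂ} (hz : z ∈ finDisc m) :
    Continuous fun q : Torus × Torus => poissonTorus m z q.1 q.2 := by
  unfold poissonTorus poissonDisc rot
  refine continuous_finsetProd _ fun j _ => ?_
  refine Continuous.div (by fun_prop) (by fun_prop) fun q => ?_
  have h : ‖z j * fourier 1 (q.1 j) * starRingEnd ℂ (fourier 1 (q.2 j))‖ < 1 := by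
    rw [norm_mul, RCLike.norm_conj, norm_fourier_apply, norm_mul, norm_fourier_apply, mul_one,
      mul_one]
    exact hz.1 j
  refine pow_ne_zero _ (norm_ne_zero_iff.2 fun h0 => ?_)
  rw [← sub_eq_zero.1 h0, norm_one] at h
  exact lt_irrefl _ h

/-- The real kernel does not change when its argument is conjugated, which exchanges the two points
and conjugates `z`. This yields the second marginal of the kernel from the first. -/
lemma poissonTorus_swap (m : ℕ) (z : ℕ → ℂ) (x y : Torus) :
    poissonTorus m z x y = poissonTorus m (fun j => starRingEnd ℂ (z j)) y x := by
  unfold poissonTorus rot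
  refine Finset.prod_congr rfl fun j _ => ?_
  rw [← poissonDisc_conj]
  simp only [map_mul, Complex.conj_conj]
  congr 1
  ring

/-- The Poisson integral of a function with spectrum in `ℕ₀^(ℕ)`. -/
lemma integral_poissonTorus_smul {f : Torus → X} (hf : Integrable f haarTorus)
    (hneg : ∀ α : ℕ →₀ ℤ, (∃ n, α n < 0) → torusCoeff f α = 0) {m : ℕ} {z : ℕ → ℂ}
    (hz : z ∈ finDisc m) (x : Torus) :
    powerSum (fun α => torusCoeff f (intIndex α)) (rot z x)
      = ∫ y, poissonTorus m z x y • f y ∂haarTorus := by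
  have hu := rot_mem_finDisc hz x
  have key := integral_prod_kernel_smul hf hneg (summable_norm_poissonCoeff hu)
    (poissonCoeff_zero _) (poissonCoeff_of_le hu)
  rw [powerSum]
  convert key.tsum_eq using 3 with α
  · unfold monomial poissonCoeff
    simp
  · rename_i y
    rw [poissonTorus, ← Complex.coe_smul, Complex.ofReal_prod]
    congr 1
    exact Finset.prod_congr rfl fun j _ => (hasSum_poissonCoeff hu j (y j)).tsum_eq.symm

lemma torusCoeff_const_one (α : ℕ →₀ ℤ) :
    torusCoeff (fun _ => (1 : ℂ)) α = if α = 0 then 1 else 0 := by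
  unfold torusCoeff
  simp only [smul_eq_mul, mul_one, integral_character, neg_eq_zero]

/-- The kernel reproduces the constant function `1`, whose only nonzero coefficient is at `0`. -/
lemma integral_poissonTorus_right {m : ℕ} {z : ℕ → ℂ} (hz : z ∈ finDisc m) (x : Torus) :
    ∫ y, poissonTorus m z x y ∂haarTorus = 1 := by
  have h := integral_poissonTorus_smul (f := fun _ => (1 : ℂ)) (integrable_const 1)
    (fun α ⟨n, hn⟩ => by
      rw [torusCoeff_const_one, if_neg]
      rintro rfl
      simp at hn) hz x
  have h1 : powerSum (fun α => torusCoeff (fun _ => (1 : ℂ)) (intIndex α)) (rot z x) = 1 := by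
    unfold powerSum
    rw [tsum_eq_single 0]
    · beta_reduce
      rw [torusCoeff_const_one, if_pos (by ext; rfl)]
      simp [monomial]
    · intro α hα
      beta_reduce
      rw [torusCoeff_const_one, if_neg, smul_zero]
      intro h0
      exact hα (intIndex_injective (h0.trans (by ext; rfl)))
  rw [h1] at h
  simp only [Complex.real_smul, mul_one] at h
  rw [integral_complex_ofReal] at h
  exact_mod_cast h.symm

lemma integral_poissonTorus_left {m : ℕ} {z : ℕ → ℂ} (hz : z ∈ finDisc m) (y : Torus) :
    ∫ x, poissonTorus m z x y ∂haarTorus = 1 := by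
  simp only [poissonTorus_swap m z]
  exact integral_poissonTorus_right
    ⟨fun j => by rw [RCLike.norm_conj]; exact hz.1 j, fun j hj => by rw [hz.2 j hj, map_zero]⟩ y

/-- Integration against a doubly stochastic kernel is a contraction of `L_p`. -/
lemma eLpNorm_integral_kernel_le {Ω : Type*} [MeasurableSpace Ω] {μ : Measure Ω}
    [IsProbabilityMeasure μ] {p : ℝ≥0∞} (hp1 : 1 ≤ p) (hp : p ≠ ∞) {K : Ω → Ω → ℝ}
    (hK : Measurable (Function.uncurry K)) (hK0 : ∀ x y, 0 ≤ K x y)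
    (hKr : ∀ x, ∫ y, K x y ∂μ = 1) (hKl : ∀ y, ∫ x, K x y ∂μ = 1) {f : Ω → X}
    (hf : StronglyMeasurable f) :
    eLpNorm (fun x => ∫ y, K x y • f y ∂μ) p μ ≤ eLpNorm f p μ := by
  have hp0 : p ≠ 0 := (zero_lt_one.trans_le hp1).ne'
  have hq : 1 ≤ p.toReal := by
    rw [← ENNReal.toReal_one]
    exact ENNReal.toReal_mono hp hp1
  set k : Ω → Ω → ℝ≥0∞ := fun x y => ENNReal.ofReal (K x y) with hk
  have hkm : Measurable (Function.uncurry k) := hK.ennreal_ofReal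
  have hone : ∀ g : Ω → ℝ, (∀ y, 0 ≤ g y) → ∫ y, g y ∂μ = 1 →
      ∫⁻ y, ENNReal.ofReal (g y) ∂μ = 1 := by
    intro g hg h1
    rw [← ofReal_integral_eq_lintegral_ofReal _ (ae_of_all _ hg), h1, ENNReal.ofReal_one]
    exact Integrable.of_integral_ne_zero (by rw [h1]; exact one_ne_zero)
  have hfm : Measurable fun y => ‖f y‖ₑ := hf.enorm
  have hpt : ∀ x, ‖∫ y, K x y • f y ∂μ‖ₑ ^ p.toReal ≤ ∫⁻ y, k x y * ‖f y‖ₑ ^ p.toReal ∂μ := by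
    intro x
    have hkx : Measurable (k x) := hkm.comp measurable_prodMk_left
    -- Jensen's inequality, in the form `L_1 ≤ L_p` for the probability measure `K(x, y) dμ(y)`.
    have : IsProbabilityMeasure (μ.withDensity (k x)) :=
      ⟨by rw [withDensity_apply _ MeasurableSet.univ, Measure.restrict_univ,
        hone _ (hK0 x) (hKr x)]⟩
    have h1 : ‖∫ y, K x y • f y ∂μ‖ₑ ≤ eLpNorm f 1 (μ.withDensity (k x)) := by
      rw [eLpNorm_one_eq_lintegral_enorm, lintegral_withDensity_eq_lintegral_mul _ hkx hfm]
      refine (enorm_integral_le_lintegral_enorm _).trans (le_of_eq ?_)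
      refine lintegral_congr fun y => ?_
      rw [enorm_smul, Pi.mul_apply, hk, Real.enorm_of_nonneg (hK0 x y)]
    have h2 : eLpNorm f 1 (μ.withDensity (k x)) ≤ eLpNorm f p (μ.withDensity (k x)) :=
      eLpNorm_le_eLpNorm_of_exponent_le hp1 hf.aestronglyMeasurable
    calc _ ≤ eLpNorm f p (μ.withDensity (k x)) ^ p.toReal := by gcongr; exact h1.trans h2
      _ = _ := by
        rw [eLpNorm_eq_lintegral_rpow_enorm_toReal hp0 hp, ← ENNReal.rpow_mul,
          one_div, inv_mul_cancel₀ (by positivity), ENNReal.rpow_one,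
          lintegral_withDensity_eq_lintegral_mul _ hkx (hfm.pow_const _)]
        rfl
  rw [eLpNorm_eq_lintegral_rpow_enorm_toReal hp0 hp, eLpNorm_eq_lintegral_rpow_enorm_toReal hp0 hp]
  refine ENNReal.rpow_le_rpow ?_ (by positivity)
  -- Tonelli's theorem, after which the other marginal of the kernel integrates to one.
  calc _ ≤ ∫⁻ x, ∫⁻ y, k x y * ‖f y‖ₑ ^ p.toReal ∂μ ∂μ := lintegral_mono hpt
    _ = ∫⁻ y, ∫⁻ x, k x y * ‖f y‖ₑ ^ p.toReal ∂μ ∂μ :=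
        lintegral_lintegral_swap
          (hkm.mul ((hfm.pow_const _).comp measurable_snd)).aemeasurable
    _ = ∫⁻ y, ‖f y‖ₑ ^ p.toReal ∂μ := by
        refine lintegral_congr fun y => ?_
        have hky : Measurable fun x => k x y := hkm.comp measurable_prodMk_right
        rw [lintegral_mul_const _ hky, hone _ (fun x => hK0 x y)
          (hKl y), one_mul]

/-- Dilations and truncations of a function with spectrum in `ℕ₀^(ℕ)` do not increase its
`L_p`-norm. -/
theorem eLpNorm_powerSum_rot_le {p : ℝ≥0∞} (hp1 : 1 ≤ p) (hp : p ≠ ∞) {f : Torus → X}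
    (hfm : StronglyMeasurable f) (hf : MemLp f p haarTorus)
    (hneg : ∀ α : ℕ →₀ ℤ, (∃ n, α n < 0) → torusCoeff f α = 0) {m : ℕ} {z : ℕ → ℂ}
    (hz : z ∈ finDisc m) :
    eLpNorm (fun x => powerSum (fun α => torusCoeff f (intIndex α)) (rot z x)) p haarTorus
      ≤ eLpNorm f p haarTorus := by
  simp only [integral_poissonTorus_smul (hf.integrable hp1) hneg hz]
  exact eLpNorm_integral_kernel_le hp1 hp (continuous_poissonTorus hz).measurable
    (poissonTorus_nonneg hz) (integral_poissonTorus_right hz) (integral_poissonTorus_left hz) hfm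

/-! ### Point evaluations -/

/-- The coefficients of the extremal kernel for point evaluations on `H_1`. -/
def evalCoeff (u : ℕ → ℂ) (j : ℕ) (k : ℤ) : ℂ :=
  if 0 ≤ k then u j ^ k.toNat
  else if k = -1 then -(starRingEnd ℂ (u j)) / (1 - ‖u j‖ ^ 2 : ℝ) else 0

/-- The Cauchy kernel `(1 - u \bar ω)⁻¹` receives a single additional term, at frequency `-1`. Its
coefficient is chosen to make the numerator the conjugate of `1 - u \bar ω`. -/
lemma hasSum_evalCoeff {m : ℕ} {u : ℕ → ℂ} (hu : u ∈ finDisc m) (j : ℕ) (t : UnitAddCircle) :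
    HasSum (fun k : ℤ => evalCoeff u j k * fourier (-k) t)
      ((1 - starRingEnd ℂ (u j) * fourier 1 t) /
        ((1 - u j * starRingEnd ℂ (fourier 1 t)) * (1 - ‖u j‖ ^ 2 : ℝ))) := by
  set ω : ℂ := fourier 1 t with hω
  have hω1 : ‖ω‖ = 1 := norm_fourier_apply 1 t
  have hζ1 : ‖u j * starRingEnd ℂ ω‖ < 1 := by
    rw [norm_mul, RCLike.norm_conj, hω1, mul_one]; exact hu.1 j
  have hne : 1 - u j * starRingEnd ℂ ω ≠ 0 := by
    intro h
    rw [← sub_eq_zero.1 h, norm_one] at hζ1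
    exact lt_irrefl _ hζ1
  have hne' : ((1 - ‖u j‖ ^ 2 : ℝ) : ℂ) ≠ 0 := by
    norm_cast
    have := hu.1 j
    nlinarith [norm_nonneg (u j)]
  have hωω : starRingEnd ℂ ω * ω = 1 := by rw [Complex.conj_mul', hω1]; simp
  have huu : u j * starRingEnd ℂ (u j) = (‖u j‖ : ℂ) ^ 2 := Complex.mul_conj' _
  have hval : (1 - starRingEnd ℂ (u j) * ω) /
        ((1 - u j * starRingEnd ℂ ω) * (1 - ‖u j‖ ^ 2 : ℝ))
      = (1 - u j * starRingEnd ℂ ω)⁻¹ + -(starRingEnd ℂ (u j)) / (1 - ‖u j‖ ^ 2 : ℝ) * ω := by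
    field_simp
    push_cast
    linear_combination (-u j * starRingEnd ℂ (u j)) * hωω - huu
  rw [hval]
  refine HasSum.of_nat_of_neg_add_one ?_ ?_
  · refine (hasSum_geometric_of_norm_lt_one hζ1).congr_fun fun n => ?_
    rw [fourier_neg_natCast, ← hω, mul_pow, evalCoeff, if_pos (Int.natCast_nonneg n),
      Int.toNat_natCast]
  · convert hasSum_ite_eq 0 (-(starRingEnd ℂ (u j)) / (1 - ‖u j‖ ^ 2 : ℝ) * ω) using 2 with n
    have h3 : ¬ (0 : ℤ) ≤ -((n : ℤ) + 1) := by omega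
    unfold evalCoeff
    rw [if_neg h3]
    split_ifs with h4 h5 h5
    · subst h5; simp [hω]
    · omega
    · omega
    · rw [zero_mul]

/-- The numerator is conjugate to a factor of the denominator and cancels in modulus. Since the
modulus is constant, integrating against the kernel costs only the `L_1`-norm of `f`. -/
lemma norm_evalKernel {m : ℕ} {u : ℕ → ℂ} (hu : u ∈ finDisc m) (j : ℕ) (t : UnitAddCircle) :
    ‖∑' k : ℤ, evalCoeff u j k * fourier (-k) t‖ = (1 - ‖u j‖ ^ 2)⁻¹ := by
  have hζ1 : ‖u j * starRingEnd ℂ (fourier 1 t)‖ < 1 := by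
    rw [norm_mul, RCLike.norm_conj, norm_fourier_apply, mul_one]; exact hu.1 j
  have hne : ‖1 - u j * starRingEnd ℂ (fourier 1 t)‖ ≠ 0 := by
    intro h
    rw [← sub_eq_zero.1 (norm_eq_zero.1 h), norm_one] at hζ1
    exact lt_irrefl _ hζ1
  have hpos : 0 ≤ 1 - ‖u j‖ ^ 2 := by
    have := hu.1 j
    nlinarith [norm_nonneg (u j)]
  rw [(hasSum_evalCoeff hu j t).tsum_eq, norm_div, norm_mul, Complex.norm_real,
    Real.norm_of_nonneg hpos, ← RCLike.norm_conj (1 - _ * (fourier 1 t : ℂ)), map_sub, map_one,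
    map_mul, Complex.conj_conj, div_mul_eq_div_div, div_self hne, one_div]

/-- Point evaluations on `H_1`. -/
theorem norm_powerSum_le {f : Torus → X} (hf : Integrable f haarTorus)
    (hneg : ∀ α : ℕ →₀ ℤ, (∃ n, α n < 0) → torusCoeff f α = 0) {m : ℕ} {z : ℕ → ℂ}
    (hz : z ∈ finDisc m) :
    ‖powerSum (fun α => torusCoeff f (intIndex α)) z‖
      ≤ (∏ j : Fin m, (1 - ‖z j‖ ^ 2)⁻¹) * ∫ x, ‖f x‖ ∂haarTorus := by
  have key := integral_prod_kernel_smul hf hneg (κ := evalCoeff z) (m := m)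
    (fun j => (hasSum_evalCoeff hz j 0).summable.norm.congr fun k => by
      rw [norm_mul, norm_fourier_apply, mul_one]) (fun j => by simp [evalCoeff])
    fun j hj k hk => by
      unfold evalCoeff
      rw [hz.2 j hj]
      split_ifs
      · exact zero_pow (by omega)
      · simp
      · rfl
  have h1 : powerSum (fun α => torusCoeff f (intIndex α)) z
      = ∫ x, (∏ j : Fin m, ∑' k : ℤ, evalCoeff z j k * fourier (-k) (x j)) • f x ∂haarTorus := by
    rw [← key.tsum_eq, powerSum]
    refine tsum_congr fun α => ?_
    unfold monomial evalCoeff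
    simp
  rw [h1]
  refine (norm_integral_le_integral_norm _).trans (le_of_eq ?_)
  simp only [norm_smul, norm_prod, norm_evalKernel hz]
  rw [integral_const_mul]

/-! ### Monomial expansions of holomorphic functions on polydiscs -/

/-- Cauchy's integral formula on a circle with center `0`. -/
lemma integral_cauchy_kernel [CompleteSpace X] {g : ℂ → X}
    (hg : DifferentiableOn ℂ g (Metric.ball 0 1)) {ρ : ℝ} (hρ : 0 < ρ) (hρ1 : ρ < 1) {z : ℂ}
    (hz : ‖z‖ < ρ) :
    ∫ t : UnitAddCircle, (1 - z / (ρ * fourier 1 t))⁻¹ • g (ρ * fourier 1 t)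
      ∂AddCircle.haarAddCircle = g z := by
  have hd : DiffContOnCl ℂ g (Metric.ball 0 |ρ|) := by
    rw [abs_of_pos hρ]
    exact hg.diffContOnCl_ball (Metric.closedBall_subset_ball hρ1)
  -- With respect to normalized measure the Cauchy kernel is `ζ / (ζ - z) = (1 - z / ζ)⁻¹`.
  have h := hd.circleAverage_smul_div (w := z) (by simpa [abs_of_pos hρ] using hz)
  rw [← h, Real.circleAverage_def, AddCircle.integral_haarAddCircle, inv_one, one_smul,
    ← UnitAddCircle.intervalIntegral_preimage 0, zero_add]
  have h2 := intervalIntegral.integral_comp_mul_left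
    (fun θ => ((circleMap 0 ρ θ - 0) / (circleMap 0 ρ θ - z)) • g (circleMap 0 ρ θ))
    (a := 0) (b := 1) (c := 2 * Real.pi) (by positivity)
  rw [mul_zero, mul_one] at h2
  rw [← h2]
  refine intervalIntegral.integral_congr fun t _ => ?_
  have h3 : (ρ : ℂ) * fourier 1 (t : UnitAddCircle) = circleMap 0 ρ (2 * Real.pi * t) := by
    rw [circleMap_zero, fourier_coe_apply]
    congr 2
    push_cast
    ring
  have h4 : circleMap 0 ρ (2 * Real.pi * t) ≠ 0 := circleMap_ne_center hρ.ne'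
  rw [h3, sub_zero, one_sub_div h4, inv_div]

/-- The point `(ρ ω_1, …, ρ ω_m)`. -/
def circlePoint {m : ℕ} (ρ : ℝ) (x : Fin m → UnitAddCircle) : Fin m → ℂ :=
  fun i => ρ * fourier 1 (x i)

lemma norm_circlePoint {m : ℕ} {ρ : ℝ} (hρ : 0 ≤ ρ) (x : Fin m → UnitAddCircle) (i : Fin m) :
    ‖circlePoint ρ x i‖ = ρ := by
  rw [circlePoint, norm_mul, norm_fourier_apply, mul_one, Complex.norm_real, Real.norm_of_nonneg hρ]

lemma circlePoint_ne_zero {m : ℕ} {ρ : ℝ} (hρ : 0 < ρ) (x : Fin m → UnitAddCircle) (i : Fin m) :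
    circlePoint ρ x i ≠ 0 := by
  rw [← norm_pos_iff, norm_circlePoint hρ.le]
  exact hρ

lemma continuous_circlePoint {m : ℕ} (ρ : ℝ) :
    Continuous (circlePoint ρ : (Fin m → UnitAddCircle) → Fin m → ℂ) := by
  unfold circlePoint
  fun_prop

lemma continuous_comp_circlePoint {m : ℕ} {ρ : ℝ} (hρ : 0 < ρ) (hρ1 : ρ < 1) {G : (Fin m → ℂ) → X}
    (hG : DifferentiableOn ℂ G (polydisc m)) : Continuous fun x => G (circlePoint ρ x) :=
  hG.continuousOn.comp_continuous (continuous_circlePoint ρ) fun x i => by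
    rw [norm_circlePoint hρ.le]; exact hρ1

/-- Cauchy's integral formula on a polydisc. -/
lemma integral_cauchy_kernel_pi [CompleteSpace X] {ρ : ℝ} (hρ : 0 < ρ) (hρ1 : ρ < 1) :
    ∀ (m : ℕ) (G : (Fin m → ℂ) → X), DifferentiableOn ℂ G (polydisc m) →
      ∀ z : Fin m → ℂ, (∀ i, ‖z i‖ < ρ) →
      ∫ x, (∏ i, (1 - z i / circlePoint ρ x i)⁻¹) • G (circlePoint ρ x) ∂haarFinTorus m = G z
  | 0, G, _, z, _ => by
    have : IsProbabilityMeasure (haarFinTorus 0) := by unfold haarFinTorus; infer_instance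
    simp only [Finset.univ_eq_empty, Finset.prod_empty, one_smul]
    have h : ∀ x : Fin 0 → UnitAddCircle, G (circlePoint ρ x) = G z := fun x => by
      congr 1; exact Subsingleton.elim _ _
    simp only [h, integral_const, probReal_univ, one_smul]
  | m + 1, G, hG, z, hz => by
    have hcont : Continuous fun x : Fin (m + 1) → UnitAddCircle =>
        (∏ i, (1 - z i / circlePoint ρ x i)⁻¹) • G (circlePoint ρ x) := by
      refine Continuous.smul ?_ (continuous_comp_circlePoint hρ hρ1 hG)
      refine continuous_finsetProd _ fun i _ => Continuous.inv₀ ?_ fun x h0 => ?_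
      · exact continuous_const.sub (continuous_const.div
          ((continuous_apply i).comp (continuous_circlePoint ρ)) fun x => circlePoint_ne_zero hρ x i)
      · have h1 : z i = circlePoint ρ x i := by
          rw [sub_eq_zero, eq_div_iff (circlePoint_ne_zero hρ x i), one_mul] at h0
          exact h0.symm
        have := hz i
        rw [h1, norm_circlePoint hρ.le] at this
        exact lt_irrefl _ this
    -- The first variable is split off. For each of its values the induction hypothesis integrates
    -- the others, and the one-variable formula finishes.
    have hmp := (measurePreserving_piFinSuccAbove
      (fun _ : Fin (m + 1) => (AddCircle.haarAddCircle : Measure UnitAddCircle)) 0).symm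
    have hcons : ∀ q : UnitAddCircle × (Fin m → UnitAddCircle),
        (MeasurableEquiv.piFinSuccAbove (fun _ : Fin (m + 1) => UnitAddCircle) 0).symm q
          = Fin.cons q.1 q.2 := fun q => by
      rw [MeasurableEquiv.piFinSuccAbove_symm_apply, Fin.insertNthEquiv]
      simp
    have hint : Integrable (fun q : UnitAddCircle × (Fin m → UnitAddCircle) =>
        (∏ i, (1 - z i / circlePoint ρ (Fin.cons q.1 q.2 : Fin (m + 1) → UnitAddCircle) i)⁻¹) •
          G (circlePoint ρ (Fin.cons q.1 q.2)))
        ((AddCircle.haarAddCircle : Measure UnitAddCircle).prod (haarFinTorus m)) := by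
      have : IsProbabilityMeasure (haarFinTorus m) := by unfold haarFinTorus; infer_instance
      refine Continuous.integrable_of_hasCompactSupport ?_ (HasCompactSupport.of_compactSpace _)
      refine hcont.comp (f := fun q : UnitAddCircle × (Fin m → UnitAddCircle) =>
        (Fin.cons q.1 q.2 : Fin (m + 1) → UnitAddCircle)) ?_
      refine continuous_pi fun i => ?_
      refine Fin.cases ?_ (fun j => ?_) i
      · simpa using continuous_fst
      · simp only [Fin.cons_succ]
        fun_prop
    rw [haarFinTorus, ← hmp.integral_comp']
    simp only [hcons]
    rw [haarFinTorus] at hint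
    rw [integral_prod _ hint]
    have hpoint : ∀ (s : UnitAddCircle) (x : Fin m → UnitAddCircle),
        circlePoint ρ (Fin.cons s x : Fin (m + 1) → UnitAddCircle)
          = Fin.cons ((ρ : ℂ) * fourier 1 s) (circlePoint ρ x) := fun s x => by
      ext i
      refine Fin.cases ?_ (fun j => ?_) i
      · simp [circlePoint]
      · simp [circlePoint]
    have hz0 : z = Fin.cons (z 0) (fun i => z i.succ) := (Fin.cons_self_tail z).symm
    have hconsd : ∀ v : ℂ, Differentiable ℂ fun w : Fin m → ℂ => (Fin.cons v w : Fin (m + 1) → ℂ) :=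
      fun v => differentiable_pi.2 fun i => by
        refine Fin.cases ?_ (fun j => ?_) i
        · simp
        · simpa using differentiable_apply (𝕜 := ℂ) j
    have hcons0 : ∀ w : Fin m → ℂ, Differentiable ℂ fun v : ℂ => (Fin.cons v w : Fin (m + 1) → ℂ) :=
      fun w => differentiable_pi.2 fun i => by
        refine Fin.cases ?_ (fun j => ?_) i
        · simp
        · simp
    have hinner : ∀ s : UnitAddCircle,
        ∫ x : Fin m → UnitAddCircle,
          (∏ i, (1 - z i / circlePoint ρ (Fin.cons s x : Fin (m + 1) → UnitAddCircle) i)⁻¹) •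
          G (circlePoint ρ (Fin.cons s x)) ∂haarFinTorus m
        = (1 - z 0 / (ρ * fourier 1 s))⁻¹ • G (Fin.cons ((ρ : ℂ) * fourier 1 s) fun i => z i.succ) := by
      intro s
      have hs : ‖(ρ : ℂ) * fourier 1 s‖ < 1 := by
        rw [norm_mul, norm_fourier_apply, mul_one, Complex.norm_real, Real.norm_of_nonneg hρ.le]
        exact hρ1
      rw [← integral_cauchy_kernel_pi hρ hρ1 m (fun w => G (Fin.cons ((ρ : ℂ) * fourier 1 s) w)) ?_
        (fun i => z i.succ) (fun i => hz i.succ), ← integral_smul]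
      · refine integral_congr_ae (ae_of_all _ fun x => ?_)
        beta_reduce
        rw [hpoint, Fin.prod_univ_succ, smul_smul]
        simp only [Fin.cons_zero, Fin.cons_succ]
      · refine hG.comp (hconsd _).differentiableOn fun w hw i => ?_
        refine Fin.cases ?_ (fun j => ?_) i
        · simpa using hs
        · simpa using hw j
    rw [haarFinTorus] at hinner
    simp only [hinner]
    rw [integral_cauchy_kernel (g := fun v => G (Fin.cons v fun i => z i.succ)) ?_ hρ hρ1 (hz 0),
      ← hz0]
    refine hG.comp (hcons0 _).differentiableOn fun w hw i => ?_
    refine Fin.cases ?_ (fun j => ?_) i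
    · simpa using hw
    · simpa using (hz j.succ).trans hρ1

/-- Power series expansion on a polydisc. -/
lemma exists_hasSum_pi [CompleteSpace X] {m : ℕ} {ρ : ℝ} (hρ : 0 < ρ) (hρ1 : ρ < 1)
    {G : (Fin m → ℂ) → X} (hG : DifferentiableOn ℂ G (polydisc m)) :
    ∃ c : (Fin m → ℕ) → X, ∀ z : Fin m → ℂ, (∀ i, ‖z i‖ < ρ) →
      HasSum (fun α => (∏ i, z i ^ α i) • c α) (G z) := by
  have : IsProbabilityMeasure (haarFinTorus m) := by unfold haarFinTorus; infer_instance
  have hGc := continuous_comp_circlePoint hρ hρ1 hG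
  have hGi : Integrable (fun x => G (circlePoint ρ x)) (haarFinTorus m) :=
    hGc.integrable_of_hasCompactSupport (HasCompactSupport.of_compactSpace _)
  -- The coefficients are Cauchy integrals over the torus of radius `ρ`. Their independence of `ρ`
  -- is left to the uniqueness of coefficients.
  refine ⟨fun α => ∫ x, (∏ i, (circlePoint ρ x i ^ α i)⁻¹) • G (circlePoint ρ x) ∂haarFinTorus m,
    fun z hz => ?_⟩
  have hq : ∀ i, ‖z i‖ / ρ < 1 := fun i => (div_lt_one hρ).2 (hz i)
  have hS : Summable fun α : Fin m → ℕ => ∏ i, (‖z i‖ / ρ) ^ α i := by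
    refine (summable_norm_and_tsum_pi_prod m (fun i k => ((‖z i‖ / ρ : ℝ) : ℂ) ^ k)
      fun i => ?_).1.congr fun α => ?_
    · simp only [norm_pow, Complex.norm_real]
      exact summable_geometric_of_lt_one (norm_nonneg _) (by
        rw [Real.norm_of_nonneg (by positivity)]; exact hq i)
    · rw [norm_prod]
      refine Finset.prod_congr rfl fun i _ => ?_
      rw [norm_pow, Complex.norm_real, Real.norm_of_nonneg (by positivity)]
  have hnorm : ∀ (α : Fin m → ℕ) x, ‖∏ i, (z i / circlePoint ρ x i) ^ α i‖
      = ∏ i, (‖z i‖ / ρ) ^ α i := fun α x => by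
    rw [norm_prod]
    refine Finset.prod_congr rfl fun i _ => ?_
    rw [norm_pow, norm_div, norm_circlePoint hρ.le]
  have hint : ∀ α : Fin m → ℕ, Integrable
      (fun x => (∏ i, (z i / circlePoint ρ x i) ^ α i) • G (circlePoint ρ x)) (haarFinTorus m) :=
    fun α => hGi.bdd_smul _ (Continuous.aestronglyMeasurable (continuous_finsetProd _ fun i _ =>
      (continuous_const.div ((continuous_apply i).comp (continuous_circlePoint ρ))
        fun x => circlePoint_ne_zero hρ x i).pow _)) (ae_of_all _ fun x => (hnorm α x).le)
  have key := hasSum_integral_of_summable_integral_norm hint (by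
    simp only [norm_smul, hnorm, integral_const_mul]
    exact hS.mul_right _)
  have hsum : ∀ x, ∑' α : Fin m → ℕ, (∏ i, (z i / circlePoint ρ x i) ^ α i) • G (circlePoint ρ x)
      = (∏ i, (1 - z i / circlePoint ρ x i)⁻¹) • G (circlePoint ρ x) := by
    intro x
    have hlt : ∀ i, ‖z i / circlePoint ρ x i‖ < 1 := fun i => by
      rw [norm_div, norm_circlePoint hρ.le]; exact hq i
    obtain ⟨h1, h2⟩ := summable_norm_and_tsum_pi_prod m
      (fun i k => (z i / circlePoint ρ x i) ^ k) fun i => by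
        simpa only [norm_pow] using summable_geometric_of_lt_one (norm_nonneg _) (hlt i)
    rw [h1.of_norm.tsum_smul_const, h2]
    congr 1
    exact Finset.prod_congr rfl fun i _ => tsum_geometric_of_norm_lt_one (hlt i)
  simp only [hsum] at key
  rw [integral_cauchy_kernel_pi hρ hρ1 m G hG z hz] at key
  refine key.congr_fun fun α => ?_
  rw [← integral_smul]
  refine integral_congr_ae (ae_of_all _ fun x => ?_)
  beta_reduce
  rw [smul_smul, ← Finset.prod_mul_distrib]
  congr 1
  refine Finset.prod_congr rfl fun i _ => ?_
  rw [div_pow, div_eq_mul_inv]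

lemma monomial_eq_zero {m : ℕ} {w : ℕ → ℂ} (hw : ∀ j, m ≤ j → w j = 0) {α : ℕ →₀ ℕ}
    (hα : ∃ j, m ≤ j ∧ α j ≠ 0) : monomial α w = 0 := by
  obtain ⟨j, hj, h⟩ := hα
  exact Finset.prod_eq_zero (Finsupp.mem_support_iff.2 h) (by beta_reduce; rw [hw j hj, zero_pow h])

lemma differentiable_padSeq (m : ℕ) : Differentiable ℂ (padSeq : (Fin m → ℂ) → EllTwo) := by
  unfold padSeq
  refine Differentiable.fun_sum fun i _ => ?_
  let L : ℂ →L[ℂ] EllTwo :=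
    { toFun := fun c => lp.single 2 (i : ℕ) c
      map_add' := fun a b => lp.single_add (E := fun _ : ℕ => ℂ) 2 (i : ℕ) a b
      map_smul' := fun a b => lp.single_smul (E := fun _ : ℕ => ℂ) 2 (i : ℕ) a b
      cont := continuous_single i }
  exact L.differentiable.comp (differentiable_apply i)

lemma exists_hasSum_monomial [CompleteSpace X] {G : EllTwo → X}
    (hG : DifferentiableOn ℂ G ballEllTwo) (m : ℕ) {ρ : ℝ} (hρ : 0 < ρ) (hρ1 : ρ < 1) :
    ∃ c : (ℕ →₀ ℕ) → X, ∀ w : ℕ → ℂ, (∀ j, ‖w j‖ < ρ) → (∀ j, m ≤ j → w j = 0) →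
      HasSum (fun α => monomial α w • c α) (G (padSeq fun i : Fin m => w i)) := by
  have hG' : DifferentiableOn ℂ (fun z : Fin m → ℂ => G (padSeq z)) (polydisc m) :=
    hG.comp (differentiable_padSeq m).differentiableOn fun z hz => (pad ⟨z, hz⟩).2
  obtain ⟨c, hc⟩ := exists_hasSum_pi hρ hρ1 hG'
  -- The entries from `m` on are forgotten; this is harmless, as monomials that involve them vanish
  -- at `w`.
  refine ⟨fun α => c fun i => α i, fun w hw hw0 => ?_⟩
  rw [← (extendZero_injective (m := m)).hasSum_iff fun α hα => by
    rw [monomial_eq_zero hw0, zero_smul]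
    by_contra! h
    exact hα (mem_range_extendZero h)]
  refine (hc _ fun i => hw i).congr_fun fun α => ?_
  rw [Function.comp_apply, monomial, finsupp_prod_extendZero (q := fun n k => w n ^ k)
    fun j => pow_zero _]
  congr 2
  exact congrArg c (funext fun i => extendZero_apply α i)

/-- The point `(r, …, r, 0, 0, …)`. -/
def constSeq (m : ℕ) (r : ℝ) : ℕ → ℂ := fun j => if j < m then r else 0

lemma constSeq_of_le {m j : ℕ} (r : ℝ) (h : m ≤ j) : constSeq m r j = 0 := if_neg (not_lt.2 h)

lemma norm_constSeq_le (m : ℕ) {r : ℝ} (hr : 0 ≤ r) (j : ℕ) : ‖constSeq m r j‖ ≤ r := by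
  unfold constSeq
  split_ifs
  · rw [Complex.norm_real, Real.norm_of_nonneg hr]
  · simpa using hr

lemma constSeq_mem_finDisc (m : ℕ) {r : ℝ} (hr : 0 ≤ r) (hr1 : r < 1) :
    constSeq m r ∈ finDisc m :=
  ⟨fun j => (norm_constSeq_le m hr j).trans_lt hr1, fun _ => constSeq_of_le r⟩

lemma monomial_constSeq {m : ℕ} {α : ℕ →₀ ℕ} (hα : ∀ j, m ≤ j → α j = 0) (r : ℝ) :
    monomial α (constSeq m r) = (r : ℂ) ^ (α.sum fun _ k => k) := by
  unfold monomial Finsupp.prod Finsupp.sum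
  rw [← Finset.prod_pow_eq_pow_sum]
  refine Finset.prod_congr rfl fun j hj => ?_
  refine congrArg (· ^ α j) (if_pos ?_)
  by_contra h
  exact (Finsupp.mem_support_iff.1 hj) (hα j (not_lt.1 h))

lemma exists_norm_le_of_summable {ι E : Type*} [NormedAddCommGroup E] {f : ι → E} (hf : Summable f) : ∃ C, ∀ i, ‖f i‖ ≤ C := by
  have h : Tendsto (fun i => ‖f i‖) cofinite (𝓝 0) := by
    simpa using hf.tendsto_cofinite_zero.norm
  obtain ⟨C, hC⟩ := h.bddAbove_range_of_cofinite
  exact ⟨C, fun i => hC ⟨i, rfl⟩⟩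

/-- Uniqueness of power series coefficients. -/
lemma eq_zero_of_hasSum_monomial [CompleteSpace X] {e : (ℕ →₀ ℕ) → X} {m : ℕ} {r : ℝ} (hr : 0 < r)
    (h : ∀ w : ℕ → ℂ, (∀ j, ‖w j‖ < r) → (∀ j, m ≤ j → w j = 0) →
      HasSum (fun α => monomial α w • e α) 0) {α : ℕ →₀ ℕ} (hα : ∀ j, m ≤ j → α j = 0) :
    e α = 0 := by
  -- Two dilations: `w0` is absorbed in the coefficients, which become bounded as terms of a
  -- convergent series; a further factor `1 / 2` gives absolute convergence on a torus, where the
  -- sum is zero and its Fourier coefficients can be read off.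
  set w0 := constSeq m (r / 2) with hw0
  have hw0n : ∀ j, ‖w0 j‖ < r := fun j =>
    (norm_constSeq_le m (by linarith) j).trans_lt (by linarith)
  obtain ⟨C, hC⟩ := exists_norm_le_of_summable (h w0 hw0n fun _ => constSeq_of_le _).summable
  have hs := constSeq_mem_finDisc m (r := 1 / 2) (by norm_num) (by norm_num)
  have hzero : ∀ x, powerSum (fun α => monomial α w0 • e α) (rot (constSeq m (1 / 2)) x) = 0 := by
    intro x
    have h1 := h (fun j => rot (constSeq m (1 / 2)) x j * w0 j) (fun j => ?_) fun j hj => by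
      rw [hw0, constSeq_of_le _ hj, mul_zero]
    · rw [powerSum, ← h1.tsum_eq]
      refine tsum_congr fun α => ?_
      rw [monomial_mul, mul_smul]
    · rw [norm_mul, norm_rot]
      refine lt_of_le_of_lt ?_ (hw0n j)
      exact mul_le_of_le_one_left (norm_nonneg _)
        ((norm_constSeq_le m (by norm_num) j).trans (by norm_num))
  have h2 := torusCoeff_powerSum_rot_intIndex hs hC α
  simp only [hzero] at h2
  have h3 : torusCoeff (fun _ => (0 : X)) (intIndex α) = 0 := by
    simp [torusCoeff]
  rw [h3, hw0, monomial_constSeq hα, monomial_constSeq hα, smul_smul, eq_comm, smul_eq_zero] at h2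
  refine h2.resolve_left (mul_ne_zero (pow_ne_zero _ ?_) (pow_ne_zero _ ?_))
  · norm_num
  · exact_mod_cast (half_pos hr).ne'

lemma padSeq_eq_of_le {m m' : ℕ} (h : m ≤ m') {w : ℕ → ℂ} (hw : ∀ j, m ≤ j → w j = 0) :
    padSeq (fun i : Fin m' => w i) = padSeq fun i : Fin m => w i := by
  ext n
  rw [padSeq_apply, padSeq_apply]
  split_ifs with h1 h2 h2
  · rfl
  · exact hw n (not_lt.1 h2)
  · omega
  · rfl

lemma pad_apply_of_le {m : ℕ} (z : polydisc m) (j : ℕ) (hj : m ≤ j) : (pad z).1 j = 0 := by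
  change padSeq z.1 j = 0
  rw [padSeq_apply, dif_neg (not_lt.2 hj)]

lemma pad_apply_fin {m : ℕ} (z : polydisc m) (i : Fin m) : (pad z).1 i = z.1 i := by
  change padSeq z.1 i = z.1 i
  rw [padSeq_apply, dif_pos i.2]

/-- Only finitely many coordinates can be nonzero, so the strict inequalities hold uniformly. -/
lemma exists_lt_one_forall_norm_lt {m : ℕ} {w : ℕ → ℂ} (hw : w ∈ finDisc m) :
    ∃ ρ : ℝ, 0 < ρ ∧ ρ < 1 ∧ ∀ j, ‖w j‖ < ρ := by
  have h1 : ∀ s : Finset ℕ, ∃ ρ : ℝ, 0 < ρ ∧ ρ < 1 ∧ ∀ j ∈ s, ‖w j‖ < ρ := by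
    intro s
    induction s using Finset.induction_on with
    | empty => exact ⟨1 / 2, by norm_num, by norm_num, by simp⟩
    | insert a s _ ih =>
      obtain ⟨ρ, h0, h1, h2⟩ := ih
      obtain ⟨σ, h3, h4⟩ := exists_between (max_lt h1 (hw.1 a))
      refine ⟨σ, h0.trans ((le_max_left _ _).trans_lt h3), h4, fun j hj => ?_⟩
      rcases Finset.mem_insert.1 hj with rfl | hj
      · exact (le_max_right _ _).trans_lt h3
      · exact (h2 j hj).trans ((le_max_left _ _).trans_lt h3)
  obtain ⟨ρ, h0, h1, h2⟩ := h1 (Finset.range m)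
  refine ⟨ρ, h0, h1, fun j => ?_⟩
  by_cases hj : j < m
  · exact h2 j (Finset.mem_range.2 hj)
  · rw [hw.2 j (not_lt.1 hj), norm_zero]; exact h0

lemma pad_mem_finDisc {m : ℕ} (z : polydisc m) : ((pad z).1 : ℕ → ℂ) ∈ finDisc m :=
  ⟨(pad z).2, pad_apply_of_le z⟩

/-- Every holomorphic function has a monomial expansion. -/
theorem exists_hasMonomialExpansion [CompleteSpace X] {F : ballEllTwo → X} (hF : Holomorphic F) :
    ∃ c, HasMonomialExpansion F c := by
  obtain ⟨G, hG, hGF⟩ := hF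
  choose N hN using exists_forall_le_eq_zero (ι := ℕ)
  have hex := fun (m : ℕ) (ρ : Set.Ioo (0 : ℝ) 1) => exists_hasSum_monomial hG m ρ.2.1 ρ.2.2
  choose d hd using hex
  -- Both expansions represent `G` near the origin of the smaller polydisc, so they share the
  -- coefficients there. The coefficient at `α` may thus be taken from the expansion in `N α`
  -- variables, with any radius.
  have huniq : ∀ (m m' : ℕ) (ρ ρ' : Set.Ioo (0 : ℝ) 1), m ≤ m' → ∀ α : ℕ →₀ ℕ,
      (∀ j, m ≤ j → α j = 0) → d m ρ α = d m' ρ' α := by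
    intro m m' ρ ρ' hm α hα
    rw [← sub_eq_zero]
    refine eq_zero_of_hasSum_monomial (e := fun α => d m ρ α - d m' ρ' α)
      (lt_min ρ.2.1 ρ'.2.1) (fun w hw hw0 => ?_) hα
    have h1 := hd m ρ w (fun j => (hw j).trans_le (min_le_left _ _)) hw0
    have h2 := hd m' ρ' w (fun j => (hw j).trans_le (min_le_right _ _))
      fun j hj => hw0 j (hm.trans hj)
    rw [padSeq_eq_of_le hm hw0] at h2
    simpa only [smul_sub, sub_self] using h1.sub h2
  let h : Set.Ioo (0 : ℝ) 1 := ⟨1 / 2, by norm_num, by norm_num⟩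
  refine ⟨fun α => d (N α) h α, fun m z => ?_⟩
  obtain ⟨ρ, h0, h1, h2⟩ := exists_lt_one_forall_norm_lt (pad_mem_finDisc z)
  have h3 := hd m ⟨ρ, h0, h1⟩ (pad z).1 h2 (pad_apply_of_le z)
  have h4 : G (padSeq fun i : Fin m => (pad z).1 i) = F (pad z) := by
    rw [← hGF]
    simp only [pad_apply_fin]
    rfl
  rw [h4] at h3
  refine h3.congr_fun fun α => ?_
  by_cases hα : ∀ j, m ≤ j → α j = 0
  · rcases le_total (N α) m with hm | hm
    · exact congrArg _ (huniq (N α) m h ⟨ρ, h0, h1⟩ hm α (hN α))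
    · exact congrArg _ (huniq m (N α) ⟨ρ, h0, h1⟩ h hm α hα).symm
  · push Not at hα
    rw [monomial_eq_zero (pad_apply_of_le z) hα, zero_smul, zero_smul]

/-- A point of the polydisc, from a finitely supported point. -/
def toPolydisc {m : ℕ} {w : ℕ → ℂ} (hw : w ∈ finDisc m) : polydisc m :=
  ⟨fun i => w i, fun i => hw.1 i⟩

lemma coe_pad_toPolydisc {m : ℕ} {w : ℕ → ℂ} (hw : w ∈ finDisc m) :
    ((pad (toPolydisc hw)).1 : ℕ → ℂ) = w := by
  ext j
  by_cases hj : j < m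
  · exact pad_apply_fin (toPolydisc hw) ⟨j, hj⟩
  · rw [pad_apply_of_le _ j (not_lt.1 hj), hw.2 j (not_lt.1 hj)]

lemma HasMonomialExpansion.hasSum {F : ballEllTwo → X} {c : (ℕ →₀ ℕ) → X}
    (h : HasMonomialExpansion F c) {m : ℕ} {w : ℕ → ℂ} (hw : w ∈ finDisc m) :
    HasSum (fun α => monomial α w • c α) (F (pad (toPolydisc hw))) := by
  have := h m (toPolydisc hw)
  rwa [coe_pad_toPolydisc] at this

lemma HasMonomialExpansion.unique [CompleteSpace X] {F : ballEllTwo → X} {c d : (ℕ →₀ ℕ) → X}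
    (hc : HasMonomialExpansion F c) (hd : HasMonomialExpansion F d) : c = d := by
  ext α
  obtain ⟨m, hm⟩ := exists_forall_le_eq_zero α
  rw [← sub_eq_zero]
  refine eq_zero_of_hasSum_monomial (e := fun α => c α - d α) one_pos (fun w hw hw0 => ?_) hm
  simpa only [smul_sub, sub_self] using
    (hc.hasSum (m := m) ⟨hw, hw0⟩).sub (hd.hasSum (m := m) ⟨hw, hw0⟩)

/-! ### Partial sums of Dirichlet series -/

/-- The triangle function. -/
def triangle (c x : ℝ) : ℝ := max (c - |x|) 0

lemma continuous_triangle (c : ℝ) : Continuous (triangle c) := by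
  unfold triangle
  fun_prop

lemma triangle_eq_zero {c x : ℝ} (h : c ≤ |x|) : triangle c x = 0 :=
  max_eq_right (by linarith)

lemma triangle_of_le {c x : ℝ} (h : |x| ≤ c) : triangle c x = c - |x| :=
  max_eq_left (by linarith)

lemma support_triangle_subset (c : ℝ) : Function.support (triangle c) ⊆ Set.Ioc (-c) c := by
  intro x hx
  have h : |x| < c := by
    by_contra h
    exact hx (triangle_eq_zero (not_lt.1 h))
  exact ⟨(abs_lt.1 h).1, (abs_lt.1 h).2.le⟩

/-- On either side of `0` the triangle is affine on its support, so an explicit primitive is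
available. -/
lemma integral_exp_mul_triangle {c : ℝ} (hc : 0 ≤ c) {k : ℂ} (hk : k ≠ 0) :
    ∫ x : ℝ, Complex.exp (k * x) * triangle c x
      = (Complex.exp (k * c) + Complex.exp (-(k * c)) - 2) / k ^ 2 := by
  have hE : ∀ x : ℝ, HasDerivAt (fun x : ℝ => Complex.exp (k * x)) (k * Complex.exp (k * x)) x := by
    intro x
    have h := ((hasDerivAt_id (x : ℂ)).const_mul k).cexp.comp_ofReal
    simpa [mul_comm] using h
  have hX : ∀ x : ℝ, HasDerivAt (fun x : ℝ => (x : ℂ)) 1 x := fun x =>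
    (hasDerivAt_id (x : ℂ)).comp_ofReal
  have hcont : Continuous fun x : ℝ => Complex.exp (k * x) * triangle c x := by
    have := continuous_triangle c
    fun_prop
  have h1 : ∫ x : ℝ, Complex.exp (k * x) * triangle c x
      = ∫ x in (-c)..c, Complex.exp (k * x) * triangle c x := by
    refine (intervalIntegral.integral_eq_integral_of_support_subset ?_).symm
    refine Set.Subset.trans (fun x hx => ?_) (support_triangle_subset c)
    rw [Function.mem_support] at hx ⊢
    intro h
    exact hx (by rw [h]; simp)
  have h2 : ∫ x in (0 : ℝ)..c, Complex.exp (k * x) * triangle c x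
      = ((c - c) * Complex.exp (k * c) / k + Complex.exp (k * c) / k ^ 2)
        - ((c - (0 : ℝ)) * Complex.exp (k * (0 : ℝ)) / k + Complex.exp (k * (0 : ℝ)) / k ^ 2) := by
    refine intervalIntegral.integral_eq_sub_of_hasDerivAt (f := fun x : ℝ =>
      ((c - x) * Complex.exp (k * x) / k + Complex.exp (k * x) / k ^ 2 : ℂ)) (fun x hx => ?_)
      (hcont.intervalIntegrable _ _)
    rw [Set.uIcc_of_le hc] at hx
    have h := ((((hasDerivAt_const x (c : ℂ)).sub (hX x)).mul (hE x)).div_const k).add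
      ((hE x).div_const (k ^ 2))
    refine HasDerivAt.congr_deriv h ?_
    rw [triangle_of_le (by rw [abs_of_nonneg hx.1]; exact hx.2), abs_of_nonneg hx.1]
    push_cast
    simp only [Pi.sub_apply]
    field_simp
    ring
  have h3 : ∫ x in (-c)..(0 : ℝ), Complex.exp (k * x) * triangle c x
      = ((c + (0 : ℝ)) * Complex.exp (k * (0 : ℝ)) / k - Complex.exp (k * (0 : ℝ)) / k ^ 2)
        - ((c + (-c : ℝ)) * Complex.exp (k * (-c : ℝ)) / k - Complex.exp (k * (-c : ℝ)) / k ^ 2) := by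
    refine intervalIntegral.integral_eq_sub_of_hasDerivAt (f := fun x : ℝ =>
      ((c + x) * Complex.exp (k * x) / k - Complex.exp (k * x) / k ^ 2 : ℂ)) (fun x hx => ?_)
      (hcont.intervalIntegrable _ _)
    rw [Set.uIcc_of_le (by linarith)] at hx
    have h := ((((hasDerivAt_const x (c : ℂ)).add (hX x)).mul (hE x)).div_const k).sub
      ((hE x).div_const (k ^ 2))
    refine HasDerivAt.congr_deriv h ?_
    rw [triangle_of_le (by rw [abs_of_nonpos hx.2]; linarith [hx.1]), abs_of_nonpos hx.2]
    push_cast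
    simp only [Pi.add_apply]
    field_simp
    ring
  rw [h1, ← intervalIntegral.integral_add_adjacent_intervals (hcont.intervalIntegrable _ 0)
    (hcont.intervalIntegrable 0 _), h2, h3]
  push_cast
  simp only [mul_zero, Complex.exp_zero, mul_neg]
  field_simp
  ring

/-- The trapezoid function, equal to `1` on `[-a, a]` and to `0` outside `[-b, b]`. -/
def trapezoid (a b x : ℝ) : ℝ := (triangle b x - triangle a x) / (b - a)

lemma continuous_trapezoid (a b : ℝ) : Continuous (trapezoid a b) :=
  ((continuous_triangle b).sub (continuous_triangle a)).div_const _

lemma trapezoid_of_le {a b x : ℝ} (hab : a < b) (hx : |x| ≤ a) : trapezoid a b x = 1 := by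
  unfold trapezoid
  rw [triangle_of_le hx, triangle_of_le (hx.trans hab.le), div_eq_one_iff_eq (by linarith)]
  ring

lemma trapezoid_of_ge {a b x : ℝ} (hab : a < b) (hx : b ≤ |x|) : trapezoid a b x = 0 := by
  unfold trapezoid
  rw [triangle_eq_zero hx, triangle_eq_zero (hab.le.trans hx), sub_zero, zero_div]

lemma integrable_trapezoid {a b : ℝ} (hab : a < b) :
    Integrable fun x => (trapezoid a b x : ℂ) := by
  refine ((Complex.continuous_ofReal.comp (continuous_trapezoid a b))).integrable_of_hasCompactSupport ?_
  refine HasCompactSupport.intro (isCompact_Icc (a := -b) (b := b)) fun x hx => ?_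
  rw [Function.comp_apply, trapezoid_of_ge hab, Complex.ofReal_zero]
  by_contra h
  exact hx (abs_le.1 (not_le.1 h).le)

lemma abs_trapezoid_le {a b : ℝ} (hab : a < b) (x : ℝ) : |trapezoid a b x| ≤ 1 := by
  have h1 : triangle a x ≤ triangle b x := max_le_max (by linarith) le_rfl
  have h2 : triangle b x ≤ triangle a x + (b - a) := by
    unfold triangle
    refine max_le ?_ ?_
    · linarith [le_max_left (a - |x|) 0]
    · linarith [le_max_right (a - |x|) 0]
  unfold trapezoid
  rw [abs_of_nonneg (div_nonneg (by linarith) (by linarith)), div_le_one (by linarith)]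
  linarith

-- The trapezoid is a scaled difference of two triangles, in which the constant terms of the two
-- transforms cancel.
open FourierTransform in
lemma fourier_trapezoid {a b : ℝ} (ha : 0 ≤ a) (hab : a < b) {ξ : ℝ} (hξ : ξ ≠ 0) :
    𝓕 (fun x : ℝ => (trapezoid a b x : ℂ)) ξ =
      ((Real.cos (2 * Real.pi * ξ * a) - Real.cos (2 * Real.pi * ξ * b)) * 2 /
        ((2 * Real.pi * ξ) ^ 2 * (b - a)) : ℝ) := by
  set k : ℂ := -(2 * Real.pi * ξ : ℝ) * Complex.I with hk
  have hk0 : k ≠ 0 := by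
    simp [hk, Real.pi_ne_zero, hξ]
  have hint : ∀ c : ℝ, Integrable fun x : ℝ => Complex.exp (k * x) * triangle c x := by
    intro c
    have hcont : Continuous fun x : ℝ => Complex.exp (k * x) * triangle c x := by
      have := continuous_triangle c
      fun_prop
    refine hcont.integrable_of_hasCompactSupport ?_
    refine HasCompactSupport.intro (isCompact_Icc (a := -c) (b := c)) fun x hx => ?_
    rw [triangle_eq_zero, Complex.ofReal_zero, mul_zero]
    by_contra h
    exact hx (abs_le.1 (not_le.1 h).le)
  have h1 : 𝓕 (fun x : ℝ => (trapezoid a b x : ℂ)) ξ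
      = ((∫ x : ℝ, Complex.exp (k * x) * triangle b x)
        - ∫ x : ℝ, Complex.exp (k * x) * triangle a x) / (b - a) := by
    rw [Real.fourier_real_eq_integral_exp_smul, ← integral_sub (hint b) (hint a), ← integral_div]
    refine integral_congr_ae (ae_of_all _ fun x => ?_)
    beta_reduce
    unfold trapezoid
    rw [smul_eq_mul, show ((-2 * Real.pi * x * ξ : ℝ) : ℂ) * Complex.I = k * x by
      rw [hk]; push_cast; ring]
    push_cast
    ring
  have hexp : ∀ c : ℝ, Complex.exp (k * c) + Complex.exp (-(k * c))
      = 2 * Real.cos (2 * Real.pi * ξ * c) := by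
    intro c
    rw [Complex.ofReal_cos, Complex.two_cos, hk, add_comm]
    congr 2 <;> push_cast <;> ring
  have hk2 : k ^ 2 = -((2 * Real.pi * ξ : ℝ) : ℂ) ^ 2 := by
    rw [hk, mul_pow, Complex.I_sq]; ring
  rw [h1, integral_exp_mul_triangle (by linarith) hk0, integral_exp_mul_triangle ha hk0, hexp, hexp,
    hk2]
  have h2 : 2 * Real.pi * ξ ≠ 0 := by simp [Real.pi_ne_zero, hξ]
  generalize 2 * Real.pi * ξ = w at *
  have h3 : (w : ℂ) ≠ 0 := Complex.ofReal_ne_zero.2 h2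
  have h4 : (b : ℂ) - a ≠ 0 := by
    rw [← Complex.ofReal_sub, Complex.ofReal_ne_zero]; linarith
  push_cast
  field_simp
  ring

-- The decay `|ξ|^{-2}` comes with the constant `1 / (b - a)`, too large for a steep ramp, and the
-- decay `|ξ|^{-1}`, free of this constant, is not integrable. Interpolating gives the integrable
-- `|ξ|^{-(1 + δ)}` for the price of `(b - a)^{-δ}`. For `|ξ| ≤ 1` the integral is bounded trivially
-- by `2 b`.
open FourierTransform in
lemma norm_fourier_trapezoid_le {a b δ : ℝ} (ha : 0 ≤ a) (hab : a < b) (hδ : 0 < δ) (hδ1 : δ ≤ 1)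
    (ξ : ℝ) :
    ‖𝓕 (fun x : ℝ => (trapezoid a b x : ℂ)) ξ‖
      ≤ 4 * (2 * b + (b - a) ^ (-δ)) * (1 + ‖ξ‖) ^ (-(1 + δ)) := by
  have hd : 0 < b - a := by linarith
  have hb : 0 < b := by linarith
  have h4 : (2 : ℝ) ^ (1 + δ) ≤ 4 := by
    calc (2 : ℝ) ^ (1 + δ) ≤ 2 ^ (2 : ℝ) :=
          Real.rpow_le_rpow_of_exponent_le (by norm_num) (by linarith)
      _ = 4 := by norm_num
  have hdp : 0 < (b - a) ^ (-δ) := Real.rpow_pos_of_pos hd _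
  rcases le_total ‖ξ‖ 1 with h | h
  · have h1 : ‖𝓕 (fun x : ℝ => (trapezoid a b x : ℂ)) ξ‖ ≤ 2 * b := by
      rw [Real.fourier_real_eq_integral_exp_smul]
      have hsupp : Function.support (fun x : ℝ => Complex.exp (((-2 * Real.pi * x * ξ : ℝ) : ℂ) *
          Complex.I) • (trapezoid a b x : ℂ)) ⊆ Set.Ioc (-b) b := by
        intro x hx
        rw [Function.mem_support] at hx
        have : |x| < b := by
          by_contra h'
          exact hx (by rw [trapezoid_of_ge hab (not_lt.1 h')]; simp)
        exact ⟨(abs_lt.1 this).1, (abs_lt.1 this).2.le⟩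
      rw [← intervalIntegral.integral_eq_integral_of_support_subset hsupp]
      refine (intervalIntegral.norm_integral_le_of_norm_le_const (C := 1) fun x _ => ?_).trans ?_
      · rw [norm_smul, Complex.norm_exp_ofReal_mul_I, one_mul, Complex.norm_real]
        exact abs_trapezoid_le hab x
      · rw [abs_of_nonneg (by linarith)]
        linarith
    have h2 : (1 : ℝ) ≤ 4 * (1 + ‖ξ‖) ^ (-(1 + δ)) := by
      rw [Real.rpow_neg (by positivity), ← div_eq_mul_inv, le_div_iff₀ (by positivity), one_mul]
      refine le_trans ?_ h4
      exact Real.rpow_le_rpow (by positivity) (by linarith) (by linarith)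
    calc _ ≤ 2 * b := h1
      _ ≤ (2 * b + (b - a) ^ (-δ)) * 1 := by linarith
      _ ≤ (2 * b + (b - a) ^ (-δ)) * (4 * (1 + ‖ξ‖) ^ (-(1 + δ))) := by gcongr
      _ = _ := by ring
  · have hξ0 : 0 < ‖ξ‖ := by linarith
    have hξ : ξ ≠ 0 := norm_pos_iff.1 hξ0
    rw [fourier_trapezoid ha hab hξ, Complex.norm_real]
    set w := 2 * Real.pi * ξ with hw
    have hwξ : 2 * ‖ξ‖ ≤ ‖w‖ := by
      rw [hw, norm_mul, norm_mul, Real.norm_of_nonneg Real.pi_pos.le, Real.norm_ofNat]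
      nlinarith [Real.pi_gt_three]
    have hwp : 0 < ‖w‖ := by linarith
    have hn : ‖(Real.cos (w * a) - Real.cos (w * b)) * 2 / (w ^ 2 * (b - a))‖
        = ‖Real.cos (w * a) - Real.cos (w * b)‖ * 2 / (‖w‖ ^ 2 * (b - a)) := by
      rw [norm_div, norm_mul, norm_mul, norm_pow, Real.norm_of_nonneg hd.le, Real.norm_ofNat]
    rw [hn]
    have hc1 : ‖Real.cos (w * a) - Real.cos (w * b)‖ ≤ 2 := by
      refine (norm_sub_le _ _).trans ?_
      have := Real.abs_cos_le_one (w * a)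
      have := Real.abs_cos_le_one (w * b)
      rw [Real.norm_eq_abs, Real.norm_eq_abs]
      linarith
    have hc2 : ‖Real.cos (w * a) - Real.cos (w * b)‖ ≤ ‖w‖ * (b - a) := by
      have h := Real.abs_cos_sub_cos_le (w * a) (w * b)
      rw [← mul_sub, abs_mul, abs_sub_comm a b, abs_of_pos hd] at h
      exact h
    have hb1 : ‖Real.cos (w * a) - Real.cos (w * b)‖ * 2 / (‖w‖ ^ 2 * (b - a))
        ≤ ‖ξ‖⁻¹ * (‖ξ‖ * (b - a))⁻¹ := by
      calc _ ≤ 2 * 2 / ((2 * ‖ξ‖) ^ 2 * (b - a)) := by gcongr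
        _ = _ := by field_simp
    have hb2 : ‖Real.cos (w * a) - Real.cos (w * b)‖ * 2 / (‖w‖ ^ 2 * (b - a)) ≤ ‖ξ‖⁻¹ * 1 := by
      calc _ ≤ (‖w‖ * (b - a)) * 2 / (‖w‖ ^ 2 * (b - a)) := by gcongr
        _ = 2 / ‖w‖ := by field_simp
        _ ≤ 2 / (2 * ‖ξ‖) := by gcongr
        _ = _ := by field_simp
    have hb3 : ‖Real.cos (w * a) - Real.cos (w * b)‖ * 2 / (‖w‖ ^ 2 * (b - a))
        ≤ ‖ξ‖⁻¹ * ((‖ξ‖ * (b - a))⁻¹) ^ δ := by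
      -- The interpolation is `min y 1 ≤ y ^ δ` with `y = (‖ξ‖ (b - a))⁻¹`.
      have hy : 0 < (‖ξ‖ * (b - a))⁻¹ := by positivity
      rcases le_total (‖ξ‖ * (b - a))⁻¹ 1 with hy1 | hy1
      · refine hb1.trans ?_
        gcongr
        exact Real.self_le_rpow_of_le_one hy.le hy1 hδ1
      · refine hb2.trans ?_
        gcongr
        exact Real.one_le_rpow hy1 hδ.le
    have hb4 : ‖ξ‖⁻¹ * ((‖ξ‖ * (b - a))⁻¹) ^ δ = (b - a) ^ (-δ) * ‖ξ‖ ^ (-(1 + δ)) := by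
      rw [← Real.rpow_neg_one (‖ξ‖ * (b - a)), ← Real.rpow_mul (by positivity), neg_one_mul,
        Real.mul_rpow hξ0.le hd.le, neg_add, Real.rpow_add hξ0, Real.rpow_neg_one]
      ring
    have hb5 : ‖ξ‖ ^ (-(1 + δ)) ≤ 4 * (1 + ‖ξ‖) ^ (-(1 + δ)) := by
      rw [Real.rpow_neg hξ0.le, Real.rpow_neg (by positivity), ← div_eq_mul_inv,
        inv_le_iff_one_le_mul₀ (by positivity), div_mul_eq_mul_div, le_div_iff₀ (by positivity),
        one_mul]
      calc (1 + ‖ξ‖) ^ (1 + δ) ≤ (2 * ‖ξ‖) ^ (1 + δ) :=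
            Real.rpow_le_rpow (by positivity) (by linarith) (by linarith)
        _ = 2 ^ (1 + δ) * ‖ξ‖ ^ (1 + δ) := Real.mul_rpow (by norm_num) hξ0.le
        _ ≤ _ := by gcongr
    calc _ ≤ (b - a) ^ (-δ) * ‖ξ‖ ^ (-(1 + δ)) := hb3.trans hb4.le
      _ ≤ (2 * b + (b - a) ^ (-δ)) * (4 * (1 + ‖ξ‖) ^ (-(1 + δ))) := by
        gcongr
        linarith
      _ = _ := by ring

open FourierTransform in
/-- A multiplier that cuts off a Dirichlet series after `N` terms. -/
lemma exists_cutoff_kernel {δ : ℝ} (hδ : 0 < δ) (hδ1 : δ ≤ 1) :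
    ∃ C : ℝ, 0 ≤ C ∧ ∀ N : ℕ, 0 < N → ∃ g : ℝ → ℂ, Integrable g ∧
      ∫ t, ‖g t‖ ≤ C * (N : ℝ) ^ δ ∧
      ∀ n : ℕ, ∫ t : ℝ, Complex.exp (2 * Real.pi * (t * Real.log (n + 1)) * Complex.I) * g t
        = if n < N then 1 else 0 := by
  have hI : Integrable fun ξ : ℝ => (1 + ‖ξ‖) ^ (-(1 + δ)) :=
    integrable_one_add_norm (by rw [Module.finrank_self]; push_cast; linarith)
  set I : ℝ := ∫ ξ : ℝ, (1 + ‖ξ‖) ^ (-(1 + δ)) with hIdef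
  have hI0 : 0 ≤ I := integral_nonneg fun ξ => by positivity
  refine ⟨4 * (2 / δ + 1) * 2 ^ δ * I, by positivity, fun N hN => ?_⟩
  have hN1 : (1 : ℝ) ≤ N := by exact_mod_cast hN
  -- The frequencies are `log (n + 1)`: those with `n < N` lie on the plateau, the others at or
  -- beyond `log (N + 1)`. The ramp between has width at least `1 / (N + 1)`, so it costs a factor
  -- of order `N ^ δ`.
  set a := Real.log N with ha
  set b := Real.log (N + 1) with hb
  have ha0 : 0 ≤ a := Real.log_nonneg hN1
  have hab : a < b := Real.log_lt_log (by linarith) (by linarith)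
  have hbd : b ≤ (N + 1 : ℝ) ^ δ / δ := Real.log_le_rpow_div (by linarith) hδ
  have hd : ((N : ℝ) + 1)⁻¹ ≤ b - a := by
    rw [hb, ha, ← Real.log_div (by linarith) (by linarith)]
    refine le_trans (le_of_eq ?_) (Real.one_sub_inv_le_log_of_pos (by positivity))
    field_simp
    ring
  have hdp : (b - a) ^ (-δ) ≤ ((N : ℝ) + 1) ^ δ := by
    rw [Real.rpow_neg (by linarith), ← Real.inv_rpow (by linarith)]
    refine Real.rpow_le_rpow (inv_nonneg.2 (by linarith)) ?_ hδ.le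
    exact inv_le_of_inv_le₀ (by positivity) hd
  have h2N : ((N : ℝ) + 1) ^ δ ≤ 2 ^ δ * (N : ℝ) ^ δ := by
    rw [← Real.mul_rpow (by norm_num) (by linarith)]
    exact Real.rpow_le_rpow (by linarith) (by linarith) hδ.le
  have hcoef : 4 * (2 * b + (b - a) ^ (-δ)) ≤ 4 * (2 / δ + 1) * 2 ^ δ * (N : ℝ) ^ δ := by
    calc 4 * (2 * b + (b - a) ^ (-δ)) ≤ 4 * (2 * ((N + 1 : ℝ) ^ δ / δ) + ((N : ℝ) + 1) ^ δ) := by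
          gcongr
      _ = 4 * (2 / δ + 1) * ((N : ℝ) + 1) ^ δ := by ring
      _ ≤ 4 * (2 / δ + 1) * (2 ^ δ * (N : ℝ) ^ δ) := by gcongr
      _ = _ := by ring
  have hcont : Continuous fun x : ℝ => (trapezoid a b x : ℂ) :=
    Complex.continuous_ofReal.comp (continuous_trapezoid a b)
  have hbound := norm_fourier_trapezoid_le ha0 hab hδ hδ1
  have hgm : Continuous (𝓕 fun x : ℝ => (trapezoid a b x : ℂ)) :=
    VectorFourier.fourierIntegral_continuous Real.continuous_fourierChar
      (innerSL ℝ : ℝ →L[ℝ] ℝ →L[ℝ] ℝ).continuous₂ (integrable_trapezoid hab)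
  have hg : Integrable (𝓕 fun x : ℝ => (trapezoid a b x : ℂ)) :=
    (hI.const_mul _).mono' hgm.aestronglyMeasurable (ae_of_all _ hbound)
  refine ⟨_, hg, ?_, fun n => ?_⟩
  · calc ∫ t, ‖𝓕 (fun x : ℝ => (trapezoid a b x : ℂ)) t‖
        ≤ ∫ t : ℝ, 4 * (2 * b + (b - a) ^ (-δ)) * (1 + ‖t‖) ^ (-(1 + δ)) :=
          integral_mono hg.norm (hI.const_mul _) hbound
      _ = 4 * (2 * b + (b - a) ^ (-δ)) * I := integral_const_mul _ _
      _ ≤ (4 * (2 / δ + 1) * 2 ^ δ * (N : ℝ) ^ δ) * I := by gcongr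
      _ = _ := by ring
  -- By Fourier inversion, integrating `g` against the exponential of frequency `log (n + 1)`
  -- returns the value of the trapezoid there.
  · have hinv := congrFun (hcont.fourierInv_fourier_eq (integrable_trapezoid hab) hg)
      (Real.log (n + 1))
    rw [Real.fourierInv_eq'] at hinv
    have hlog : 0 ≤ Real.log ((n : ℝ) + 1) := Real.log_nonneg (by linarith [n.cast_nonneg (α := ℝ)])
    have hval : (trapezoid a b (Real.log (n + 1)) : ℂ) = if n < N then 1 else 0 := by
      split_ifs with h
      · rw [trapezoid_of_le hab, Complex.ofReal_one]
        rw [abs_of_nonneg hlog]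
        exact Real.log_le_log (by positivity) (by exact_mod_cast h)
      · rw [trapezoid_of_ge hab, Complex.ofReal_zero]
        rw [abs_of_nonneg hlog]
        exact Real.log_le_log (by positivity) (by exact_mod_cast Nat.succ_le_succ (not_lt.1 h))
    rw [← hval, ← hinv]
    refine integral_congr_ae (ae_of_all _ fun t => ?_)
    beta_reduce
    rw [smul_eq_mul]
    congr 2
    simp [mul_comm]

/-- The partial sums of a bounded Dirichlet series grow slower than any power. -/
lemma exists_norm_sum_range_le {δ : ℝ} (hδ : 0 < δ) (hδ1 : δ ≤ 1) :
    ∃ C : ℝ, 0 ≤ C ∧ ∀ {Y : Type*} [NormedAddCommGroup Y] [NormedSpace ℂ Y] [CompleteSpace Y]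
      (y : ℕ → Y) (M : ℝ), (Summable fun n => ‖y n‖) →
      (∀ t : ℝ, ‖∑' n : ℕ, Complex.exp (t * Real.log (n + 1) * Complex.I) • y n‖ ≤ M) →
      ∀ N : ℕ, ‖∑ n ∈ Finset.range N, y n‖ ≤ C * (N : ℝ) ^ δ * M := by
  obtain ⟨C, hC, h⟩ := exists_cutoff_kernel hδ hδ1
  refine ⟨C, hC, fun {Y} _ _ _ y M hy hM N => ?_⟩
  have hM0 : 0 ≤ M := (norm_nonneg _).trans (hM 0)
  rcases N.eq_zero_or_pos with rfl | hN
  · simp only [Finset.range_zero, Finset.sum_empty, norm_zero]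
    positivity
  obtain ⟨g, hg, hgn, hgv⟩ := h N hN
  have hnorm : ∀ (t : ℝ) (n : ℕ),
      ‖Complex.exp (2 * Real.pi * (t * Real.log (n + 1)) * Complex.I)‖ = 1 := fun t n => by
    rw [← Complex.ofReal_ofNat, ← Complex.ofReal_mul, ← Complex.ofReal_mul, ← Complex.ofReal_mul,
      Complex.norm_exp_ofReal_mul_I]
  have hint : ∀ n : ℕ, Integrable fun t : ℝ =>
      (Complex.exp (2 * Real.pi * (t * Real.log (n + 1)) * Complex.I) * g t) • y n := fun n => by
    refine Integrable.smul_const ?_ _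
    refine hg.bdd_mul (c := 1) ?_ (ae_of_all _ fun t => (hnorm t n).le)
    exact Continuous.aestronglyMeasurable (by fun_prop)
  -- The partial sum is the integral, weighted by `g`, of the values of the series along a vertical
  -- line.
  have key := hasSum_integral_of_summable_integral_norm hint (by
    simp only [norm_smul, norm_mul, hnorm, one_mul, integral_mul_const]
    exact hy.mul_left _)
  have h1 : HasSum (fun n : ℕ => ∫ t : ℝ,
      (Complex.exp (2 * Real.pi * (t * Real.log (n + 1)) * Complex.I) * g t) • y n)
      (∑ n ∈ Finset.range N, y n) := by
    simp only [integral_smul_const, hgv]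
    have : ∀ n ∉ Finset.range N, (if n < N then (1 : ℂ) else 0) • y n = 0 := fun n hn => by
      rw [if_neg (by simpa using hn), zero_smul]
    have h2 := hasSum_sum_of_ne_finset_zero (L := .unconditional ℕ) this
    rwa [Finset.sum_congr rfl fun n hn => by
      rw [if_pos (Finset.mem_range.1 hn), one_smul]] at h2
  rw [h1.unique key]
  have h2 : ∀ t : ℝ, ‖∑' n : ℕ,
      (Complex.exp (2 * Real.pi * (t * Real.log (n + 1)) * Complex.I) * g t) • y n‖
      ≤ ‖g t‖ * M := by
    intro t
    have h3 : ∀ n : ℕ, (Complex.exp (2 * Real.pi * (t * Real.log (n + 1)) * Complex.I) * g t) • y n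
        = g t • Complex.exp ((2 * Real.pi * t : ℝ) * Real.log (n + 1) * Complex.I) • y n := by
      intro n
      rw [smul_smul, mul_comm]
      congr 3
      push_cast
      ring
    simp only [h3]
    rw [Summable.tsum_const_smul, norm_smul]
    · gcongr
      exact hM _
    · refine Summable.of_norm (hy.congr fun n => ?_)
      rw [norm_smul, ← Complex.ofReal_mul, Complex.norm_exp_ofReal_mul_I, one_mul]
  calc _ ≤ ∫ t, ‖g t‖ * M := norm_integral_le_of_norm_le (hg.norm.mul_const M) (ae_of_all _ h2)
    _ = (∫ t, ‖g t‖) * M := integral_mul_const _ _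
    _ ≤ _ := by gcongr

/-- A quantitative form of Bohr's theorem: the tails of a translate of a bounded Dirichlet series
are small. -/
theorem exists_norm_tsum_sub_sum_range_le {ε : ℝ} (hε : 0 < ε) (hε1 : ε ≤ 1) :
    ∃ C : ℝ, 0 ≤ C ∧ ∀ {Y : Type*} [NormedAddCommGroup Y] [NormedSpace ℂ Y] [CompleteSpace Y]
      (y : ℕ → Y) (M : ℝ), (Summable fun n => ‖y n‖) →
      (∀ t : ℝ, ‖∑' n : ℕ, Complex.exp (t * Real.log (n + 1) * Complex.I) • y n‖ ≤ M) →
      ∀ N : ℕ, ‖∑' n : ℕ, (((n : ℝ) + 1) ^ (-ε) : ℝ) • y n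
        - ∑ n ∈ Finset.range N, (((n : ℝ) + 1) ^ (-ε) : ℝ) • y n‖
        ≤ C * ((N : ℝ) + 1) ^ (-(ε / 2)) * M := by
  -- The weights are `v n ^ 2`, while the partial sums of `y` grow at most like `(v n)⁻¹`: one
  -- factor `v` pays for the growth, the other remains as decay.
  obtain ⟨B, hB, hS⟩ := exists_norm_sum_range_le (half_pos hε) (by linarith)
  refine ⟨3 * B, by positivity, fun {Y} _ _ _ y M hy hM N => ?_⟩
  have hM0 : 0 ≤ M := (norm_nonneg _).trans (hM 0)
  replace hS := hS y M hy hM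
  set v : ℕ → ℝ := fun n => ((n : ℝ) + 1) ^ (-(ε / 2)) with hv
  have hv0 : ∀ n, 0 < v n := fun n => by simp only [hv]; positivity
  have hu : ∀ n : ℕ, ((n : ℝ) + 1) ^ (-ε) = v n ^ 2 := fun n => by
    simp only [hv]
    rw [← Real.rpow_natCast, ← Real.rpow_mul (by positivity)]
    congr 1
    push_cast
    ring
  have hvn : ∀ n : ℕ, v (n + 1) ≤ v n := fun n => by
    simp only [hv]
    refine Real.rpow_le_rpow_of_nonpos (by positivity) (by push_cast; linarith) (by linarith)
  have hinv : ∀ n : ℕ, ((n : ℝ) + 1) ^ (ε / 2) = (v n)⁻¹ := fun n => by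
    simp only [hv]
    rw [Real.rpow_neg (by positivity), inv_inv]
  have hS1 : ∀ n, ‖∑ j ∈ Finset.range (n + 1), y j‖ ≤ B * M * (v n)⁻¹ := fun n => by
    have := hS (n + 1)
    push_cast at this
    rw [hinv] at this
    linarith
  have hS2 : ∀ n : ℕ, ‖∑ j ∈ Finset.range n, y j‖ ≤ B * M * (v n)⁻¹ := fun n => by
    refine (hS n).trans ?_
    rw [← hinv, mul_right_comm]
    gcongr
    linarith
  simp only [hu]
  -- Abel summation, written as an induction on `K`. Each step adds at most `2 (v K - v (K + 1))`
  -- times `B * M`, which telescopes.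
  have hD : ∀ K, N ≤ K → ‖(∑ n ∈ Finset.range K, v n ^ 2 • y n
      - ∑ n ∈ Finset.range N, v n ^ 2 • y n) - v K ^ 2 • ∑ n ∈ Finset.range K, y n‖
      ≤ B * M * (v N + 2 * (v N - v K)) := by
    intro K hK
    induction K, hK using Nat.le_induction with
    | base =>
      rw [sub_self, zero_sub, norm_neg, sub_self, mul_zero, add_zero, norm_smul,
        Real.norm_of_nonneg (by positivity)]
      calc v N ^ 2 * _ ≤ v N ^ 2 * (B * M * (v N)⁻¹) := by gcongr; exact hS2 N
        _ = _ := by have := (hv0 N).ne'; field_simp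
    | succ K hK ih =>
      have h1 : (∑ n ∈ Finset.range (K + 1), v n ^ 2 • y n
          - ∑ n ∈ Finset.range N, v n ^ 2 • y n) - v (K + 1) ^ 2 • ∑ n ∈ Finset.range (K + 1), y n
          = ((∑ n ∈ Finset.range K, v n ^ 2 • y n
          - ∑ n ∈ Finset.range N, v n ^ 2 • y n) - v K ^ 2 • ∑ n ∈ Finset.range K, y n)
          + (v K ^ 2 - v (K + 1) ^ 2) • ∑ n ∈ Finset.range (K + 1), y n := by
        rw [sub_smul, Finset.sum_range_succ (fun n => v n ^ 2 • y n), Finset.sum_range_succ y,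
          smul_add, smul_add]
        abel
      rw [h1]
      refine (norm_add_le _ _).trans ?_
      have h2 : 0 ≤ v K ^ 2 - v (K + 1) ^ 2 := by
        have := hvn K
        have := (hv0 (K + 1)).le
        have : v (K + 1) ^ 2 ≤ v K ^ 2 := by gcongr
        linarith
      have h3 : ‖(v K ^ 2 - v (K + 1) ^ 2) • ∑ n ∈ Finset.range (K + 1), y n‖
          ≤ B * M * (2 * (v K - v (K + 1))) := by
        rw [norm_smul, Real.norm_of_nonneg h2]
        calc (v K ^ 2 - v (K + 1) ^ 2) * _ ≤ (v K ^ 2 - v (K + 1) ^ 2) * (B * M * (v K)⁻¹) := by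
              gcongr; exact hS1 K
          _ = B * M * ((v K - v (K + 1)) * ((v K + v (K + 1)) / v K)) := by ring
          _ ≤ B * M * ((v K - v (K + 1)) * 2) := by
              have := hvn K
              have h4 : (v K + v (K + 1)) / v K ≤ 2 := by
                rw [div_le_iff₀ (hv0 K)]; linarith
              have h5 : 0 ≤ v K - v (K + 1) := by linarith
              gcongr
          _ = _ := by ring
      linarith
  have hsum : Summable fun n => v n ^ 2 • y n := by
    refine Summable.of_norm (hy.of_nonneg_of_le (fun _ => norm_nonneg _) fun n => ?_)
    rw [norm_smul, Real.norm_of_nonneg (by positivity)]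
    refine mul_le_of_le_one_left (norm_nonneg _) ?_
    rw [← hu]
    exact Real.rpow_le_one_of_one_le_of_nonpos (by linarith [n.cast_nonneg (α := ℝ)]) (by linarith)
  refine le_of_tendsto ((hsum.hasSum.tendsto_sum_nat.sub_const _).norm) ?_
  filter_upwards [eventually_ge_atTop N] with K hK
  -- The boundary term costs `v K`, absorbed by the telescoped `-2 v K`; what remains is at most `3
  -- v N`.
  have h1 : ‖v K ^ 2 • ∑ n ∈ Finset.range K, y n‖ ≤ B * M * v K := by
    rw [norm_smul, Real.norm_of_nonneg (by positivity)]
    calc v K ^ 2 * _ ≤ v K ^ 2 * (B * M * (v K)⁻¹) := by gcongr; exact hS2 K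
      _ = _ := by have := (hv0 K).ne'; field_simp
  have h2 := norm_add_le ((∑ n ∈ Finset.range K, v n ^ 2 • y n
      - ∑ n ∈ Finset.range N, v n ^ 2 • y n) - v K ^ 2 • ∑ n ∈ Finset.range K, y n)
      (v K ^ 2 • ∑ n ∈ Finset.range K, y n)
  rw [sub_add_cancel] at h2
  have h3 := hD K hK
  have h4 : 0 ≤ B * M * v K := by have := hv0 K; positivity
  change _ ≤ 3 * B * v N * M
  linarith

/-! ### Bounded sections -/

/-- All dilated sections of the power series `∑ c_α ω^α` are bounded by `M` in `L_p`. -/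
def SectionBound (p : ℝ≥0∞) (c : (ℕ →₀ ℕ) → X) (M : ℝ≥0∞) : Prop :=
  ∀ (m : ℕ), ∀ w ∈ finDisc m, eLpNorm (fun x => powerSum c (rot w x)) p haarTorus ≤ M

lemma enorm_torusCoeff_le {p : ℝ≥0∞} (hp : 1 ≤ p) {f : Torus → X}
    (hf : AEStronglyMeasurable f haarTorus) (α : ℕ →₀ ℤ) :
    ‖torusCoeff f α‖ₑ ≤ eLpNorm f p haarTorus := by
  refine le_trans ?_ (eLpNorm_le_eLpNorm_of_exponent_le hp hf)
  rw [eLpNorm_one_eq_lintegral_enorm]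
  refine (enorm_integral_le_lintegral_enorm _).trans (le_of_eq (lintegral_congr fun x => ?_))
  rw [enorm_smul, ← ofReal_norm (character _ _), norm_character, ENNReal.ofReal_one,
    one_mul]

lemma powerSum_monomial_smul (c : (ℕ →₀ ℕ) → X) (v z : ℕ → ℂ) :
    powerSum (fun α => monomial α v • c α) z = powerSum c fun j => z j * v j := by
  unfold powerSum
  refine tsum_congr fun α => ?_
  rw [monomial_mul, mul_smul]

lemma powerSum_rot_constSeq {F : ballEllTwo → X} {c : (ℕ →₀ ℕ) → X}
    (hc : HasMonomialExpansion F c) (m : ℕ) (r : Set.Ioo (0 : ℝ) 1) (x : Torus) :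
    powerSum c (rot (constSeq m r) x) = F (pad (scaled r fun i : Fin m => x i)) := by
  have hw := rot_mem_finDisc (constSeq_mem_finDisc m r.2.1.le r.2.2) x
  have h : toPolydisc hw = scaled r fun i : Fin m => x i := by
    refine Subtype.ext (funext fun i => ?_)
    change constSeq m r i * _ = _
    rw [constSeq, if_pos i.2]
    rfl
  rw [powerSum, (hc.hasSum hw).tsum_eq, h]

lemma eLpNorm_pad_scaled {p : ℝ≥0∞} {F : ballEllTwo → X} (hF : Continuous F) {c : (ℕ →₀ ℕ) → X}
    (hc : HasMonomialExpansion F c) (m : ℕ) (r : Set.Ioo (0 : ℝ) 1) :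
    eLpNorm (fun x : Fin m → UnitAddCircle => F (pad (scaled r x))) p (haarFinTorus m)
      = eLpNorm (fun x => powerSum c (rot (constSeq m r) x)) p haarTorus := by
  simp only [powerSum_rot_constSeq hc]
  exact (eLpNorm_comp_measurePreserving
    (hF.comp (continuous_pad_scaled r)).aestronglyMeasurable (measurePreserving_projFin m)).symm

lemma hardyBallNorm_le_of_sectionBound {p : ℝ≥0∞} {F : ballEllTwo → X} (hF : Continuous F)
    {c : (ℕ →₀ ℕ) → X} (hc : HasMonomialExpansion F c) {M : ℝ≥0∞} (h : SectionBound p c M) :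
    hardyBallNorm p F ≤ M := by
  refine iSup₂_le fun m r => ?_
  rw [eLpNorm_pad_scaled hF hc]
  exact h m _ (constSeq_mem_finDisc m r.2.1.le r.2.2)

/-- A Fourier coefficient is bounded by the norm of the section, and the radius tends to `1`. The
radius is written `t * t` because the `c α` are not yet known to be bounded: one factor `t` makes
them so, the other provides absolute convergence. -/
lemma enorm_coeff_le_hardyBallNorm [CompleteSpace X] {p : ℝ≥0∞} (hp : 1 ≤ p) {F : ballEllTwo → X}
    (hF : Continuous F) {c : (ℕ →₀ ℕ) → X} (hc : HasMonomialExpansion F c) (α : ℕ →₀ ℕ) :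
    ‖c α‖ₑ ≤ hardyBallNorm p F := by
  obtain ⟨m, hm⟩ := exists_forall_le_eq_zero α
  have hr : ∀ t ∈ Set.Ioo (0 : ℝ) 1, ‖monomial α (constSeq m (t * t)) • c α‖ₑ ≤ hardyBallNorm p F := by
    intro t ht
    have ht2 : t * t ∈ Set.Ioo (0 : ℝ) 1 := ⟨mul_pos ht.1 ht.1, by nlinarith [ht.1, ht.2]⟩
    have hw := constSeq_mem_finDisc m ht.1.le ht.2
    obtain ⟨C, hC⟩ := exists_norm_le_of_summable (hc.hasSum hw).summable
    have hmul : ∀ x, (fun j => rot (constSeq m t) x j * constSeq m t j)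
        = rot (constSeq m (t * t)) x := fun x => by
      ext j
      unfold rot constSeq
      split_ifs
      · push_cast; ring
      · simp
    have h1 := torusCoeff_powerSum_rot_intIndex hw hC α
    have h3 := enorm_torusCoeff_le hp (continuous_powerSum_rot hw hC).aestronglyMeasurable
      (intIndex α)
    rw [h1, smul_smul, ← monomial_mul] at h3
    simp only [powerSum_monomial_smul, hmul] at h3
    rw [← eLpNorm_pad_scaled hF hc m ⟨t * t, ht2⟩] at h3
    have h4 : (fun j => constSeq m t j * constSeq m t j) = constSeq m (t * t) := by
      ext j
      unfold constSeq
      split_ifs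
      · push_cast; ring
      · simp
    rw [h4] at h3
    exact h3.trans (le_iSup₂ (f := fun (m : ℕ) (r : Set.Ioo (0 : ℝ) 1) =>
      eLpNorm (fun x : Fin m → UnitAddCircle => F (pad (scaled r x))) p (haarFinTorus m))
      m ⟨t * t, ht2⟩)
  have hlim : Tendsto (fun t : ℝ => ‖monomial α (constSeq m (t * t)) • c α‖ₑ) (𝓝[<] 1)
      (𝓝 ‖c α‖ₑ) := by
    have hcont : Continuous fun t : ℝ => ‖monomial α (constSeq m (t * t)) • c α‖ₑ := by
      simp only [monomial_constSeq hm]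
      fun_prop
    have h := (hcont.tendsto 1).mono_left (nhdsWithin_le_nhds (s := Set.Iio 1))
    simpa [monomial_constSeq hm] using h
  refine le_of_tendsto hlim ?_
  filter_upwards [Ioo_mem_nhdsLT (zero_lt_one' ℝ)] with t ht using hr t ht

/-- Dilation of a finitely supported point. -/
lemma exists_dilate {m : ℕ} {w : ℕ → ℂ} {ρ : ℝ} (hw0 : ∀ j, m ≤ j → w j = 0)
    (hρ : 0 < ρ) (hw : ∀ j, ‖w j‖ < ρ) :
    (fun j => w j / ρ) ∈ finDisc m ∧ ∀ j, w j / ρ * constSeq m ρ j = w j := by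
  refine ⟨⟨fun j => ?_, fun j hj => by beta_reduce; rw [hw0 j hj, zero_div]⟩, fun j => ?_⟩
  · rw [norm_div, Complex.norm_real, Real.norm_of_nonneg hρ.le]
    exact (div_lt_one hρ).2 (hw j)
  · unfold constSeq
    split_ifs with h
    · rw [div_mul_cancel₀]
      exact_mod_cast hρ.ne'
    · rw [hw0 j (not_lt.1 h), zero_div, mul_zero]

lemma exists_norm_le_of_enorm_le {ι E : Type*} [NormedAddCommGroup E] {c : ι → E}
    {M : ℝ≥0∞} (hM : M ≠ ∞)
    (h : ∀ i, ‖c i‖ₑ ≤ M) (i : ι) : ‖c i‖ ≤ M.toReal := by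
  rw [← toReal_enorm]
  exact ENNReal.toReal_mono hM (h i)

lemma memLp_of_continuous {E : Type*} [NormedAddCommGroup E] {p : ℝ≥0∞} {f : Torus → E}
    (hf : Continuous f) :
    MemLp f p haarTorus := by
  obtain ⟨C, hC⟩ := (isCompact_range hf).isBounded.exists_norm_le
  exact MemLp.of_bound hf.aestronglyMeasurable C (ae_of_all _ fun x => hC _ ⟨x, rfl⟩)

/-- The norm of `F` tests only points with equal radii. A general `w` is `w / ρ` times the point
with all radii `ρ`, and the Poisson contraction disposes of the dilation by `w / ρ`. -/
lemma sectionBound_hardyBallNorm [CompleteSpace X] {p : ℝ≥0∞} (hp1 : 1 ≤ p) (hp : p ≠ ∞)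
    {F : ballEllTwo → X} (hF : Continuous F) {c : (ℕ →₀ ℕ) → X} (hc : HasMonomialExpansion F c)
    {C : ℝ} (hC : ∀ α, ‖c α‖ ≤ C) : SectionBound p c (hardyBallNorm p F) := by
  intro m w hw
  obtain ⟨ρ, h0, h1, h2⟩ := exists_lt_one_forall_norm_lt hw
  obtain ⟨hz, hzw⟩ := exists_dilate hw.2 h0 h2
  have hv := constSeq_mem_finDisc m h0.le h1
  have hcont := continuous_powerSum_rot hv hC
  have key := eLpNorm_powerSum_rot_le hp1 hp hcont.stronglyMeasurable (memLp_of_continuous hcont)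
    (torusCoeff_powerSum_rot_of_neg hv hC) hz
  simp only [torusCoeff_powerSum_rot_intIndex hv hC, powerSum_monomial_smul] at key
  rw [← eLpNorm_pad_scaled hF hc m ⟨ρ, h0, h1⟩] at key
  have h3 : ∀ x, (fun j => rot (fun j => w j / ρ) x j * constSeq m ρ j) = rot w x := fun x => by
    ext j
    rw [rot, rot, mul_right_comm, hzw]
  simp only [h3] at key
  exact key.trans (le_iSup₂ (f := fun (m : ℕ) (r : Set.Ioo (0 : ℝ) 1) =>
      eLpNorm (fun x : Fin m → UnitAddCircle => F (pad (scaled r x))) p (haarFinTorus m))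
      m ⟨ρ, h0, h1⟩)

/-- The bound for point evaluations, in terms of the bound for sections. -/
lemma SectionBound.norm_powerSum_le [CompleteSpace X] {p : ℝ≥0∞} (hp1 : 1 ≤ p)
    {c : (ℕ →₀ ℕ) → X} {C : ℝ} (hC : ∀ α, ‖c α‖ ≤ C) {M : ℝ≥0∞} (hM : M ≠ ∞)
    (h : SectionBound p c M) {m : ℕ} {w : ℕ → ℂ} (hw : w ∈ finDisc m) :
    ‖powerSum c w‖ ≤ (∏ j : Fin m, (1 - ‖w j‖ ^ 2)⁻¹) * M.toReal := by
  obtain ⟨ρ₀, h0, h1, h2⟩ := exists_lt_one_forall_norm_lt hw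
  -- For `ρ < 1` the section of radius `ρ` is a continuous function, and its power series at `w / ρ`
  -- is the one to be bounded. Then `ρ` tends to `1`.
  have hρ : ∀ ρ ∈ Set.Ioo ρ₀ 1, ‖powerSum c w‖
      ≤ (∏ j : Fin m, (1 - (‖w j‖ / ρ) ^ 2)⁻¹) * M.toReal := by
    intro ρ hρ
    have hρ0 : 0 < ρ := h0.trans hρ.1
    obtain ⟨hz, hzw⟩ := exists_dilate hw.2 hρ0 fun j => (h2 j).trans hρ.1
    have hv := constSeq_mem_finDisc m hρ0.le hρ.2
    have hcont := continuous_powerSum_rot hv hC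
    have key := BohrHardy.norm_powerSum_le
      ((memLp_of_continuous (p := 1) hcont).integrable le_rfl)
      (torusCoeff_powerSum_rot_of_neg hv hC) hz
    simp only [torusCoeff_powerSum_rot_intIndex hv hC, powerSum_monomial_smul, hzw, norm_div,
      Complex.norm_real, Real.norm_of_nonneg hρ0.le] at key
    refine key.trans ?_
    have hint : ∫ x, ‖powerSum c (rot (constSeq m ρ) x)‖ ∂haarTorus ≤ M.toReal := by
      rw [integral_norm_eq_lintegral_enorm hcont.aestronglyMeasurable]
      refine ENNReal.toReal_mono hM ?_
      rw [← eLpNorm_one_eq_lintegral_enorm]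
      exact (eLpNorm_le_eLpNorm_of_exponent_le hp1 hcont.aestronglyMeasurable).trans (h m _ hv)
    refine mul_le_mul_of_nonneg_left hint (Finset.prod_nonneg fun j _ => inv_nonneg.2 ?_)
    have h3 : ‖w j‖ / ρ < 1 := (div_lt_one hρ0).2 ((h2 j).trans hρ.1)
    have h4 : 0 ≤ ‖w j‖ / ρ := by positivity
    nlinarith
  have hlim : Tendsto (fun ρ : ℝ => (∏ j : Fin m, (1 - (‖w j‖ / ρ) ^ 2)⁻¹) * M.toReal) (𝓝[<] 1)
      (𝓝 ((∏ j : Fin m, (1 - ‖w j‖ ^ 2)⁻¹) * M.toReal)) := by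
    refine Tendsto.mono_left ?_ nhdsWithin_le_nhds
    refine Tendsto.mul_const _ (tendsto_finsetProd _ fun j _ => ?_)
    have h3 : (1 - ‖w j‖ ^ 2) ≠ 0 := by
      have := hw.1 j
      nlinarith [norm_nonneg (w j)]
    refine Tendsto.inv₀ (tendsto_const_nhds.sub (Tendsto.pow ?_ 2)) h3
    have h4 : ContinuousAt (fun ρ : ℝ => ‖w j‖ / ρ) 1 :=
      continuousAt_const.div continuousAt_id one_ne_zero
    simpa using h4.tendsto
  refine ge_of_tendsto hlim ?_
  filter_upwards [Ioo_mem_nhdsLT h1] with ρ h using hρ ρ h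

lemma prod_inv_one_sub_le {ι : Type*} (s : Finset ι) {x : ι → ℝ} {q : ℝ} (hq : q < 1)
    (hx0 : ∀ i, 0 ≤ x i) (hx : ∀ i, x i ≤ q) :
    ∏ i ∈ s, (1 - x i)⁻¹ ≤ Real.exp ((∑ i ∈ s, x i) / (1 - q)) := by
  rw [Finset.sum_div, Real.exp_sum]
  refine Finset.prod_le_prod (fun i _ => ?_) fun i _ => ?_
  · have := hx i
    exact inv_nonneg.2 (by linarith)
  · have h1 := hx i
    have h2 := hx0 i
    have h3 : 0 < 1 - x i := by linarith
    calc (1 - x i)⁻¹ = x i / (1 - x i) + 1 := by field_simp; ring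
      _ ≤ Real.exp (x i / (1 - x i)) := Real.add_one_le_exp _
      _ ≤ Real.exp (x i / (1 - q)) := by
        gcongr

/-- Here `ℓ₂` enters: the bound does not involve `m`, only the sum of the squares and a bound `θ <
1` for the coordinates. -/
lemma SectionBound.norm_powerSum_le_exp [CompleteSpace X] {p : ℝ≥0∞} (hp1 : 1 ≤ p)
    {c : (ℕ →₀ ℕ) → X} {C : ℝ} (hC : ∀ α, ‖c α‖ ≤ C) {M : ℝ≥0∞} (hM : M ≠ ∞)
    (h : SectionBound p c M) {m : ℕ} {w : ℕ → ℂ} (hw0 : ∀ j, m ≤ j → w j = 0) {θ S : ℝ}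
    (hθ : θ < 1) (hw : ∀ j, ‖w j‖ ≤ θ) (hS : ∑ j ∈ Finset.range m, ‖w j‖ ^ 2 ≤ S) :
    ‖powerSum c w‖ ≤ Real.exp (S / (1 - θ ^ 2)) * M.toReal := by
  have hθ0 : 0 ≤ θ := (norm_nonneg _).trans (hw 0)
  refine (h.norm_powerSum_le hp1 hC hM ⟨fun j => (hw j).trans_lt hθ, hw0⟩).trans ?_
  refine mul_le_mul_of_nonneg_right ?_ ENNReal.toReal_nonneg
  refine (prod_inv_one_sub_le Finset.univ (x := fun j : Fin m => ‖w j‖ ^ 2) (q := θ ^ 2)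
    (by nlinarith) (fun _ => by positivity) fun j => ?_).trans ?_
  · exact pow_le_pow_left₀ (norm_nonneg _) (hw _) 2
  · rw [← Finset.sum_range (fun j => ‖w j‖ ^ 2)]
    have : 0 < 1 - θ ^ 2 := by nlinarith
    gcongr

/-! ### Primes -/

/-- The homomorphism `n ↦ n^s`. -/
def cpowHom (s : ℂ) : ℕ+ →* ℂ where
  toFun n := ((n : ℕ) : ℂ) ^ s
  map_one' := by simp
  map_mul' a b := by rw [PNat.mul_coe, Nat.cast_mul, Complex.natCast_mul_natCast_cpow]

lemma monomial_prime_cpow (α : ℕ →₀ ℕ) (s : ℂ) :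
    monomial α (fun j => ((prime j : ℕ) : ℂ) ^ s) = ((primePow α : ℕ) : ℂ) ^ s := by
  change _ = cpowHom s (primePow α)
  unfold monomial primePow
  rw [map_finsuppProd]
  simp only [map_pow]
  rfl

lemma coe_primePow (α : ℕ →₀ ℕ) :
    (primePow α : ℕ) = (α.embDomain ⟨Nat.nth Nat.Prime,
      Nat.nth_injective Nat.infinite_setOfPred_prime⟩).prod (· ^ ·) := by
  rw [Finsupp.prod_embDomain]
  unfold primePow
  change PNat.coeMonoidHom _ = _
  rw [map_finsuppProd]
  rfl

/-- Unique factorization, transported along the enumeration of the primes. -/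
lemma primePow_bijective : Function.Bijective primePow := by
  have hp : ∀ (α : ℕ →₀ ℕ) p, p ∈ (α.embDomain ⟨Nat.nth Nat.Prime,
      Nat.nth_injective Nat.infinite_setOfPred_prime⟩).support → p.Prime := by
    intro α p hp
    rw [Finsupp.support_embDomain, Finset.mem_map] at hp
    obtain ⟨j, -, rfl⟩ := hp
    exact Nat.prime_nth_prime j
  constructor
  · intro α β h
    have h1 : (primePow α : ℕ).factorization = (primePow β : ℕ).factorization := by rw [h]
    rw [coe_primePow, coe_primePow, Nat.prod_pow_factorization_eq_self (hp α),
      Nat.prod_pow_factorization_eq_self (hp β)] at h1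
    exact Finsupp.embDomain_injective _ h1
  · intro n
    let e : ℕ ↪ ℕ := ⟨Nat.nth Nat.Prime, Nat.nth_injective Nat.infinite_setOfPred_prime⟩
    refine ⟨(n : ℕ).factorization.comapDomain e e.injective.injOn, PNat.coe_injective ?_⟩
    rw [coe_primePow, Finsupp.embDomain_comapDomain]
    · exact Nat.prod_factorization_pow_eq_self n.ne_zero
    · intro q hq
      have hq' : q.Prime := Nat.prime_of_mem_primeFactors (n := n) (by simpa using hq)
      exact ⟨_, Nat.nth_count hq'⟩

/-- Multi-indices correspond to positive integers. -/
def primePowEquiv : (ℕ →₀ ℕ) ≃ ℕ+ := Equiv.ofBijective primePow primePow_bijective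

lemma two_le_prime (j : ℕ) : 2 ≤ (prime j : ℕ) := (Nat.prime_nth_prime j).two_le

/-- A crude bound, enough to ensure that integers below `m` involve only the first `m` primes. -/
lemma le_primePow {α : ℕ →₀ ℕ} {j : ℕ} (h : α j ≠ 0) : j ≤ (primePow α : ℕ) := by
  have h1 : prime j ∣ primePow α := by
    unfold primePow Finsupp.prod
    exact (dvd_pow_self _ h).trans (Finset.dvd_prod_of_mem _ (Finsupp.mem_support_iff.2 h))
  have h2 : (prime j : ℕ) ≤ primePow α := PNat.le_of_dvd h1
  exact ((Nat.nth_strictMono Nat.infinite_setOfPred_prime).le_apply).trans h2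

/-! ### Hardy spaces of Dirichlet series -/

lemma enorm_torusCoeff_Lp_le {p : ℝ≥0∞} (hp : 1 ≤ p) (f : Lp X p haarTorus) (α : ℕ →₀ ℤ) :
    ‖torusCoeff f α‖ₑ ≤ ‖f‖ₑ := by
  rw [Lp.enorm_def]
  exact enorm_torusCoeff_le hp (Lp.aestronglyMeasurable f) α

lemma hardyDirichletNorm_le_hardyPlusNorm (p : ℝ≥0∞) (a : DirichletSeries X) {ε : ℝ} (hε : 0 < ε) :
    hardyDirichletNorm p (translate (ε : ℂ) a) ≤ hardyPlusNorm p a :=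
  le_iSup₂ (f := fun (ε : ℝ) (_ : 0 < ε) => hardyDirichletNorm p (translate (ε : ℂ) a)) ε hε

lemma tendsto_natCast_cpow {n : ℕ} (hn : n ≠ 0) :
    Tendsto (fun ε : ℝ => (n : ℂ) ^ (ε : ℂ)) (𝓝[>] 0) (𝓝 1) := by
  have hcont : Continuous fun ε : ℝ => (n : ℂ) ^ (ε : ℂ) :=
    Complex.continuous_ofReal.const_cpow (Or.inl (by exact_mod_cast hn))
  simpa using (hcont.tendsto 0).mono_left (nhdsWithin_le_nhds (s := Set.Ioi 0))

/-- The coefficients of `D_ε` are Fourier coefficients of its lifts; then `ε` tends to `0`. -/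
lemma enorm_coeff_le_hardyPlusNorm {p : ℝ≥0∞} (hp : 1 ≤ p) (a : DirichletSeries X) (n : ℕ+) :
    ‖a n‖ₑ ≤ hardyPlusNorm p a := by
  obtain ⟨α, rfl⟩ := primePow_bijective.2 n
  have h1 : ∀ ε : ℝ, 0 < ε → ‖translate (ε : ℂ) a (primePow α)‖ₑ ≤ hardyPlusNorm p a := by
    intro ε hε
    refine le_trans ?_ (hardyDirichletNorm_le_hardyPlusNorm p a hε)
    refine le_iInf₂ fun f hf => ?_
    rw [← hf.2 α]
    exact enorm_torusCoeff_Lp_le hp f _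
  have hlim : Tendsto (fun ε : ℝ => ‖translate (ε : ℂ) a (primePow α)‖ₑ) (𝓝[>] 0)
      (𝓝 ‖a (primePow α)‖ₑ) := by
    refine (continuous_enorm.tendsto _).comp ?_
    unfold translate
    simp only [Complex.cpow_neg]
    have h := (tendsto_natCast_cpow (primePow α).ne_zero).inv₀ one_ne_zero
    simpa using h.smul_const (a (primePow α))
  refine le_of_tendsto hlim ?_
  filter_upwards [self_mem_nhdsWithin] with ε hε using h1 ε hε

/-- As `w` has finitely many nonzero coordinates, `w_j 𝔭_j^ε` stays in the disc for small `ε`. The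
section at `w` is the dilation by this point of a lift of `D_ε`, and dilations contract `L_p`. -/
lemma sectionBound_hardyPlusNorm {p : ℝ≥0∞} (hp1 : 1 ≤ p) (hp : p ≠ ∞) (a : DirichletSeries X) :
    SectionBound p (fun α => a (primePow α)) (hardyPlusNorm p a) := by
  intro m w hw
  have hev : ∀ᶠ ε : ℝ in 𝓝[>] 0, ∀ j ∈ Finset.range m, ‖w j * ((prime j : ℕ) : ℂ) ^ (ε : ℂ)‖ < 1 := by
    rw [Filter.eventually_all_finset]
    intro j _
    have h := ((tendsto_natCast_cpow (prime j).ne_zero).const_mul (w j)).norm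
    rw [mul_one] at h
    exact h.eventually_lt_const (hw.1 j)
  obtain ⟨ε, hε, hε0⟩ := (hev.and self_mem_nhdsWithin).exists
  have hz : (fun j => w j * ((prime j : ℕ) : ℂ) ^ (ε : ℂ)) ∈ finDisc m := by
    refine ⟨fun j => ?_, fun j hj => by beta_reduce; rw [hw.2 j hj, zero_mul]⟩
    by_cases hj : j < m
    · exact hε j (Finset.mem_range.2 hj)
    · beta_reduce; rw [hw.2 j (not_lt.1 hj), zero_mul, norm_zero]; exact one_pos
  refine le_trans ?_ (hardyDirichletNorm_le_hardyPlusNorm p a hε0)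
  refine le_iInf₂ fun f hf => ?_
  have key := eLpNorm_powerSum_rot_le hp1 hp (Lp.stronglyMeasurable f) (Lp.memLp f) hf.1 hz
  rw [← Lp.enorm_def] at key
  refine le_trans (le_of_eq ?_) key
  congr 1
  ext x
  have h1 : (fun α => torusCoeff f (intIndex α)) = fun α =>
      monomial α (fun j => ((prime j : ℕ) : ℂ) ^ (-(ε : ℂ))) • a (primePow α) := by
    ext α
    rw [hf.2 α, monomial_prime_cpow]
    rfl
  rw [h1, powerSum_monomial_smul]
  congr 1
  ext j
  unfold rot
  have h2 : ((prime j : ℕ) : ℂ) ≠ 0 := by exact_mod_cast (prime j).ne_zero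
  have h3 : ((prime j : ℕ) : ℂ) ^ (ε : ℂ) ≠ 0 := by
    rw [Complex.cpow_ne_zero_iff]; exact Or.inl h2
  rw [Complex.cpow_neg]
  field_simp

/-- The point `(𝔭_1^{-s}, …, 𝔭_m^{-s}, 0, 0, …)`. -/
def primeTrunc (m : ℕ) (s : ℂ) : ℕ → ℂ := fun j => if j < m then ((prime j : ℕ) : ℂ) ^ (-s) else 0

lemma primeTrunc_of_le {m j : ℕ} (s : ℂ) (h : m ≤ j) : primeTrunc m s j = 0 := if_neg (not_lt.2 h)

lemma norm_prime_cpow (j : ℕ) (s : ℂ) :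
    ‖((prime j : ℕ) : ℂ) ^ (-s)‖ = ((prime j : ℕ) : ℝ) ^ (-s.re) := by
  rw [Complex.norm_natCast_cpow_of_pos (prime j).pos, Complex.neg_re]

lemma norm_primeTrunc_le_rpow (m j : ℕ) (s : ℂ) :
    ‖primeTrunc m s j‖ ≤ ((prime j : ℕ) : ℝ) ^ (-s.re) := by
  unfold primeTrunc
  split_ifs
  · exact (norm_prime_cpow j s).le
  · rw [norm_zero]; positivity

lemma norm_primeTrunc_le (m j : ℕ) {s : ℂ} (hs : 0 < s.re) :
    ‖primeTrunc m s j‖ ≤ 2 ^ (-s.re) :=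
  (norm_primeTrunc_le_rpow m j s).trans
    (Real.rpow_le_rpow_of_nonpos two_pos (by exact_mod_cast two_le_prime j) (by linarith))

lemma two_rpow_neg_lt_one {σ : ℝ} (hσ : 0 < σ) : (2 : ℝ) ^ (-σ) < 1 :=
  Real.rpow_lt_one_of_one_lt_of_neg one_lt_two (by linarith)

lemma primeTrunc_mem_finDisc (m : ℕ) {s : ℂ} (hs : 0 < s.re) : primeTrunc m s ∈ finDisc m :=
  ⟨fun j => (norm_primeTrunc_le m j hs).trans_lt (two_rpow_neg_lt_one hs),
    fun _ => primeTrunc_of_le s⟩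

lemma monomial_primeTrunc {m : ℕ} {α : ℕ →₀ ℕ} (hα : ∀ j, m ≤ j → α j = 0) (s : ℂ) :
    monomial α (primeTrunc m s) = ((primePow α : ℕ) : ℂ) ^ (-s) := by
  rw [← monomial_prime_cpow]
  unfold monomial
  refine Finsupp.prod_congr fun j hj => congrArg (· ^ α j) (if_pos ?_)
  by_contra h
  exact (Finsupp.mem_support_iff.1 hj) (hα j (not_lt.1 h))

/-- Monomials in further variables vanish on both sides. So a power series along truncated prime
points is a Dirichlet series, and moving the point translates it. -/
lemma monomial_primeTrunc_add (m : ℕ) (α : ℕ →₀ ℕ) (s u : ℂ) :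
    monomial α (primeTrunc m (s + u))
      = ((primePow α : ℕ) : ℂ) ^ (-u) * monomial α (primeTrunc m s) := by
  by_cases hα : ∀ j, m ≤ j → α j = 0
  · rw [monomial_primeTrunc hα, monomial_primeTrunc hα, neg_add, add_comm,
      Complex.cpow_add _ _ (by exact_mod_cast (primePow α).ne_zero)]
  · push Not at hα
    rw [monomial_eq_zero (fun _ => primeTrunc_of_le _) hα,
      monomial_eq_zero (fun _ => primeTrunc_of_le _) hα, mul_zero]

/-- The multi-index of the integer `n + 1`. -/
def indexEquiv : ℕ ≃ (ℕ →₀ ℕ) := Equiv.pnatEquivNat.symm.trans primePowEquiv.symm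

lemma primePow_indexEquiv (n : ℕ) : primePow (indexEquiv n) = n.succPNat :=
  primePowEquiv.apply_symm_apply _

lemma indexEquiv_eq_zero {n m : ℕ} (h : n + 1 < m) (j : ℕ) (hj : m ≤ j) : indexEquiv n j = 0 := by
  by_contra h0
  have := le_primePow h0
  rw [primePow_indexEquiv, Nat.succPNat_coe] at this
  omega

/-- The tails of translates of bounded power series, along the natural order of the integers
`𝔭^α`. -/
theorem exists_norm_powerSum_sub_le {ε : ℝ} (hε : 0 < ε) (hε1 : ε ≤ 1) :
    ∃ C : ℝ, 0 ≤ C ∧ ∀ {Y : Type*} [NormedAddCommGroup Y] [NormedSpace ℂ Y] [CompleteSpace Y]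
      (d : (ℕ →₀ ℕ) → Y) (B : ℝ), (∀ α, ‖d α‖ ≤ B) → ∀ (s : ℂ), 0 < s.re → ∀ (m : ℕ) (M : ℝ),
      (∀ t : ℝ, ‖powerSum d (primeTrunc m (s + t * Complex.I))‖ ≤ M) → ∀ N < m,
      ‖powerSum d (primeTrunc m (s + ε))
        - ∑ n ∈ Finset.range N, ((n.succPNat : ℕ) : ℂ) ^ (-(s + ε)) • d (indexEquiv n)‖
        ≤ C * ((N : ℝ) + 1) ^ (-(ε / 2)) * M := by
  obtain ⟨C, hC, h⟩ := exists_norm_tsum_sub_sum_range_le hε hε1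
  refine ⟨C, hC, fun {Y} _ _ _ d B hB s hs m M hM N hN => ?_⟩
  set y : ℕ → Y := fun n => monomial (indexEquiv n) (primeTrunc m s) • d (indexEquiv n) with hy
  have hsum : Summable fun n => ‖y n‖ :=
    (summable_norm_monomial_smul (primeTrunc_mem_finDisc m hs) hB).comp_injective
      indexEquiv.injective
  have hshift : ∀ (u : ℂ) (n : ℕ),
      monomial (indexEquiv n) (primeTrunc m (s + u)) • d (indexEquiv n)
        = ((n.succPNat : ℕ) : ℂ) ^ (-u) • y n := fun u n => by
    rw [monomial_primeTrunc_add, primePow_indexEquiv, mul_smul]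
  have hps : ∀ u : ℂ, powerSum d (primeTrunc m (s + u))
      = ∑' n : ℕ, ((n.succPNat : ℕ) : ℂ) ^ (-u) • y n := fun u => by
    unfold powerSum
    rw [← indexEquiv.tsum_eq]
    exact tsum_congr (hshift u)
  -- The factor `exp (i t log (n + 1)) = (n + 1)^{it}` is a translation by `-it`, so the line is run
  -- through in reverse.
  have key := h y M hsum (fun t => by
    refine le_trans (le_of_eq ?_) (hM (-t))
    rw [hps]
    congr 1
    refine tsum_congr fun n => ?_
    congr 1
    rw [Complex.cpow_def_of_ne_zero (by exact_mod_cast n.succPNat.ne_zero),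
      ← Complex.natCast_log, Nat.succPNat_coe]
    congr 1
    push_cast
    ring) N
  have hreal : ∀ n : ℕ, (((n : ℝ) + 1) ^ (-ε) : ℝ) • y n = ((n.succPNat : ℕ) : ℂ) ^ (-(ε : ℂ)) • y n := by
    intro n
    rw [← Complex.coe_smul, Complex.ofReal_cpow (by positivity), Nat.succPNat_coe]
    push_cast
    rfl
  simp only [hreal] at key
  rw [hps]
  refine le_trans (le_of_eq ?_) key
  congr 2
  -- Since `n + 1 ≤ N < m`, the truncation does not affect the first `N` terms.
  refine Finset.sum_congr rfl fun n hn => ?_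
  rw [← hshift, monomial_primeTrunc, primePow_indexEquiv]
  exact indexEquiv_eq_zero (by have := Finset.mem_range.1 hn; omega)

/-! ### Power series in `L_p` -/

/-- The function `ω ↦ ω^α c_α`. -/
def charSection (c : (ℕ →₀ ℕ) → X) (α : ℕ →₀ ℕ) : C(Torus, X) :=
  ⟨fun x => character (intIndex α) x • c α, (continuous_character _).smul continuous_const⟩

lemma norm_charSection_le (c : (ℕ →₀ ℕ) → X) (α : ℕ →₀ ℕ) : ‖charSection c α‖ ≤ ‖c α‖ := by
  refine (ContinuousMap.norm_le _ (norm_nonneg _)).2 fun x => ?_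
  change ‖character (intIndex α) x • c α‖ ≤ _
  rw [norm_smul, norm_character, one_mul]

lemma powerSum_charSection [CompleteSpace X] {m : ℕ} {w : ℕ → ℂ} (hw : w ∈ finDisc m)
    {c : (ℕ →₀ ℕ) → X} {C : ℝ} (hC : ∀ α, ‖c α‖ ≤ C) (x : Torus) :
    powerSum (charSection c) w x = powerSum c (rot w x) := by
  have h := hasSum_powerSum hw fun α => (norm_charSection_le c α).trans (hC α)
  unfold powerSum at h ⊢
  refine (ContinuousMap.hasSum_apply h x).tsum_eq.symm.trans ?_
  refine tsum_congr fun α => ?_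
  rw [monomial_rot, mul_smul]
  rfl

/-- The function `ω ↦ ω^α c_α`, in `L_p`. -/
def charLp (p : ℝ≥0∞) [Fact (1 ≤ p)] (c : (ℕ →₀ ℕ) → X) (α : ℕ →₀ ℕ) : Lp X p haarTorus :=
  ContinuousMap.toLp p haarTorus ℂ (charSection c α)

lemma norm_charLp_le {p : ℝ≥0∞} [Fact (1 ≤ p)] {c : (ℕ →₀ ℕ) → X} {C : ℝ}
    (hC : ∀ α, ‖c α‖ ≤ C) (α : ℕ →₀ ℕ) :
    ‖charLp p c α‖ ≤ ‖(ContinuousMap.toLp p haarTorus ℂ : C(Torus, X) →L[ℂ] Lp X p haarTorus)‖ * C :=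
  (ContinuousLinearMap.le_opNorm _ _).trans
    (mul_le_mul_of_nonneg_left ((norm_charSection_le c α).trans (hC α)) (norm_nonneg _))

/-- The series converges uniformly on the torus, hence in `L_p`. Section bounds thereby become norm
bounds for a power series with values in the Banach space `L_p`, to which Bohr's theorem applies. -/
lemma powerSum_charLp [CompleteSpace X] {p : ℝ≥0∞} [Fact (1 ≤ p)] {m : ℕ} {w : ℕ → ℂ}
    (hw : w ∈ finDisc m) {c : (ℕ →₀ ℕ) → X} {C : ℝ} (hC : ∀ α, ‖c α‖ ≤ C) :
    ((powerSum (charLp p c) w : Lp X p haarTorus) : Torus → X) =ᵐ[haarTorus] fun x => powerSum c (rot w x) := by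
  have h := hasSum_powerSum hw fun α => (norm_charSection_le c α).trans (hC α)
  have h1 : powerSum (charLp p c) w = ContinuousMap.toLp p haarTorus ℂ (powerSum (charSection c) w) := by
    have h2 := h.mapL (ContinuousMap.toLp p haarTorus ℂ : C(Torus, X) →L[ℂ] Lp X p haarTorus)
    rw [← h2.tsum_eq]
    simp only [map_smul]
    rfl
  rw [h1]
  filter_upwards [ContinuousMap.coeFn_toLp haarTorus (p := p) (𝕜 := ℂ) (powerSum (charSection c) w)]
    with x hx
  rw [hx, powerSum_charSection hw hC]

lemma continuous_torusCoeff {p : ℝ≥0∞} [hp : Fact (1 ≤ p)] (α : ℕ →₀ ℤ) :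
    Continuous fun f : Lp X p haarTorus => torusCoeff f α := by
  let L : Lp X p haarTorus →ₗ[ℂ] X :=
    { toFun := fun f => torusCoeff f α
      map_add' := fun f g => torusCoeff_add f g α
      map_smul' := fun r f => torusCoeff_smul r f α }
  refine (L.mkContinuous 1 fun f => ?_).continuous
  rw [one_mul]
  exact enorm_le_iff_norm_le.1 (enorm_torusCoeff_Lp_le hp.out f α)

lemma tendsto_succ_rpow_neg {δ : ℝ} (hδ : 0 < δ) (A B : ℝ) :
    Tendsto (fun N : ℕ => A * ((N : ℝ) + 1) ^ (-δ) * B) atTop (𝓝 0) := by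
  have h := (tendsto_rpow_neg_atTop hδ).comp
    (tendsto_atTop_add_const_right atTop (1 : ℝ) tendsto_natCast_atTop_atTop)
  simpa using (h.const_mul A).mul_const B

/-- On the line `Re = ε - η > 0` all sections are bounded by `M`. Translation by `η` makes the tails
of the `L_p`-valued series small uniformly in the number of primes, so the sections at `(𝔭_1^{-ε},
…, 𝔭_m^{-ε})` are a Cauchy sequence. Their limit inherits the Fourier coefficients and the bound. -/
lemma exists_mem_torusLifts [CompleteSpace X] {p : ℝ≥0∞} [hp1 : Fact (1 ≤ p)]
    {a : DirichletSeries X} {C : ℝ} (hC : ∀ n, ‖a n‖ ≤ C) {M : ℝ≥0∞} (hM : M ≠ ∞)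
    (h : SectionBound p (fun α => a (primePow α)) M) {ε : ℝ} (hε : 0 < ε) :
    ∃ f ∈ torusLifts p (translate (ε : ℂ) a), ‖f‖ₑ ≤ M := by
  set c : (ℕ →₀ ℕ) → X := fun α => a (primePow α) with hc
  have hcC : ∀ α, ‖c α‖ ≤ C := fun α => hC _
  obtain ⟨η, hη, hη1, hηε⟩ : ∃ η : ℝ, 0 < η ∧ η ≤ 1 ∧ η < ε :=
    ⟨min (ε / 2) 1, lt_min (by linarith) one_pos, min_le_right _ _,
      (min_le_left _ _).trans_lt (by linarith)⟩
  have hεre : 0 < (ε : ℂ).re := by simpa using hε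
  have hnorm : ∀ (m : ℕ) (s : ℂ), 0 < s.re → ‖powerSum (charLp p c) (primeTrunc m s)‖ₑ ≤ M := by
    intro m s hs
    have hw := primeTrunc_mem_finDisc m hs
    rw [Lp.enorm_def, eLpNorm_congr_ae (powerSum_charLp hw hcC)]
    exact h m _ hw
  obtain ⟨K, hK, hT⟩ := exists_norm_powerSum_sub_le hη hη1
  -- The shift to `m + 1` turns `N ≤ m` into the strict inequality of the tail estimate.
  set Q : ℕ → Lp X p haarTorus := fun m => powerSum (charLp p c) (primeTrunc (m + 1) ε) with hQ
  have htail : ∀ N m : ℕ, N ≤ m → ‖Q m - ∑ n ∈ Finset.range N,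
      ((n.succPNat : ℕ) : ℂ) ^ (-(ε : ℂ)) • charLp p c (indexEquiv n)‖
      ≤ K * ((N : ℝ) + 1) ^ (-(η / 2)) * M.toReal := by
    intro N m hNm
    have hs : 0 < ((ε - η : ℝ) : ℂ).re := by rw [Complex.ofReal_re]; linarith
    have h1 := hT (charLp p c) _ (norm_charLp_le hcC) ((ε - η : ℝ) : ℂ) hs (m + 1) M.toReal
      (fun t => by
        rw [← toReal_enorm]
        refine ENNReal.toReal_mono hM (hnorm _ _ ?_)
        simp only [Complex.add_re, Complex.mul_I_re, Complex.ofReal_im, neg_zero, add_zero]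
        exact hs) N (by omega)
    have h2 : (((ε - η : ℝ) : ℂ) + η) = ε := by push_cast; ring
    rwa [h2] at h1
  have hcauchy : CauchySeq Q := by
    refine cauchySeq_of_le_tendsto_0
      (fun N : ℕ => 2 * K * ((N : ℝ) + 1) ^ (-(η / 2)) * M.toReal) (fun n m N hn hm => ?_)
      (tendsto_succ_rpow_neg (by linarith) _ _)
    have h1 := htail N n hn
    have h2 := htail N m hm
    rw [dist_eq_norm]
    refine (norm_sub_le_norm_sub_add_norm_sub _ (∑ n ∈ Finset.range N,
      ((n.succPNat : ℕ) : ℂ) ^ (-(ε : ℂ)) • charLp p c (indexEquiv n)) _).trans ?_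
    rw [norm_sub_rev _ (Q m)]
    linarith
  obtain ⟨f, hf⟩ := cauchySeq_tendsto_of_complete hcauchy
  have hcoef : ∀ (m : ℕ) (β : ℕ →₀ ℤ), torusCoeff (Q m) β
      = torusCoeff (fun x => powerSum c (rot (primeTrunc (m + 1) ε) x)) β := fun m β => by
    unfold torusCoeff
    refine integral_congr_ae ?_
    filter_upwards [powerSum_charLp (p := p) (primeTrunc_mem_finDisc (m + 1) hεre) hcC] with x hx
    rw [hx]
  refine ⟨f, ⟨fun β hβ => ?_, fun α => ?_⟩, ?_⟩
  · refine tendsto_nhds_unique (((continuous_torusCoeff β).tendsto f).comp hf) ?_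
    refine tendsto_const_nhds.congr fun m => ?_
    rw [Function.comp_apply, hcoef,
      torusCoeff_powerSum_rot_of_neg (primeTrunc_mem_finDisc (m + 1) hεre) hcC β hβ]
  · refine tendsto_nhds_unique (((continuous_torusCoeff (intIndex α)).tendsto f).comp hf) ?_
    obtain ⟨N, hN⟩ := exists_forall_le_eq_zero α
    -- Once all primes occurring in `𝔭^α` are included, the coefficient at `α` no longer changes
    -- with `m`.
    refine tendsto_const_nhds.congr' ?_
    filter_upwards [eventually_ge_atTop N] with m hm
    rw [Function.comp_apply, hcoef,
      torusCoeff_powerSum_rot_intIndex (primeTrunc_mem_finDisc (m + 1) hεre) hcC,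
      monomial_primeTrunc fun j hj => hN j (by omega)]
    rfl
  · exact le_of_tendsto ((continuous_enorm.tendsto f).comp hf)
      (Eventually.of_forall fun m => hnorm _ _ hεre)

lemma mem_hardyPlus_of_sectionBound [CompleteSpace X] {p : ℝ≥0∞} [Fact (1 ≤ p)]
    {a : DirichletSeries X} {C : ℝ} (hC : ∀ n, ‖a n‖ ≤ C) {M : ℝ≥0∞} (hM : M ≠ ∞)
    (h : SectionBound p (fun α => a (primePow α)) M) :
    a ∈ HardyPlus X p ∧ hardyPlusNorm p a ≤ M := by
  have hle : hardyPlusNorm p a ≤ M := by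
    refine iSup₂_le fun ε hε => ?_
    obtain ⟨f, hf, hfM⟩ := exists_mem_torusLifts hC hM h hε
    exact (hardyDirichletNorm_le hf).trans hfM
  refine ⟨⟨fun ε hε => ?_, hle.trans_lt hM.lt_top⟩, hle⟩
  obtain ⟨f, hf, -⟩ := exists_mem_torusLifts hC hM h hε
  exact ⟨f, hf⟩

/-! ### Convergence of the Dirichlet series -/

lemma tendsto_padSeq (z : EllTwo) : Tendsto (fun m : ℕ => padSeq fun i : Fin m => z i) atTop (𝓝 z) := by
  have h := (lp.hasSum_single (p := 2) (E := fun _ : ℕ => ℂ) (by norm_num) z).tendsto_sum_nat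
  refine h.congr fun m => ?_
  rw [Finset.sum_range]
  rfl

lemma summable_prime_rpow {σ : ℝ} (hσ : 1 / 2 < σ) :
    Summable fun j : ℕ => (((prime j : ℕ) : ℝ) ^ (-σ)) ^ 2 := by
  have hsum : Summable fun n : ℕ => (n : ℝ) ^ (-(2 * σ)) :=
    Real.summable_nat_rpow.2 (by linarith)
  refine (hsum.comp_injective (Nat.nth_injective Nat.infinite_setOfPred_prime)).congr fun n => ?_
  rw [Function.comp_apply, ← Real.rpow_natCast, ← Real.rpow_mul (Nat.cast_nonneg _)]
  change _ = ((Nat.nth Nat.Prime n : ℕ) : ℝ) ^ _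
  congr 1
  push_cast
  ring

/-- A small `η` keeps `σ = Re s - η` above `1/2`. Then `∑ 𝔭_j^{-2σ}` converges, point evaluations
are bounded on the line `Re = σ` uniformly in `m`, and the translation by `η` back to `s` gives
tails independent of `m`. -/
theorem dirichletConvergesTo_of_sectionBound [CompleteSpace X] {p : ℝ≥0∞} (hp1 : 1 ≤ p)
    {a : DirichletSeries X} {C : ℝ} (hC : ∀ n, ‖a n‖ ≤ C) {M : ℝ≥0∞} (hM : M ≠ ∞)
    (h : SectionBound p (fun α => a (primePow α)) M) {F : ballEllTwo → X} (hF : Continuous F)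
    (hFa : IsBohrTransform F a) (s : ℂ) (hs : 1 / 2 < s.re) :
    DirichletConvergesTo a s (F (primeSeq s hs)) := by
  obtain ⟨η, hη, hη1, hηs⟩ : ∃ η : ℝ, 0 < η ∧ η ≤ 1 ∧ 1 / 2 < s.re - η :=
    ⟨min ((s.re - 1 / 2) / 2) 1, lt_min (by linarith) one_pos, min_le_right _ _, by
      linarith [min_le_left ((s.re - 1 / 2) / 2) 1]⟩
  set σ := s.re - η with hσ
  have hs0 : 0 < s.re := by linarith
  obtain ⟨K, hK, hT⟩ := exists_norm_powerSum_sub_le hη hη1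
  set A : ℝ := Real.exp ((∑' j : ℕ, (((prime j : ℕ) : ℝ) ^ (-σ)) ^ 2) / (1 - (2 ^ (-σ)) ^ 2))
    * M.toReal with hA
  have hbound : ∀ (m : ℕ) (u : ℂ), u.re = σ →
      ‖powerSum (fun α => a (primePow α)) (primeTrunc m u)‖ ≤ A := by
    intro m u hu
    refine h.norm_powerSum_le_exp hp1 (fun α => hC _) hM (fun j => primeTrunc_of_le u)
      (two_rpow_neg_lt_one (by linarith)) (fun j => ?_) ?_
    · rw [← hu]; exact norm_primeTrunc_le m j (by linarith)
    · refine (Finset.sum_le_sum fun j _ => ?_).trans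
        ((summable_prime_rpow hηs).sum_le_tsum _ fun j _ => by positivity)
      rw [← hu]
      exact pow_le_pow_left₀ (norm_nonneg _) (norm_primeTrunc_le_rpow m j u) 2
  have hlim : Tendsto (fun m : ℕ => powerSum (fun α => a (primePow α)) (primeTrunc m s)) atTop
      (𝓝 (F (primeSeq s hs))) := by
    have h1 : Tendsto (fun m : ℕ => pad (toPolydisc (primeTrunc_mem_finDisc m hs0))) atTop
        (𝓝 (primeSeq s hs)) := by
      rw [tendsto_subtype_rng]
      refine (tendsto_padSeq (primeSeq s hs).1).congr fun m => ?_
      change padSeq _ = padSeq _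
      congr 1
      ext i
      exact (if_pos i.2).symm
    refine ((hF.tendsto _).comp h1).congr fun m => ?_
    rw [powerSum, (HasMonomialExpansion.hasSum hFa (primeTrunc_mem_finDisc m hs0)).tsum_eq]
    rfl
  have htail : ∀ N : ℕ, ‖F (primeSeq s hs) - ∑ n ∈ Finset.range N,
      ((n.succPNat : ℕ) : ℂ) ^ (-s) • a n.succPNat‖ ≤ K * ((N : ℝ) + 1) ^ (-(η / 2)) * A := by
    intro N
    -- Here `m` tends to infinity with `N` fixed; the bound is free of `m`.
    refine le_of_tendsto (hlim.sub_const _).norm ?_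
    filter_upwards [eventually_gt_atTop N] with m hm
    have h1 := hT (fun α => a (primePow α)) C (fun α => hC _) (s - η) (by
      rw [Complex.sub_re, Complex.ofReal_re]; linarith) m A (fun t => hbound m _ (by
        simp only [Complex.add_re, Complex.sub_re, Complex.ofReal_re, Complex.mul_I_re,
          Complex.ofReal_im, neg_zero, add_zero, hσ])) N hm
    simpa only [sub_add_cancel, primePow_indexEquiv] using h1
  unfold DirichletConvergesTo
  rw [tendsto_iff_norm_sub_tendsto_zero]
  refine squeeze_zero (fun _ => norm_nonneg _) (fun N => ?_)
    (tendsto_succ_rpow_neg (δ := η / 2) (by linarith) K A)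
  rw [norm_sub_rev]
  exact htail N

/-! ### Holomorphic functions with prescribed monomial coefficients -/

/-- A quantitative first order Taylor expansion of a bounded holomorphic function. -/
lemma norm_sub_sub_fderiv_le {E Y : Type*} [NormedAddCommGroup E] [NormedSpace ℂ E]
    [NormedAddCommGroup Y] [NormedSpace ℂ Y] {f : E → Y} {z : E} {R C : ℝ} (hR : 0 < R)
    (hd : DifferentiableOn ℂ f (Metric.ball z R)) (hb : ∀ w ∈ Metric.ball z R, ‖f w‖ ≤ C) :
    ‖fderiv ℂ f z‖ ≤ 2 * C / R ∧ ∀ w ∈ Metric.ball z R,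
      ‖f w - f z - fderiv ℂ f z (w - z)‖ ≤ 4 * C * (‖w - z‖ / R) ^ 2 := by
  have hz : z ∈ Metric.ball z R := Metric.mem_ball_self hR
  have hmaps : ∀ w ∈ Metric.ball z R, ‖f w - f z‖ ≤ 2 * C := fun w hw =>
    (norm_sub_le _ _).trans (by linarith [hb w hw, hb z hz])
  have h1 : ‖fderiv ℂ f z‖ ≤ 2 * C / R :=
    Complex.norm_fderiv_le_div_of_mapsTo_ball hd
      (fun w hw => mem_closedBall_iff_norm.2 (hmaps w hw)) hR
  refine ⟨h1, fun w hw => ?_⟩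
  have hdz : HasFDerivAt f (fderiv ℂ f z) z :=
    (hd.differentiableAt (Metric.ball_mem_nhds z hR)).hasFDerivAt
  -- A Schwarz lemma of higher order: without its linear part, `f - f z` is `o(‖w - z‖)` and bounded
  -- by `2 C + 2 C`, hence quadratically small.
  have h2 := Complex.dist_le_mul_div_pow_of_mapsTo_ball_of_isLittleO (n := 1) (R₂ := 4 * C)
    (f := fun w => f w - fderiv ℂ f z (w - z)) (c := z)
    (hd.sub (((fderiv ℂ f z).differentiable.comp
      (differentiable_id.sub_const z)).differentiableOn)) (fun v hv => ?_) ?_ hw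
  · rw [dist_eq_norm, dist_eq_norm, sub_self, map_zero, sub_zero] at h2
    refine le_trans (le_of_eq ?_) h2
    congr 1
    abel
  · rw [mem_closedBall_iff_norm, sub_self, map_zero, sub_zero]
    have h3 : ‖fderiv ℂ f z (v - z)‖ ≤ 2 * C := by
      refine ((fderiv ℂ f z).le_of_opNorm_le_of_le h1 (mem_ball_iff_norm.1 hv).le).trans ?_
      rw [div_mul_cancel₀ _ hR.ne']
    have h4 : f v - fderiv ℂ f z (v - z) - f z = (f v - f z) - fderiv ℂ f z (v - z) := by abel
    rw [h4]
    exact (norm_sub_le _ _).trans (by linarith [hmaps v hv])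
  · simp only [sub_self, map_zero, sub_zero, pow_one]
    refine Asymptotics.IsLittleO.norm_right (hdz.isLittleO.congr_left fun v => ?_)
    abel

/-- A pointwise limit of uniformly bounded holomorphic functions is holomorphic. -/
lemma differentiableAt_of_tendsto_of_norm_le {E Y : Type*} [NormedAddCommGroup E]
    [NormedSpace ℂ E] [NormedAddCommGroup Y] [NormedSpace ℂ Y] [CompleteSpace Y] {f : ℕ → E → Y}
    {g : E → Y} {z : E} {R C : ℝ} (hR : 0 < R)
    (hd : ∀ i, DifferentiableOn ℂ (f i) (Metric.ball z R))
    (hb : ∀ i, ∀ w ∈ Metric.ball z R, ‖f i w‖ ≤ C)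
    (hg : ∀ w ∈ Metric.ball z R, Tendsto (fun i => f i w) atTop (𝓝 (g w))) :
    DifferentiableAt ℂ g z := by
  have hz : z ∈ Metric.ball z R := Metric.mem_ball_self hR
  have hC : 0 ≤ C := (norm_nonneg _).trans (hb 0 z hz)
  set D : ℕ → E →L[ℂ] Y := fun i => fderiv ℂ (f i) z with hD
  have h1 : ∀ i, ‖D i‖ ≤ 2 * C / R := fun i => (norm_sub_sub_fderiv_le hR (hd i) (hb i)).1
  have h2 : ∀ i, ∀ w ∈ Metric.ball z R,
      ‖f i w - f i z - D i (w - z)‖ ≤ 4 * C * (‖w - z‖ / R) ^ 2 := fun i =>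
    (norm_sub_sub_fderiv_le hR (hd i) (hb i)).2
  -- For a fixed small step `t` the difference quotients converge, and they differ from `D i v` by
  -- at most `t * A`, uniformly in `i`.
  have hcauchy : ∀ v, CauchySeq fun i => D i v := by
    intro v
    set A : ℝ := 4 * C * (‖v‖ / R) ^ 2 with hA
    have hA0 : 0 ≤ A := by positivity
    refine Metric.cauchySeq_iff'.2 fun ε hε => ?_
    obtain ⟨t, ht, htR, htA⟩ : ∃ t : ℝ, 0 < t ∧ t * ‖v‖ < R ∧ t * (2 * A) < ε / 2 := by
      have e1 : Tendsto (fun t : ℝ => t * ‖v‖) (𝓝[>] 0) (𝓝 0) := by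
        simpa using ((continuous_id.mul continuous_const).tendsto (0 : ℝ)).mono_left
          (nhdsWithin_le_nhds (s := Set.Ioi (0 : ℝ))) (f := fun t : ℝ => id t * ‖v‖)
      have e2 : Tendsto (fun t : ℝ => t * (2 * A)) (𝓝[>] 0) (𝓝 0) := by
        simpa using ((continuous_id.mul continuous_const).tendsto (0 : ℝ)).mono_left
          (nhdsWithin_le_nhds (s := Set.Ioi (0 : ℝ))) (f := fun t : ℝ => id t * (2 * A))
      exact ((eventually_mem_nhdsWithin (a := (0 : ℝ)) (s := Set.Ioi 0)).and ((e1.eventually (gt_mem_nhds hR)).and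
        (e2.eventually (gt_mem_nhds (half_pos hε))))).exists
    have hw : z + (t : ℂ) • v ∈ Metric.ball z R := by
      rw [mem_ball_iff_norm, add_sub_cancel_left, norm_smul, Complex.norm_real,
        Real.norm_of_nonneg ht.le]
      exact htR
    have h3 : ∀ i, ‖f i (z + (t : ℂ) • v) - f i z - (t : ℂ) • D i v‖ ≤ t * (t * A) := by
      intro i
      have := h2 i _ hw
      rw [add_sub_cancel_left, map_smul, norm_smul (t : ℂ) v, Complex.norm_real,
        Real.norm_of_nonneg ht.le] at this
      refine this.trans (le_of_eq ?_)
      rw [hA]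
      ring
    obtain ⟨N, hN⟩ := Metric.cauchySeq_iff'.1 ((hg _ hw).sub (hg z hz)).cauchySeq
      (t * (ε / 2)) (by positivity)
    refine ⟨N, fun n hn => ?_⟩
    have h4 := hN n hn
    rw [dist_eq_norm] at h4 ⊢
    have h5 : (t : ℂ) • (D n v - D N v)
        = ((f n (z + (t : ℂ) • v) - f n z) - (f N (z + (t : ℂ) • v) - f N z))
          - (f n (z + (t : ℂ) • v) - f n z - (t : ℂ) • D n v)
          + (f N (z + (t : ℂ) • v) - f N z - (t : ℂ) • D N v) := by
      rw [smul_sub]; abel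
    have h6 : t * ‖D n v - D N v‖ < t * ε := by
      rw [← Real.norm_of_nonneg ht.le, ← Complex.norm_real, ← norm_smul, h5, Complex.norm_real,
        Real.norm_of_nonneg ht.le]
      refine (norm_add_le _ _).trans_lt ?_
      have h7 := norm_sub_le ((f n (z + (t : ℂ) • v) - f n z) - (f N (z + (t : ℂ) • v) - f N z))
        (f n (z + (t : ℂ) • v) - f n z - (t : ℂ) • D n v)
      have h8 := h3 n
      have h9 := h3 N
      have h10 := mul_lt_mul_of_pos_left htA ht
      nlinarith
    exact lt_of_mul_lt_mul_left h6 ht.le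
  choose L hL using fun v => cauchySeq_tendsto_of_complete (hcauchy v)
  -- The derivatives are uniformly bounded, so their pointwise limit is a bounded operator; the
  -- quadratic error estimate passes to the limit as well.
  let L' : E →L[ℂ] Y := ContinuousLinearMap.ofTendstoOfBoundedRange L D (tendsto_pi_nhds.2 hL)
    ((isBounded_iff_forall_norm_le).2 ⟨2 * C / R, by rintro _ ⟨i, rfl⟩; exact h1 i⟩)
  have h3 : ∀ w ∈ Metric.ball z R,
      ‖g w - g z - L' (w - z)‖ ≤ 4 * C * (‖w - z‖ / R) ^ 2 := fun w hw =>
    le_of_tendsto (((hg w hw).sub (hg z hz)).sub (hL (w - z))).norm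
      (Eventually.of_forall fun i => h2 i w hw)
  have h4 : (fun w => g w - g z - L' (w - z)) =O[𝓝 z] fun w => ‖w - z‖ ^ 2 := by
    refine Asymptotics.IsBigO.of_bound (4 * C / R ^ 2) ?_
    filter_upwards [Metric.ball_mem_nhds z hR] with w hw
    refine (h3 w hw).trans (le_of_eq ?_)
    rw [Real.norm_of_nonneg (by positivity)]
    ring
  have h5 : DifferentiableAt ℂ (fun w => g w - g z - L' (w - z)) z :=
    (h4.hasFDerivAt one_lt_two).differentiableAt
  have h6 : DifferentiableAt ℂ (fun w => g z + L' (w - z)) z :=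
    (L'.differentiableAt.comp z (differentiableAt_id.sub_const z)).const_add _
  refine (h5.add h6).congr_of_eventuallyEq (Eventually.of_forall fun w => ?_)
  simp only [Pi.add_apply]
  abel

/-- The sequence `(z_1, …, z_m, 0, 0, …)`. -/
def trunc (m : ℕ) (z : EllTwo) : ℕ → ℂ := fun j => if j < m then z j else 0

lemma trunc_of_le {m j : ℕ} (z : EllTwo) (h : m ≤ j) : trunc m z j = 0 := if_neg (not_lt.2 h)

lemma norm_trunc_le (m : ℕ) (z : EllTwo) (j : ℕ) : ‖trunc m z j‖ ≤ ‖z j‖ := by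
  unfold trunc
  split_ifs
  · exact le_rfl
  · rw [norm_zero]; exact norm_nonneg _

lemma trunc_mem_finDisc (m : ℕ) {z : EllTwo} (hz : z ∈ ballEllTwo) : trunc m z ∈ finDisc m :=
  ⟨fun j => (norm_trunc_le m z j).trans_lt (hz j), fun _ => trunc_of_le z⟩

lemma trunc_padSeq {k m : ℕ} (h : k ≤ m) (z : EllTwo) :
    trunc m (padSeq fun i : Fin k => z i) = trunc k z := by
  ext j
  unfold trunc
  rw [padSeq_apply]
  split_ifs with h1 h2 h2
  · rfl
  · rfl
  · omega
  · rfl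

lemma trunc_pad {k m : ℕ} (h : k ≤ m) (z : polydisc k) : trunc m (pad z).1 = (pad z).1 := by
  ext j
  unfold trunc
  split_ifs with h1
  · rfl
  · rw [pad_apply_of_le z j (by omega)]

/-- Near a point of `B_{c₀} ∩ ℓ₂`, the coordinates are bounded away from `1` uniformly. -/
lemma exists_ball_norm_le {z : EllTwo} (hz : z ∈ ballEllTwo) :
    ∃ R > 0, ∃ θ : ℝ, 0 ≤ θ ∧ θ < 1 ∧ ∀ w ∈ Metric.ball z R, ∀ j, ‖w j‖ ≤ θ := by
  obtain ⟨m, hm⟩ := (Metric.tendsto_atTop.1 (tendsto_padSeq z) (1 / 2) (by norm_num))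
  obtain ⟨ρ, h0, h1, h2⟩ := exists_lt_one_forall_norm_lt (trunc_mem_finDisc m hz)
  set θ : ℝ := max ρ (1 / 2) with hθ
  have hθ1 : θ < 1 := max_lt h1 (by norm_num)
  have hzθ : ∀ j, ‖z j‖ ≤ θ := by
    intro j
    by_cases hj : j < m
    · have := (h2 j).le
      rw [trunc, if_pos hj] at this
      exact this.trans (le_max_left _ _)
    · refine le_trans ?_ (le_max_right _ _)
      have h3 := lp.norm_apply_le_norm (p := 2) (by norm_num) ((padSeq fun i : Fin m => z i) - z) j
      rw [lp.coeFn_sub, Pi.sub_apply, padSeq_apply, dif_neg hj, zero_sub, norm_neg,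
        ← dist_eq_norm] at h3
      exact h3.trans (hm m le_rfl).le
  refine ⟨(1 - θ) / 2, by linarith, (1 + θ) / 2, by linarith [h0.le.trans (le_max_left ρ (1 / 2))],
    by linarith, fun w hw j => ?_⟩
  have h3 := lp.norm_apply_le_norm (p := 2) (by norm_num) (w - z) j
  rw [lp.coeFn_sub, Pi.sub_apply] at h3
  have h4 := norm_le_norm_add_norm_sub' (w j) (z j)
  have h5 := mem_ball_iff_norm.1 hw
  linarith [hzθ j]

lemma differentiable_monomial_trunc (m : ℕ) (α : ℕ →₀ ℕ) :
    Differentiable ℂ fun z : EllTwo => monomial α (trunc m z) := by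
  have h : ∀ j, Differentiable ℂ fun z : EllTwo => trunc m z j ^ α j := by
    intro j
    suffices h : Differentiable ℂ fun z : EllTwo => trunc m z j from h.pow _
    unfold trunc
    split_ifs
    · exact (lp.evalCLM ℂ (fun _ : ℕ => ℂ) 2 j).differentiable
    · exact differentiable_const 0
  exact fun z => (HasFDerivAt.finsetProd fun j _ => (h j z).hasFDerivAt).differentiableAt

lemma norm_monomial_trunc_le {m : ℕ} {θ : ℝ} (hθ : 0 ≤ θ) {w : EllTwo} (hw : ∀ j, ‖w j‖ ≤ θ)
    (α : ℕ →₀ ℕ) : ‖monomial α (trunc m w)‖ ≤ ‖monomial α (constSeq m θ)‖ := by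
  unfold monomial Finsupp.prod
  rw [norm_prod, norm_prod]
  refine Finset.prod_le_prod (fun _ _ => norm_nonneg _) fun j _ => ?_
  rw [norm_pow, norm_pow]
  refine pow_le_pow_left₀ (norm_nonneg _) ?_ _
  unfold trunc constSeq
  split_ifs
  · rw [Complex.norm_real, Real.norm_of_nonneg hθ]; exact hw j
  · exact le_rfl

/-- The partial sums are polynomials in finitely many coordinates, dominated near `z` by the
absolutely convergent series at `(θ, …, θ, 0, …)` with `θ < 1`. -/
lemma differentiableAt_powerSum_trunc [CompleteSpace X] (m : ℕ) {c : (ℕ →₀ ℕ) → X} {C : ℝ}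
    (hC : ∀ α, ‖c α‖ ≤ C) {z : EllTwo} (hz : z ∈ ballEllTwo) :
    DifferentiableAt ℂ (fun w => powerSum c (trunc m w)) z := by
  obtain ⟨R, hR, θ, hθ, hθ1, hw⟩ := exists_ball_norm_le hz
  have hsum := (summable_norm_monomial (constSeq_mem_finDisc m hθ hθ1)).mul_right C
  refine differentiableAt_of_tendsto_of_norm_le (C := ∑' α, ‖monomial α (constSeq m θ)‖ * C)
    (f := fun N w => ∑ n ∈ Finset.range N, monomial (indexEquiv n) (trunc m w) • c (indexEquiv n))
    hR (fun N => ?_) (fun N w hwR => ?_) fun w hwR => ?_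
  · exact (Differentiable.fun_sum fun n _ =>
      (differentiable_monomial_trunc m _).smul_const _).differentiableOn
  · refine (norm_sum_le _ _).trans ?_
    rw [← indexEquiv.tsum_eq]
    refine le_trans (Finset.sum_le_sum fun n _ => ?_)
      ((indexEquiv.summable_iff.2 hsum).sum_le_tsum _ fun n _ => ?_)
    · rw [norm_smul]
      exact mul_le_mul (norm_monomial_trunc_le hθ (hw w hwR) _) (hC _) (norm_nonneg _)
        (norm_nonneg _)
    · exact mul_nonneg (norm_nonneg _) ((norm_nonneg _).trans (hC 0))
  · have hwb : w ∈ ballEllTwo := fun j => (hw w hwR j).trans_lt hθ1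
    exact (indexEquiv.hasSum_iff.2 (hasSum_powerSum (trunc_mem_finDisc m hwb) hC)).tendsto_sum_nat

/-- Bounded sections determine a holomorphic function on `B_{c₀} ∩ ℓ₂`. -/
theorem SectionBound.exists_holomorphic [CompleteSpace X] {p : ℝ≥0∞} (hp1 : 1 ≤ p)
    {c : (ℕ →₀ ℕ) → X} {C : ℝ} (hC : ∀ α, ‖c α‖ ≤ C) {M : ℝ≥0∞} (hM : M ≠ ∞)
    (h : SectionBound p c M) : ∃ F : ballEllTwo → X, Holomorphic F ∧ HasMonomialExpansion F c := by
  set V : ℕ → EllTwo → X := fun m w => powerSum c (trunc m w) with hV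
  -- Near `z` the coordinates stay below some `θ < 1` and the `ℓ₂`-norms below `‖z‖ + R`, so the
  -- evaluation bound is uniform in `m`.
  have hloc : ∀ z ∈ ballEllTwo, ∃ R > 0, ∃ K : ℝ, Metric.ball z R ⊆ ballEllTwo ∧
      ∀ m, ∀ w ∈ Metric.ball z R, ‖V m w‖ ≤ K := by
    intro z hz
    obtain ⟨R, hR, θ, hθ, hθ1, hw⟩ := exists_ball_norm_le hz
    refine ⟨R, hR, Real.exp ((‖z‖ + R) ^ 2 / (1 - θ ^ 2)) * M.toReal,
      fun w hwR j => (hw w hwR j).trans_lt hθ1, fun m w hwR => ?_⟩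
    refine h.norm_powerSum_le_exp hp1 hC hM (fun j => trunc_of_le w) hθ1
      (fun j => (norm_trunc_le m w j).trans (hw w hwR j)) ?_
    have h1 := lp.sum_rpow_le_norm_rpow (p := 2) (by norm_num) w (Finset.range m)
    simp only [ENNReal.toReal_ofNat, Real.rpow_two] at h1
    refine (Finset.sum_le_sum fun j _ =>
      pow_le_pow_left₀ (norm_nonneg _) (norm_trunc_le m w j) 2).trans (h1.trans ?_)
    refine pow_le_pow_left₀ (norm_nonneg _) ?_ 2
    have h2 := norm_le_norm_add_norm_sub' w z
    have h3 := mem_ball_iff_norm.1 hwR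
    linarith
  have hdiff : ∀ m, ∀ z ∈ ballEllTwo, DifferentiableAt ℂ (V m) z := fun m z hz =>
    differentiableAt_powerSum_trunc m hC hz
  have hcauchy : ∀ z ∈ ballEllTwo, CauchySeq fun m => V m z := by
    intro z hz
    obtain ⟨R, hR, K, hRb, hK⟩ := hloc z hz
    -- The uniform bound makes the `V m` equi-Lipschitz at `z`. At the truncation of `z` to `k`
    -- coordinates every `V m` with `m ≥ k` takes the value `V k z`, so `V m z` is close to `V k z`.
    have hlip : ∀ m, ∀ w ∈ Metric.ball z R, dist (V m w) (V m z) ≤ 2 * K / R * dist w z :=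
      fun m w hw => Complex.dist_le_div_mul_dist_of_mapsTo_ball
        (fun v hv => (hdiff m v (hRb hv)).differentiableWithinAt)
        (fun v hv => mem_closedBall_iff_norm.2 ((norm_sub_le _ _).trans (by
          linarith [hK m v hv, hK m z (Metric.mem_ball_self hR)]))) hw
    have ht : Tendsto (fun k => 2 * K / R * dist (padSeq fun i : Fin k => z i) z) atTop (𝓝 0) := by
      simpa using (tendsto_iff_dist_tendsto_zero.1 (tendsto_padSeq z)).const_mul (2 * K / R)
    refine Metric.cauchySeq_iff'.2 fun ε hε => ?_
    obtain ⟨k, hk, hkε⟩ := (((tendsto_padSeq z).eventually (Metric.ball_mem_nhds z hR)).and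
      (ht.eventually (gt_mem_nhds hε))).exists
    refine ⟨k, fun m hm => ?_⟩
    have h1 := hlip m _ hk
    have h2 : V m (padSeq fun i : Fin k => z i) = V k z := by
      simp only [hV, trunc_padSeq hm]
    rw [h2, dist_comm] at h1
    exact h1.trans_lt hkε
  choose! G hG using fun z (hz : z ∈ ballEllTwo) => cauchySeq_tendsto_of_complete (hcauchy z hz)
  refine ⟨fun z => G z.1, ⟨G, fun z hz => ?_, fun _ => rfl⟩, fun m z => ?_⟩
  · obtain ⟨R, hR, K, hRb, hK⟩ := hloc z hz
    exact (differentiableAt_of_tendsto_of_norm_le hR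
      (fun m v hv => (hdiff m v (hRb hv)).differentiableWithinAt) hK
      fun w hw => hG w (hRb hw)).differentiableWithinAt
  · have h1 : G (pad z).1 = powerSum c (pad z).1 := by
      refine tendsto_nhds_unique (hG _ (pad z).2) (tendsto_const_nhds.congr' ?_)
      filter_upwards [eventually_ge_atTop m] with k hk
      simp only [hV, trunc_pad hk]
    have h2 := hasSum_powerSum (pad_mem_finDisc z) hC
    rw [← h1] at h2
    exact h2

/-! ### The Bohr transform -/

/-- The expansion fixes the values at finitely supported points, which are dense. -/
lemma HasMonomialExpansion.ext {F G : ballEllTwo → X} (hF : Continuous F) (hG : Continuous G)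
    {c : (ℕ →₀ ℕ) → X} (hFc : HasMonomialExpansion F c) (hGc : HasMonomialExpansion G c) :
    F = G := by
  funext z
  have h1 : Tendsto (fun m : ℕ => pad (m := m) ⟨fun i => z.1 i, fun i => z.2 i⟩) atTop (𝓝 z) := by
    rw [tendsto_subtype_rng]
    exact tendsto_padSeq z.1
  refine tendsto_nhds_unique ((hF.tendsto z).comp h1) (((hG.tendsto z).comp h1).congr fun m => ?_)
  exact (hGc m _).unique (hFc m _)

lemma HasMonomialExpansion.add {F G : ballEllTwo → X} {c d : (ℕ →₀ ℕ) → X}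
    (hF : HasMonomialExpansion F c) (hG : HasMonomialExpansion G d) :
    HasMonomialExpansion (F + G) (c + d) := fun m z => by
  simpa only [Pi.add_apply, smul_add] using (hF m z).add (hG m z)

lemma HasMonomialExpansion.smul {F : ballEllTwo → X} {c : (ℕ →₀ ℕ) → X} (r : ℂ)
    (hF : HasMonomialExpansion F c) : HasMonomialExpansion (r • F) (r • c) := fun m z => by
  simpa only [Pi.smul_apply, smul_comm r] using (hF m z).const_smul r

lemma IsBohrTransform.unique [CompleteSpace X] {F : ballEllTwo → X} {a b : DirichletSeries X}
    (ha : IsBohrTransform F a) (hb : IsBohrTransform F b) : a = b := by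
  funext n
  obtain ⟨α, rfl⟩ := primePow_bijective.2 n
  exact congrFun (HasMonomialExpansion.unique ha hb) α

lemma exists_isBohrTransform [CompleteSpace X] {F : ballEllTwo → X} (hF : Holomorphic F) :
    ∃ a, IsBohrTransform F a := by
  obtain ⟨c, hc⟩ := exists_hasMonomialExpansion hF
  refine ⟨fun n => c (primePowEquiv.symm n), ?_⟩
  have h : (fun α => c (primePowEquiv.symm (primePow α))) = c :=
    funext fun α => congrArg c (primePowEquiv.symm_apply_apply α)
  unfold IsBohrTransform
  rwa [h]

lemma IsBohrTransform.norm_le [CompleteSpace X] {p : ℝ≥0∞} (hp1 : 1 ≤ p)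
    {F : ballEllTwo → X} (hF : Continuous F) (hM : hardyBallNorm p F ≠ ∞) {a : DirichletSeries X}
    (ha : IsBohrTransform F a) (n : ℕ+) : ‖a n‖ ≤ (hardyBallNorm p F).toReal := by
  obtain ⟨α, rfl⟩ := primePow_bijective.2 n
  exact exists_norm_le_of_enorm_le hM (enorm_coeff_le_hardyBallNorm hp1 hF ha) α

lemma IsBohrTransform.sectionBound [CompleteSpace X] {p : ℝ≥0∞} (hp1 : 1 ≤ p) (hp : p ≠ ∞)
    {F : ballEllTwo → X} (hF : Continuous F) (hM : hardyBallNorm p F ≠ ∞) {a : DirichletSeries X}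
    (ha : IsBohrTransform F a) :
    SectionBound p (fun α => a (primePow α)) (hardyBallNorm p F) :=
  sectionBound_hardyBallNorm hp1 hp hF ha fun _ => ha.norm_le hp1 hF hM _

/-- The Bohr transform as a map into `𝓗⁺_p(X)`. -/
theorem exists_bohrTransform_linearMap [CompleteSpace X] {p : ℝ≥0∞} [hp1 : Fact (1 ≤ p)]
    (hp : p ≠ ∞) :
    ∃ B : HardyBall X p →ₗ[ℂ] HardyPlus X p, ∀ F, IsBohrTransform F.1 (B F).1 := by
  -- Uniqueness of the coefficients makes the chosen map linear.
  choose a ha using fun F : HardyBall X p => exists_isBohrTransform F.2.1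
  have hmem : ∀ F, a F ∈ HardyPlus X p := fun F =>
    (mem_hardyPlus_of_sectionBound ((ha F).norm_le hp1.out F.2.1.continuous F.2.2.ne) F.2.2.ne
      ((ha F).sectionBound hp1.out hp F.2.1.continuous F.2.2.ne)).1
  exact ⟨
    { toFun := fun F => ⟨a F, hmem F⟩
      map_add' := fun F G => Subtype.ext ((ha (F + G)).unique (HasMonomialExpansion.add (ha F) (ha G)))
      map_smul' := fun r F => Subtype.ext ((ha (r • F)).unique (HasMonomialExpansion.smul r (ha F))) },
    ha⟩

theorem exists_hardyBall_of_mem_hardyPlus [CompleteSpace X] {p : ℝ≥0∞} [hp1 : Fact (1 ≤ p)]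
    (hp : p ≠ ∞) {a : DirichletSeries X} (ha : a ∈ HardyPlus X p) :
    ∃ F ∈ HardyBall X p, IsBohrTransform F a := by
  have hb := sectionBound_hardyPlusNorm hp1.out hp a
  obtain ⟨F, hF, hFc⟩ := hb.exists_holomorphic hp1.out
    (fun α => exists_norm_le_of_enorm_le ha.2.ne (enorm_coeff_le_hardyPlusNorm hp1.out a) (primePow α))
    ha.2.ne
  exact ⟨F, ⟨hF, (hardyBallNorm_le_of_sectionBound hF.continuous hFc hb).trans_lt ha.2⟩, hFc⟩

/-- Each of the two norms is a bound for the sections, and each is at most any finite such bound; so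
they agree. -/
lemma IsBohrTransform.hardyPlusNorm_eq [CompleteSpace X] {p : ℝ≥0∞} [hp1 : Fact (1 ≤ p)]
    (hp : p ≠ ∞) {F : ballEllTwo → X} (hF : Continuous F) (hM : hardyBallNorm p F ≠ ∞)
    {a : DirichletSeries X} (ha : IsBohrTransform F a) :
    hardyPlusNorm p a = hardyBallNorm p F :=
  le_antisymm (mem_hardyPlus_of_sectionBound (ha.norm_le hp1.out hF hM) hM
      (ha.sectionBound hp1.out hp hF hM)).2
    (hardyBallNorm_le_of_sectionBound hF ha (sectionBound_hardyPlusNorm hp1.out hp a))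

end BohrHardy

end

theorem mainTheorem7 (X : Type*) [NormedAddCommGroup X] [NormedSpace ℂ X] [CompleteSpace X]
    (p : ENNReal) [Fact (1 ≤ p)] (hp : p ≠ ⊤) :
    ∃ B : BohrHardy.HardyBall X p ≃ₗ[ℂ] BohrHardy.HardyPlus X p,
      (∀ (F : BohrHardy.HardyBall X p) (a : BohrHardy.DirichletSeries X),
        BohrHardy.IsBohrTransform F.1 a ↔ (B F).1 = a) ∧
      (∀ F : BohrHardy.HardyBall X p,
        BohrHardy.hardyPlusNorm p (B F).1 = BohrHardy.hardyBallNorm p F.1) ∧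
      (∀ (F : BohrHardy.HardyBall X p) (s : ℂ) (hs : 1 / 2 < s.re),
        BohrHardy.DirichletConvergesTo (B F).1 s (F.1 (BohrHardy.primeSeq s hs))) := by
  obtain ⟨B, hB⟩ := BohrHardy.exists_bohrTransform_linearMap (X := X) hp
  have hp1 : 1 ≤ p := Fact.out
  have hinj : Function.Injective B := fun F G h =>
    Subtype.ext (BohrHardy.HasMonomialExpansion.ext F.2.1.continuous G.2.1.continuous (hB F)
      (h ▸ hB G))
  have hsurj : Function.Surjective B := fun a => by
    obtain ⟨F, hF, hFa⟩ := BohrHardy.exists_hardyBall_of_mem_hardyPlus hp a.2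
    exact ⟨⟨F, hF⟩, Subtype.ext ((hB ⟨F, hF⟩).unique hFa)⟩
  refine ⟨LinearEquiv.ofBijective B ⟨hinj, hsurj⟩, fun F a => ⟨fun h => (hB F).unique h, fun h => ?_⟩,
    fun F => (hB F).hardyPlusNorm_eq hp F.2.1.continuous F.2.2.ne, fun F s hs => ?_⟩
  · exact h ▸ hB F
  · exact BohrHardy.dirichletConvergesTo_of_sectionBound hp1
      ((hB F).norm_le hp1 F.2.1.continuous F.2.2.ne) F.2.2.ne
      ((hB F).sectionBound hp1 hp F.2.1.continuous F.2.2.ne) F.2.1.continuous (hB F) s hs
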